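/- For $n\ge 0$ let $\mathrm{Sig}_n$ be the set of weakly decreasing $n$-tuples $\lambda=(\lambda_1\ge\dots\ge\lambda_n)$ of integers, $\mathrm{Sig}_n^+$ the subset of those with all parts nonnegative, $|\lambda|=\sum_i\lambda_i$, $m_k(\lambda)=\#\{i:\lambda_i=k\}$, and $0[n]=(0,\dots,0)\in \mathrm{Sig}_n$. For $\lambda\in\mathrm{Sig}_n$ the Hall–Littlewood (Laurent) polynomial is $$P_\lambda(x_1,\dots,x_n;t)=\frac1{V_\lambda(t)}\sum_{\sigma\in S_n}\sigma\Big(x_1^{\lambda_1}\cdots x_n^{\lambda_n}\prod_{1\le i<j\le n}\frac{x_i-tx_j}{x_i-x_j}\Big),\qquad V_\lambda(t)=\prod_{k\in\mathbb Z}\frac{(1-t)(1-t^2)\cdots(1-t^{m_k(\lambda)})}{(1-t)^{m_k(\lambda)}}.$$ For $\nu,\lambda\in\mathrm{Sig}_n$ write $\nu\prec_Q\lambda$ if $\lambda_i\ge\nu_i$ for $1\le i\le n$ and $\nu_i\ge\lambda_{i+1}$ for $1\le i\le n-1$; put $\varphi_{\lambda/\nu}(t)=\prod_{k\in\mathbb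 Z:\ m_k(\lambda)=m_k(\nu)+1}(1-t^{m_k(\lambda)})$. For $k\ge 0$ the skew Hall–Littlewood polynomial is $$Q_{\lambda/\nu}(x_1,\dots,x_k;t)=\sum_{\nu=\lambda^{(0)}\prec_Q\lambda^{(1)}\prec_Q\cdots\prec_Q\lambda^{(k)}=\lambda}\ \prod_{i=1}^k x_i^{|\lambda^{(i)}|-|\lambda^{(i-1)}|}\varphi_{\lambda^{(i)}/\lambda^{(i-1)}}(t).$$ Let $t$ and the $x_i$ be indeterminates, let $m,n\ge 0$ and $\lambda,\nu\in\mathrm{Sig}_n$. 1. For every $\mu\in\mathrm{Sig}_{2n}$ there are unique coefficients $c^{\mathrm{alt},\kappa}_{\mu,\nu}(t)\in\mathbb{Q}(t)$, $\kappa\in\mathrm{Sig}_n$, all but finitely many zero, with $$P_\mu(x_1,x_1t,\dots,x_n,x_nt;t)\,P_\nu(x_1,\dots,x_n;t^2)=\sum_{\kappa\in\mathrm{Sig}_n}c^{\mathrm{alt},\kappa}_{\mu,\nu}(t)\,P_\kappa(x_1,\dots,x_n;t^2);$$ they lie in $\mathbb Z[t,t^{-1}]$, and in $\mathbb Z[t]$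 if $\mu\in\mathrm{Sig}_{2n}^+$. For every $\mu\in\mathrm{Sig}_n$ there are unique coefficients $c^{\mathrm{her},\kappa}_{\mu,\nu}(t)\in\mathbb{Q}(t)$, $\kappa\in\mathrm{Sig}_n$, all but finitely many zero, with $$P_\mu(x_1^2,\dots,x_n^2;t^2)\,P_\nu(x_1,\dots,x_n;-t)=\sum_{\kappa\in\mathrm{Sig}_n}c^{\mathrm{her},\kappa}_{\mu,\nu}(t)\,P_\kappa(x_1,\dots,x_n;-t);$$ they lie in $\mathbb Z[t]$. 2. For only finitely many $\mu\in\mathrm{Sig}_{2n}^+$ is $c^{\mathrm{alt},\lambda}_{\mu,\nu}(t)\neq0$, for only finitely many $\mu\in\mathrm{Sig}_n^+$ is $c^{\mathrm{her},\lambda}_{\mu,\nu}(t)\ne 0$, and $$\sum_{\mu\in\mathrm{Sig}_{2n}^+}c^{\mathrm{alt},\lambda}_{\mu,\nu}(t)\,Q_{\mu/0[2n]}(x_1,\dots,x_m;t)=Q_{\lambda/\nu}(x_1,\dots,x_m;t^2),$$ $$\sum_{\mu\in\mathrm{Sig}_n^+}c^{\mathrm{her},\lambda}_{\mu,\nu}(t)\,Q_{\mu/0[n]}(x_1^2,\dots,x_m^2;t^2)=Q_{\lambda/\nu}(x_1,-x_1,\dots,x_m,-x_m;-t).$$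 -/

import Mathlib

namespace HallLittlewood

/-- Integer signatures of length `n`: weakly decreasing `n`-tuples of integers. -/
abbrev Sig (n : ℕ) : Type := {l : Fin n → ℤ // Antitone l}

/-- Signatures all of whose parts are nonnegative. -/
def SigPos (n : ℕ) : Set (Sig n) := {l | ∀ i, 0 ≤ l.1 i}

/-- The signature `(0, …, 0)` of length `n`. -/
def Sig.zero (n : ℕ) : Sig n := ⟨fun _ => 0, fun _ _ _ => le_rfl⟩

/-- `|l|`, the sum of the parts. -/
def Sig.size {n : ℕ} (l : Sig n) : ℤ := ∑ i, l.1 i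

/-- `m_k(l)`, the number of parts equal to `k`. -/
def Sig.mult {n : ℕ} (l : Sig n) (k : ℤ) : ℕ := (Finset.univ.filter fun i => l.1 i = k).card

/-- The finite set of values taken by the parts of `l`. -/
def Sig.values {n : ℕ} (l : Sig n) : Finset ℤ := Finset.univ.image l.1

/-- `V_m(t) = (1 - t)(1 - t ^ 2) ⋯ (1 - t ^ m) / (1 - t) ^ m`. -/
def V {K : Type*} [Field K] (m : ℕ) (t : K) : K :=
  (∏ i ∈ Finset.range m, (1 - t ^ (i + 1))) / (1 - t) ^ m

/-- `V_l(t) = ∏_{k ∈ ℤ} V_{m_k(l)}(t)`; as `V_0 = 1`, only the values of the parts contribute. -/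
def VSig {K : Type*} [Field K] {n : ℕ} (l : Sig n) (t : K) : K :=
  ∏ k ∈ l.values, V (l.mult k) t

/-- The Hall-Littlewood polynomial `P_l(y_1, …, y_n; t)`, by its symmetrization formula, at
pairwise distinct nonzero elements `y_i` of a field and a parameter `t` with `V_l(t) ≠ 0`
(below, `t` is generic and the `y_i` are pairwise distinct nonzero rational functions, so no
denominator vanishes). -/
def hallP {K : Type*} [Field K] {n : ℕ} (l : Sig n) (y : Fin n → K) (t : K) : K :=
  (VSig l t)⁻¹ * ∑ σ : Equiv.Perm (Fin n),
    (∏ i, y (σ i) ^ l.1 i) *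
      ∏ p ∈ (Finset.univ : Finset (Fin n × Fin n)).filter (fun p => p.1 < p.2),
        (y (σ p.1) - t * y (σ p.2)) / (y (σ p.1) - y (σ p.2))

/-- `ν ≺_Q l`: `l_i ≥ ν_i` for all `i`, and `ν_i ≥ l_{i+1}` whenever `i + 1` is an index. -/
def InterlaceQ {n : ℕ} (ν l : Sig n) : Prop :=
  (∀ i, ν.1 i ≤ l.1 i) ∧ ∀ i j : Fin n, (j : ℕ) = (i : ℕ) + 1 → l.1 j ≤ ν.1 i

/-- The branching coefficient `φ_{l/ν}(t)`, the product of `1 - t ^ m_k(l)` over all integers `k`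
with `m_k(l) = m_k(ν) + 1` (such a `k` is necessarily a part of `l`). -/
def phi {R : Type*} [CommRing R] {n : ℕ} (l ν : Sig n) (t : R) : R :=
  ∏ k ∈ l.values.filter (fun k => l.mult k = ν.mult k + 1), (1 - t ^ l.mult k)

/-- Gelfand-Tsetlin patterns `ν = T_0 ≺_Q T_1 ≺_Q ⋯ ≺_Q T_k = l`. -/
def GTQ {n : ℕ} (k : ℕ) (l ν : Sig n) : Set (Fin (k + 1) → Sig n) :=
  {T | T 0 = ν ∧ T (Fin.last k) = l ∧ ∀ i : Fin k, InterlaceQ (T i.castSucc) (T i.succ)}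

theorem GTQ_finite {n : ℕ} (k : ℕ) (l ν : Sig n) : (GTQ k l ν).Finite := by
  have hinj : Function.Injective
      (fun (T : Fin (k + 1) → Sig n) (i : Fin (k + 1)) => (T i).1) := by
    intro T S h
    funext i
    exact Subtype.ext (congrFun h i)
  refine Set.Finite.subset (Set.Finite.preimage hinj.injOn
    (Set.finite_Icc (fun _ : Fin (k + 1) => ν.1) (fun _ => l.1))) ?_
  rintro T ⟨h0, h1, h⟩
  have hm : Monotone fun i => (T i).1 := Fin.monotone_iff_le_succ.2 fun i => (h i).1
  refine ⟨fun i => ?_, fun i => ?_⟩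
  · have := hm (Fin.zero_le i)
    simpa [h0] using this
  · have := hm (Fin.le_last i)
    simpa [h1] using this

/-- The skew Hall-Littlewood polynomial `Q_{l/ν}(x_1, …, x_k; t)`, as a sum over Gelfand-Tsetlin
patterns. The exponents `|T_i| - |T_{i-1}|` are nonnegative, since consecutive signatures
interlace. -/
noncomputable def skewQ {R : Type*} [CommRing R] {n k : ℕ} (l ν : Sig n) (x : Fin k → R) (t : R) :
    R :=
  ∑ T ∈ (GTQ_finite k l ν).toFinset,
    ∏ i : Fin k, (x i ^ ((T i.succ).size - (T i.castSucc).size).toNat *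
      phi (T i.succ) (T i.castSucc) t)

/-- The sequence `(a_1, b_1, a_2, b_2, …, a_n, b_n)`. -/
def interleave {R : Type*} {n : ℕ} (a b : Fin n → R) : Fin (2 * n) → R := fun i =>
  if (i : ℕ) % 2 = 0 then a ⟨i / 2, by omega⟩ else b ⟨i / 2, by omega⟩

/-- The field of rational functions in `t`, the fraction field of `ℤ[t]`. -/
abbrev Ft : Type := RatFunc ℤ

/-- The field of rational functions in `x_1, …, x_n` over the rational functions in `t`; it
contains the Laurent polynomials in `x_1, …, x_n` with coefficients in `ℤ[t]`. -/
abbrev Fx (n : ℕ) : Type := FractionRing (MvPolynomial (Fin n) Ft)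

/-- The indeterminate `t` as an element of `Fx n`. -/
noncomputable def tvar (n : ℕ) : Fx n := algebraMap Ft (Fx n) RatFunc.X

/-- The indeterminate `x_i` as an element of `Fx n`. -/
noncomputable def xvar {n : ℕ} (i : Fin n) : Fx n :=
  algebraMap (MvPolynomial (Fin n) Ft) (Fx n) (MvPolynomial.X i)

/-- `P_μ(x_1, x_1 t, …, x_n, x_n t; t) P_ν(x; t²) = ∑_l c_l P_l(x; t²)`. -/
def IsAltExpansion {n : ℕ} (μ : Sig (2 * n)) (ν : Sig n) (c : Sig n →₀ Ft) : Prop :=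
  hallP μ (interleave xvar fun i => xvar i * tvar n) (tvar n) * hallP ν xvar (tvar n ^ 2) =
    c.sum fun l a => algebraMap Ft (Fx n) a * hallP l xvar (tvar n ^ 2)

/-- `P_μ(x_1², …, x_n²; t²) P_ν(x; -t) = ∑_l c_l P_l(x; -t)`. -/
def IsHerExpansion {n : ℕ} (μ ν : Sig n) (c : Sig n →₀ Ft) : Prop :=
  hallP μ (fun i => xvar i ^ 2) (tvar n ^ 2) * hallP ν xvar (-tvar n) =
    c.sum fun l a => algebraMap Ft (Fx n) a * hallP l xvar (-tvar n)

open Classical in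
/-- The alternating Littlewood-Richardson coefficients: `altLR μ ν l` is the coefficient of
`P_l(x; t²)`. -/
noncomputable def altLR {n : ℕ} (μ : Sig (2 * n)) (ν : Sig n) : Sig n →₀ Ft :=
  if h : ∃ c, IsAltExpansion μ ν c then h.choose else 0

open Classical in
/-- The Hermitian Littlewood-Richardson coefficients: `herLR μ ν l` is the coefficient of
`P_l(x; -t)`. -/
noncomputable def herLR {n : ℕ} (μ ν : Sig n) : Sig n →₀ Ft :=
  if h : ∃ c, IsHerExpansion μ ν c then h.choose else 0

/-- The subring `ℤ[t]` of the field of rational functions in `t`. -/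
noncomputable def Zt : Subring Ft := (algebraMap (Polynomial ℤ) Ft).range

end HallLittlewood

/-!
# Alternating and Hermitian Littlewood-Richardson coefficients

Both identities compare two Cauchy kernels. The skew Cauchy identity
`∑_l Q_{l/ν}(u; t) P_l(y; t) = ∏_{i,j} (1 - t u_i y_j) / (1 - u_i y_j) · P_ν(y; t)` is applied to `ν`
on the one hand, and to the zero signature after a change of variables on the other hand. The kernel
for the parameter `t` at the variables `y_j, t y_j` is
`∏ (1 - t² u_i y_j) / (1 - u_i y_j)`, since the factors `1 - t u_i y_j` cancel, and this is the kernel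
for `t²` at the variables `y_j`. The kernel for `t²` at `u_i²` and `y_j²` is the kernel for `-t` at
`u_i, -u_i` and `y_j`. Hence `∑_μ Q_{μ/0} P_μ P_ν` equals `∑_l Q_{l/ν} P_l` in both cases; expanding
the products `P_μ P_ν` and comparing the coefficients of the linearly independent `P_l` gives the
result (`Generic.alt_identity`, `Generic.her_identity`). To stay with finite sums, the `u_i` are
taken to be nilpotent, namely the variables of a polynomial ring modulo a power of the ideal they
generate, and identities are compared modulo all such powers (`finsum_mul_eq`).

The skew Cauchy identity follows from the Pieri rule (`pieri`) by induction on the number of `u_i`.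
Pieri rules are derived from the symmetrization formula. The symmetrization is written as a recursive
operator `sym` on lists of one-variable functions, with increasing exponents, and the only tool is a
relation between adjacent entries (`sym_adjacent`). Multiplying by the kernel multiplies each
entry by `(1 - t u y) / (1 - u y)`; the resulting series are expanded from the smallest exponent on,
and what exceeds the next exponent is moved to the next entry (`sym_full_eq_sum`).

Multiplying each entry by `1 + u y` instead shows that the product of an elementary symmetric and a
Hall-Littlewood polynomial is a combination of Hall-Littlewood polynomials with coefficients in
`ℤ[t]` (`elem_mul_listP_mem`), with a leading term that raises maximal entries only
(`elem_mul_listP_sub_mem`). By induction, a Hall-Littlewood polynomial is a polynomial in the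
elementary symmetric ones, with a leading monomial that determines its index. As the elementary
symmetric polynomials are algebraically independent, this proves linear independence
(`linearIndependent_listP`), hence uniqueness of the expansions. The elementary symmetric polynomials
of `y_j, t y_j` and of `y_j²` are polynomials in those of the `y_j`. So multiplication by the
corresponding `P_μ` preserves the span of the Hall-Littlewood polynomials over `ℤ[t]`, or over
`ℤ[t, t⁻¹]` if inverses of the variables `t y_j` are involved, and raises the degree by a fixed amount
(`hallP_interleave_mem_stab`, `hallP_sq_mem_stab`). This gives existence and integrality of the
expansions, and finiteness since the degree of `P_μ` is determined by those of `P_ν` and `P_l`.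
-/

namespace HallLittlewood

/-! ### Hall-Littlewood symmetrization of lists of one-variable functions -/

section Symmetrization

variable {K A : Type*} [Field K] [CommRing A] [Algebra K A]

open Classical in
/-- The Hall-Littlewood symmetrization of `f_1(y_1) ⋯ f_k(y_k)` over the elements of a finite set
`Y`, as a recursion that chooses the argument of the head of the list first. The head of the list
corresponds to the *last* variable in the usual convention, so exponents appear in increasing
order. -/
noncomputable def sym (t : K) : List (K → A) → Finset K → A
  | [], _ => 1
  | f :: fs, Y => ∑ y ∈ Y,
      algebraMap K A (∏ z ∈ Y.erase y, (z - t * y) / (z - y)) * f y * sym t fs (Y.erase y)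

variable (t : K)

theorem sym_nil (Y : Finset K) : sym t ([] : List (K → A)) Y = 1 := by rw [sym]

open Classical in
theorem sym_cons (f : K → A) (fs : List (K → A)) (Y : Finset K) :
    sym t (f :: fs) Y = ∑ y ∈ Y,
      algebraMap K A (∏ z ∈ Y.erase y, (z - t * y) / (z - y)) * f y * sym t fs (Y.erase y) := by
  rw [sym]

/-- The symmetrization as a linear function of one entry of the list. -/
noncomputable def slot (w r : List (K → A)) (Y : Finset K) : (K → A) →ₗ[A] A where
  toFun f := sym t (w ++ f :: r) Y
  map_add' f g := by
    classical
    induction w generalizing Y with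
    | nil => simp only [List.nil_append, sym_cons, Pi.add_apply, mul_add, add_mul,
        Finset.sum_add_distrib]
    | cons h w ih => simp only [List.cons_append, sym_cons, ih, mul_add, Finset.sum_add_distrib]
  map_smul' c f := by
    classical
    induction w generalizing Y with
    | nil =>
      simp only [List.nil_append, sym_cons, Pi.smul_apply, smul_eq_mul, Finset.mul_sum,
        RingHom.id_apply]
      exact Finset.sum_congr rfl fun y _ => by ring
    | cons h w ih =>
      simp only [List.cons_append, sym_cons, ih, smul_eq_mul, Finset.mul_sum, RingHom.id_apply]
      exact Finset.sum_congr rfl fun y _ => by ring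

theorem slot_apply (w r : List (K → A)) (Y : Finset K) (f : K → A) :
    slot t w r Y f = sym t (w ++ f :: r) Y := rfl

/-- If the difference `δ` of two products of adjacent entries has `(b - t a) δ(a, b)` symmetric,
then the two products have the same symmetrization: the factor of the kernel belonging to the two
arguments is `(b - t a) / (b - a)`, which turns this symmetry into an antisymmetry. -/
theorem sym_adjacent (w r : List (K → A)) (Y : Finset K) (f g f' g' : K → A)
    (h : ∀ a ∈ Y, ∀ b ∈ Y, algebraMap K A (b - t * a) * (f a * g b - f' a * g' b) =
      algebraMap K A (a - t * b) * (f b * g a - f' b * g' a)) :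
    sym t (w ++ f :: g :: r) Y = sym t (w ++ f' :: g' :: r) Y := by
  classical
  induction w generalizing Y with
  | cons k w ih =>
    simp only [List.cons_append, sym_cons]
    refine Finset.sum_congr rfl fun y _ => ?_
    rw [ih _ fun a ha b hb => h a (Finset.mem_of_mem_erase ha) b (Finset.mem_of_mem_erase hb)]
  | nil =>
    simp only [List.nil_append, sym_cons, Finset.mul_sum]
    rw [← sub_eq_zero, ← Finset.sum_sub_distrib]
    simp only [← Finset.sum_sub_distrib]
    rw [Finset.sum_sigma']
    refine Finset.sum_involution (fun p _ => ⟨p.2, p.1⟩) ?_ ?_ ?_ ?_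
    · rintro ⟨a, b⟩ hp
      simp only [Finset.mem_sigma, Finset.mem_erase] at hp
      obtain ⟨ha, hba, hb⟩ := hp
      have hb' : b ∈ Y.erase a := Finset.mem_erase.2 ⟨hba, hb⟩
      have ha' : a ∈ Y.erase b := Finset.mem_erase.2 ⟨hba.symm, ha⟩
      simp only []
      rw [← Finset.mul_prod_erase _ _ hb', ← Finset.mul_prod_erase _ _ ha',
        Finset.erase_right_comm (a := b)]
      set E := (Y.erase a).erase b
      have hx := h a ha b hb
      have h1 : (b - t * a) / (b - a) = (b - a)⁻¹ * (b - t * a) := by rw [div_eq_inv_mul]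
      have h2 : (a - t * b) / (a - b) = -((b - a)⁻¹ * (a - t * b)) := by
        rw [div_eq_inv_mul, ← neg_sub b a, inv_neg, neg_mul]
      rw [h1, h2]
      simp only [map_mul, map_neg]
      linear_combination (algebraMap K A (b - a)⁻¹ *
        algebraMap K A (∏ z ∈ E, (z - t * a) / (z - a)) *
        algebraMap K A (∏ z ∈ E, (z - t * b) / (z - b)) * sym t r E) * hx
    · rintro ⟨a, b⟩ hp _ heq
      simp only [Finset.mem_sigma, Finset.mem_erase] at hp
      simp only [Sigma.mk.injEq, heq_eq_eq] at heq
      exact hp.2.1 heq.1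
    · rintro ⟨a, b⟩ hp
      simp only [Finset.mem_sigma, Finset.mem_erase] at hp ⊢
      exact ⟨hp.2.2, Ne.symm hp.2.1, hp.1⟩
    · rintro ⟨a, b⟩ hp
      rfl

theorem sym_congr_slot (w r : List (K → A)) (Y : Finset K) (f f' : K → A)
    (h : ∀ a ∈ Y, f a = f' a) : sym t (w ++ f :: r) Y = sym t (w ++ f' :: r) Y := by
  classical
  induction w generalizing Y with
  | cons k w ih =>
    simp only [List.cons_append, sym_cons]
    refine Finset.sum_congr rfl fun y _ => ?_
    rw [ih _ fun a ha => h a (Finset.mem_of_mem_erase ha)]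
  | nil =>
    simp only [List.nil_append, sym_cons]
    exact Finset.sum_congr rfl fun y hy => by rw [h y hy]

/-- Multiplying every entry by the same one-variable function multiplies the symmetrization by a
symmetric product. -/
theorem sym_map_mul {ι : Type*} (g : K → A) (F G : ι → K → A) (l : List ι) (Y : Finset K)
    (h : ∀ i, ∀ y ∈ Y, F i y = g y * G i y) (hl : l.length = Y.card) :
    sym t (l.map F) Y = (∏ y ∈ Y, g y) * sym t (l.map G) Y := by
  classical
  induction l generalizing Y with
  | nil =>
    have : Y = ∅ := by rw [← Finset.card_eq_zero, ← hl, List.length_nil]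
    simp [this, sym_nil]
  | cons i l ih =>
    simp only [List.map_cons, sym_cons, Finset.mul_sum]
    refine Finset.sum_congr rfl fun y hy => ?_
    rw [ih _ (fun i z hz => h i z (Finset.mem_of_mem_erase hz))
      (by rw [Finset.card_erase_of_mem hy, ← hl]; simp), ← Finset.mul_prod_erase _ _ hy, h i y hy]
    ring

theorem sym_algebraMap (l : List (K → K)) (Y : Finset K) :
    sym t (l.map fun f y => algebraMap K A (f y)) Y = algebraMap K A (sym t l Y) := by
  classical
  induction l generalizing Y with
  | nil => simp [sym_nil]
  | cons f l ih =>
    simp only [List.map_cons, sym_cons, ih, map_sum, map_mul, Algebra.algebraMap_self,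
      RingHom.id_apply]

/-- `∏_{i=1}^m (1 + t + ⋯ + t^{i-1})`, the `t`-analogue of `m!`. -/
def tfact (t : K) (m : ℕ) : K := ∏ i ∈ Finset.range m, ∑ j ∈ Finset.range (i + 1), t ^ j

theorem tfact_succ (m : ℕ) :
    tfact t (m + 1) = tfact t m * ∑ j ∈ Finset.range (m + 1), t ^ j := by
  rw [tfact, Finset.prod_range_succ, tfact]

open Classical in
/-- A partial fraction identity: the leading coefficient of `∏_z (z - t x)`, a polynomial in `x`,
by Lagrange interpolation at the points of `Y` and at `0`. -/
theorem sum_prod_div (ht : t ≠ 1) (Y : Finset K) (h0 : (0 : K) ∉ Y) :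
    ∑ y ∈ Y, ∏ z ∈ Y.erase y, (z - t * y) / (z - y) = ∑ j ∈ Finset.range Y.card, t ^ j := by
  set f : K → Polynomial K := fun z => Polynomial.C z - Polynomial.C t * Polynomial.X with hf
  have hf1 : ∀ z, (f z).natDegree ≤ 1 := fun z =>
    (Polynomial.natDegree_sub_le _ _).trans (max_le (by simp)
      ((Polynomial.natDegree_C_mul_le _ _).trans Polynomial.natDegree_X_le))
  have hP : (∏ z ∈ Y, f z).natDegree ≤ Y.card := by
    refine (Polynomial.natDegree_prod_le _ _).trans ?_
    simpa using Finset.sum_le_card_nsmul Y _ 1 fun z _ => hf1 z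
  have hc : (∏ z ∈ Y, f z).coeff Y.card = (-t) ^ Y.card := by
    have := Polynomial.coeff_prod_of_natDegree_le (s := Y) (f := f) (n := 1) fun z _ => hf1 z
    rw [mul_one] at this
    rw [this]
    simp [hf, Polynomial.coeff_C]
  have hcard : (insert 0 Y).card = Y.card + 1 := Finset.card_insert_of_notMem h0
  have key := Lagrange.coeff_eq_sum (s := insert 0 Y) (v := id) (Function.injective_id.injOn)
    (P := ∏ z ∈ Y, f z) (by
      rw [hcard]
      refine lt_of_le_of_lt Polynomial.degree_le_natDegree ?_
      exact_mod_cast Nat.lt_succ_of_le hP)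
  rw [hcard, Nat.add_sub_cancel, hc, Finset.sum_insert h0, Finset.erase_insert h0] at key
  have e0 : (∏ z ∈ Y, f z).eval (id 0) / ∏ j ∈ Y, (id 0 - id j) = (-1) ^ Y.card := by
    rw [Polynomial.eval_prod, ← Finset.prod_div_distrib, ← Finset.prod_const]
    refine Finset.prod_congr rfl fun z hz => ?_
    have : z ≠ 0 := fun h => h0 (h ▸ hz)
    simp [hf]
    field_simp
  have e1 : ∀ y ∈ Y, (∏ z ∈ Y, f z).eval (id y) / ∏ j ∈ (insert 0 Y).erase y, (id y - id j) =
      -((-1) ^ Y.card * (1 - t)) * ∏ z ∈ Y.erase y, (z - t * y) / (z - y) := by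
    intro y hy
    have hy0 : y ≠ 0 := fun h => h0 (h ▸ hy)
    rw [Finset.erase_insert_of_ne hy0.symm, Finset.prod_insert (by simp [h0]),
      Polynomial.eval_prod, ← Finset.mul_prod_erase _ _ hy, mul_div_mul_comm,
      ← Finset.prod_div_distrib]
    have : ∀ z ∈ Y.erase y, (f z).eval (id y) / (id y - id z) =
        (-1) * ((z - t * y) / (z - y)) := by
      intro z hz
      have : z - y ≠ 0 := sub_ne_zero.2 (Finset.ne_of_mem_erase hz)
      have h2 : y - z ≠ 0 := sub_ne_zero.2 (Finset.ne_of_mem_erase hz).symm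
      simp only [hf, Polynomial.eval_sub, Polynomial.eval_C, Polynomial.eval_mul,
        Polynomial.eval_X, id]
      field_simp
      ring
    rw [Finset.prod_congr rfl this, Finset.prod_mul_distrib, Finset.prod_const]
    have hk : Y.card = (Y.erase y).card + 1 := (Finset.card_erase_add_one hy).symm
    have h1 : (f y).eval (id y) / (id y - id 0) = 1 - t := by
      simp [hf]
      field_simp
    rw [h1, hk, pow_succ]
    ring
  rw [e0, Finset.sum_congr rfl e1, ← Finset.mul_sum] at key
  have ht' : 1 - t ≠ 0 := sub_ne_zero.2 ht.symm
  apply mul_left_cancel₀ ht'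
  rw [mul_neg_geom_sum]
  have hs : ((-1 : K) ^ Y.card) * (-1) ^ Y.card = 1 := by rw [← mul_pow]; simp
  have hn : (-t) ^ Y.card = (-1) ^ Y.card * t ^ Y.card := by rw [← mul_pow]; simp
  rw [hn] at key
  linear_combination (-1) ^ Y.card * key -
    (t ^ Y.card - 1 + (1 - t) * ∑ y ∈ Y, ∏ z ∈ Y.erase y, (z - t * y) / (z - y)) * hs

/-- The symmetrization of the constant `1`: a constant, by `sum_prod_div` and induction. -/
theorem sym_one (ht : t ≠ 1) (n : ℕ) (Y : Finset K) (h0 : (0 : K) ∉ Y) (hn : Y.card = n) :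
    sym t (List.replicate n (1 : K → K)) Y = tfact t n := by
  classical
  induction n generalizing Y with
  | zero => simp [sym_nil, tfact]
  | succ n ih =>
    rw [List.replicate_succ, sym_cons, tfact_succ, ← hn, ← sum_prod_div t ht Y h0, Finset.mul_sum]
    refine Finset.sum_congr rfl fun y hy => ?_
    rw [ih _ (fun h => h0 (Finset.mem_of_mem_erase h)) (by
      rw [Finset.card_erase_of_mem hy, hn, Nat.add_sub_cancel])]
    simp [mul_comm]

end Symmetrization
end HallLittlewood
namespace HallLittlewood

/-! ### The Pieri rule for lists -/

section Pieri

variable {K A : Type*} [Field K] [CommRing A] [Algebra K A]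

/-- The one-variable function `y ↦ y ^ a` with values in an algebra. -/
def pw (a : ℤ) : K → A := fun y => algebraMap K A (y ^ a)

variable (t : K) (u : A) (γ : K → A)

/-- The series `(1 - t) ∑_{i ≥ 1} u ^ i y ^ (p + i)`, where `γ y` stands for the inverse of
`1 - u y`. -/
def tail (p : ℤ) : K → A := fun y =>
  algebraMap K A ((1 - t) * y ^ p) * (u * algebraMap K A y * γ y)

/-- The series `y ^ p (1 - t u y) / (1 - u y)`, where `γ y` stands for the inverse of `1 - u y`. -/
def full (p : ℤ) : K → A := pw p + tail t u γ p

variable {γ}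

theorem full_apply (hγ : ∀ y, (1 - u * algebraMap K A y) * γ y = 1) (p : ℤ) (y : K) :
    full t u γ p y = (1 - algebraMap K A t * u * algebraMap K A y) * γ y * pw p y := by
  simp only [full, pw, tail, Pi.add_apply, map_mul, map_sub, map_one]
  linear_combination (-algebraMap K A (y ^ p)) * hγ y

/-- The tail at `q` is a sum of monomials up to degree `p` plus a multiple of the tail at `p`, so
that in front of an entry `p` only exponents in `[q, p]` and the tail at `p` remain. -/
theorem tail_eq_sum (hγ : ∀ y, (1 - u * algebraMap K A y) * γ y = 1) {q p : ℤ} (hqp : q ≤ p)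
    {y : K} (hy : y ≠ 0) :
    tail t u γ q y =
      ((∑ a ∈ Finset.Ioc q p, (algebraMap K A (1 - t) * u ^ (a - q).toNat) • pw a) +
        u ^ (p - q).toNat • tail t u γ p : K → A) y := by
  induction p, hqp using Int.leInduction with
  | base => simp
  | succ p hqp ih =>
    have h1 : Finset.Ioc q (p + 1) = insert (p + 1) (Finset.Ioc q p) := by
      ext x; simp only [Finset.mem_Ioc, Finset.mem_insert]; omega
    have h2 : (p + 1 - q).toNat = (p - q).toNat + 1 := by omega
    rw [ih, h1, Finset.sum_insert (by simp), h2]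
    simp only [Pi.add_apply, Pi.smul_apply, smul_eq_mul, pw, tail, zpow_add_one₀ hy, map_mul,
      map_sub, map_one]
    linear_combination (u ^ (p - q).toNat * (1 - algebraMap K A t) * algebraMap K A (y ^ p) * u *
      algebraMap K A y) * hγ y

/-- A tail passes a series with the same exponent, at the cost of a factor `t`, and leaves a
monomial behind. -/
theorem sym_tail_full (hγ : ∀ y, (1 - u * algebraMap K A y) * γ y = 1) (w r : List (K → A))
    (Y : Finset K) (p : ℤ) :
    sym t (w ++ tail t u γ p :: full t u γ p :: r) Y =
      algebraMap K A t * sym t (w ++ pw p :: tail t u γ p :: r) Y := by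
  have h : algebraMap K A t * sym t (w ++ pw p :: tail t u γ p :: r) Y =
      sym t (w ++ (algebraMap K A t • pw p) :: tail t u γ p :: r) Y := by
    rw [← slot_apply, ← slot_apply, map_smul, smul_eq_mul]
  rw [h]
  refine sym_adjacent t w r Y _ _ _ _ fun a _ b _ => ?_
  have key : ∀ a b : K, tail t u γ p a * full t u γ p b -
      (algebraMap K A t • pw p) a * tail t u γ p b = algebraMap K A (a - t * b) *
        (algebraMap K A ((1 - t) * (a ^ p * b ^ p)) * u * γ a * γ b) := by
    intro a b
    rw [full_apply t u hγ]
    simp only [tail, pw, Pi.smul_apply, smul_eq_mul, map_mul, map_sub, map_one]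
    linear_combination (algebraMap K A t * algebraMap K A (a ^ p) * (1 - algebraMap K A t) *
      algebraMap K A (b ^ p) * (u * algebraMap K A b * γ b)) * hγ a
  rw [key, key, mul_comm (a ^ p)]
  ring

/-- The coefficients arising from moving series through the list: `α` and `β` are the coefficients
of the power and of the tail in the entry that is processed. -/
noncomputable def pieriCoeff (t : K) : K → K → List ℤ → List ℤ → K
  | α, β, [q], [a] => if a = q then α else (1 - t) * β
  | α, β, q :: p :: r, a :: l =>
    pieriCoeff t (if a = q then α else (1 - t) * β)
      ((if a = q then α else (1 - t) * β) + if a = p then t * β else 0) (p :: r) l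
  | _, _, _, _ => 1

/-- The lists `l` interlacing the list `q_1, …, q_k`, that is `q_i ≤ l_i ≤ q_{i+1}`, with last
entry at most `q_k + D`. -/
noncomputable def interlacing (D : ℕ) : List ℤ → Finset (List ℤ)
  | [] => {[]}
  | [q] => (Finset.Icc q (q + D)).image fun a => [a]
  | q :: p :: r => (Finset.Icc q p ×ˢ interlacing D (p :: r)).image fun x => x.1 :: x.2

theorem mem_interlacing_singleton {D : ℕ} {q : ℤ} {l : List ℤ} :
    l ∈ interlacing D [q] ↔ ∃ a, q ≤ a ∧ a ≤ q + D ∧ l = [a] := by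
  simp [interlacing, and_assoc, eq_comm]

theorem mem_interlacing_cons {D : ℕ} {q p : ℤ} {r l : List ℤ} :
    l ∈ interlacing D (q :: p :: r) ↔
      ∃ a l', q ≤ a ∧ a ≤ p ∧ l' ∈ interlacing D (p :: r) ∧ l = a :: l' := by
  simp [interlacing, and_assoc, eq_comm]

theorem sum_interlacing_singleton {M : Type*} [AddCommMonoid M] (D : ℕ) (q : ℤ)
    (f : List ℤ → M) :
    ∑ l ∈ interlacing D [q], f l = ∑ a ∈ Finset.Icc q (q + D), f [a] := by
  rw [interlacing, Finset.sum_image fun a _ b _ h => by simpa using h]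

theorem sum_interlacing_cons {M : Type*} [AddCommMonoid M] (D : ℕ) (q p : ℤ) (r : List ℤ)
    (f : List ℤ → M) :
    ∑ l ∈ interlacing D (q :: p :: r), f l =
      ∑ a ∈ Finset.Icc q p, ∑ l ∈ interlacing D (p :: r), f (a :: l) := by
  rw [interlacing, Finset.sum_image fun a _ b _ h => by simpa [Prod.ext_iff] using h,
    Finset.sum_product]

theorem sum_le_sum_of_mem_interlacing {D : ℕ} {r l : List ℤ} (h : l ∈ interlacing D r) :
    r.sum ≤ l.sum := by
  induction r generalizing l with
  | nil => simp [interlacing] at h; simp [h]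
  | cons q r ih =>
    cases r with
    | nil =>
      obtain ⟨a, ha, -, rfl⟩ := mem_interlacing_singleton.1 h
      simpa using ha
    | cons p r =>
      obtain ⟨a, l', ha, -, hl', rfl⟩ := mem_interlacing_cons.1 h
      have := ih hl'
      simp only [List.sum_cons] at this ⊢
      omega

/-- The symmetrization of a product of series, expanded into symmetrizations of monomials: the
entries are processed in increasing order, and the tail of each is moved to the next one by
`tail_eq_sum` and `sym_tail_full`. -/
theorem sym_full_eq_sum (hγ : ∀ y, (1 - u * algebraMap K A y) * γ y = 1) {D : ℕ}
    (hD : u ^ (D + 1) = 0) (Y : Finset K) (h0 : (0 : K) ∉ Y) (r : List ℤ) (q : ℤ) (α β : K)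
    (w : List (K → A)) (hr : (q :: r).IsChain (· ≤ ·)) :
    sym t (w ++ (algebraMap K A α • pw q + algebraMap K A β • tail t u γ q) ::
        r.map (full t u γ)) Y =
      ∑ l ∈ interlacing D (q :: r), algebraMap K A (pieriCoeff t α β (q :: r) l) *
        u ^ (l.sum - (q :: r).sum).toNat * sym t (w ++ l.map pw) Y := by
  induction r generalizing q α β w with
  | nil =>
    rw [List.map_nil, sum_interlacing_singleton]
    rw [← slot_apply, map_add, map_smul, map_smul, slot_apply t w [] Y (tail t u γ q),
      sym_congr_slot t w [] Y _ _ fun y hy => tail_eq_sum t u hγ (show q ≤ q + D by omega)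
        (fun h => h0 (h ▸ hy)), ← slot_apply, map_add, map_sum, map_smul]
    -- beyond the last entry the tail is cut off by the nilpotency of `u`
    have hz : u ^ (q + D - q).toNat • slot t w [] Y (tail t u γ (q + D)) = 0 := by
      have : tail t u γ (q + D) = u • fun y : K =>
          algebraMap K A ((1 - t) * y ^ (q + D)) * (algebraMap K A y * γ y) := by
        funext y; simp only [tail, Pi.smul_apply, smul_eq_mul]; ring
      rw [this, map_smul, smul_smul, ← pow_succ, show (q + D - q).toNat = D by omega, hD, zero_smul]
    have hI : Finset.Icc q (q + D) = insert q (Finset.Ioc q (q + D)) := by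
      ext x; simp only [Finset.mem_Icc, Finset.mem_Ioc, Finset.mem_insert]; omega
    rw [hz, add_zero, hI, Finset.sum_insert (by simp), Finset.smul_sum]
    congr 1
    · simp [pieriCoeff, slot_apply]
    · refine Finset.sum_congr rfl fun a ha => ?_
      have : a ≠ q := by have := Finset.mem_Ioc.1 ha; omega
      simp only [map_smul, smul_eq_mul, pieriCoeff, if_neg this, List.sum_cons, List.sum_nil,
        List.map_cons, List.map_nil, slot_apply, add_zero, map_mul]
      ring
  | cons p r ih =>
    have hqp : q ≤ p := by simpa using (List.isChain_cons_cons.1 hr).1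
    have hpr := (List.isChain_cons_cons.1 hr).2
    rw [List.map_cons, sum_interlacing_cons]
    have hstep : ∀ a ∈ Finset.Icc q p, ∑ l ∈ interlacing D (p :: r),
        algebraMap K A (pieriCoeff t α β (q :: p :: r) (a :: l)) *
          u ^ ((a :: l).sum - (q :: p :: r).sum).toNat * sym t (w ++ (a :: l).map pw) Y =
        u ^ (a - q).toNat * sym t (w ++ pw a ::
          (algebraMap K A (if a = q then α else (1 - t) * β) • pw p +
          algebraMap K A ((if a = q then α else (1 - t) * β) + if a = p then t * β else 0) •
            tail t u γ p) :: r.map (full t u γ)) Y := by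
      intro a ha
      have := ih p (if a = q then α else (1 - t) * β)
        ((if a = q then α else (1 - t) * β) + if a = p then t * β else 0) (w ++ [pw a]) hpr
      simp only [List.append_assoc, List.cons_append, List.nil_append] at this
      rw [this, Finset.mul_sum]
      refine Finset.sum_congr rfl fun l hl => ?_
      have hs := sum_le_sum_of_mem_interlacing hl
      have e : ((a :: l).sum - (q :: p :: r).sum).toNat =
          (a - q).toNat + (l.sum - (p :: r).sum).toNat := by
        have := Finset.mem_Icc.1 ha
        simp only [List.sum_cons] at hs ⊢
        omega
      rw [e, pow_add, pieriCoeff, List.map_cons]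
      ring
    rw [Finset.sum_congr rfl hstep]
    have hsplit : ∀ a, sym t (w ++ pw a ::
          (algebraMap K A (if a = q then α else (1 - t) * β) • pw p +
          algebraMap K A ((if a = q then α else (1 - t) * β) + if a = p then t * β else 0) •
            tail t u γ p) :: r.map (full t u γ)) Y =
        algebraMap K A (if a = q then α else (1 - t) * β) *
          sym t (w ++ pw a :: full t u γ p :: r.map (full t u γ)) Y +
        if a = p then algebraMap K A (t * β) *
          sym t (w ++ pw a :: tail t u γ p :: r.map (full t u γ)) Y else 0 := by
      intro a
      have h1 : ∀ f : K → A, sym t (w ++ pw a :: f :: r.map (full t u γ)) Y =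
          slot t (w ++ [pw a]) (r.map (full t u γ)) Y f := fun f => by
        rw [slot_apply]; simp
      simp only [h1, full, map_add, map_smul, smul_eq_mul]
      split_ifs <;> simp <;> ring
    simp only [hsplit, mul_add, Finset.sum_add_distrib, mul_ite, mul_zero, Finset.sum_ite_eq',
      Finset.mem_Icc, hqp, le_refl, and_self, if_true]
    have hI : Finset.Icc q p = insert q (Finset.Ioc q p) := by
      ext x; simp only [Finset.mem_Icc, Finset.mem_Ioc, Finset.mem_insert]; omega
    rw [← slot_apply, map_add, map_smul, map_smul, slot_apply t _ _ Y (tail t u γ q),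
      sym_congr_slot t w _ Y _ _ fun y hy => tail_eq_sum t u hγ hqp
        (fun h => h0 (h ▸ hy)), ← slot_apply, map_add, map_sum, map_smul,
      slot_apply t _ _ Y (tail t u γ p), sym_tail_full t u hγ, hI, Finset.sum_insert (by simp)]
    have h2 : ∀ a ∈ Finset.Ioc q p, u ^ (a - q).toNat *
        (algebraMap K A (if a = q then α else (1 - t) * β) *
          sym t (w ++ pw a :: full t u γ p :: r.map (full t u γ)) Y) =
        algebraMap K A β * slot t w (full t u γ p :: r.map (full t u γ)) Y
          ((algebraMap K A (1 - t) * u ^ (a - q).toNat) • pw a) := by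
      intro a ha
      have : a ≠ q := by have := Finset.mem_Ioc.1 ha; omega
      rw [map_smul, if_neg this, slot_apply, smul_eq_mul, map_mul]
      ring
    rw [Finset.sum_congr rfl h2, ← Finset.mul_sum]
    simp only [slot_apply, smul_eq_mul, sub_self, Int.toNat_zero, pow_zero, if_true, map_mul]
    ring

/-- The contribution to `φ_{l/ν}(t) V_ν(t) / V_l(t)` of a value which occurs `x` times in `l` and
`y` times in `ν`. -/
noncomputable def localWeight (t : K) (x y : ℕ) : K :=
  (if x = y + 1 then 1 - t ^ x else 1) * tfact t y / tfact t x

theorem one_sub_ne_zero (ht : ∀ m, 0 < m → t ^ m ≠ 1) : 1 - t ≠ 0 :=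
  sub_ne_zero.2 fun h => ht 1 one_pos (by rw [pow_one, h])

theorem geom_ne_zero (ht : ∀ m, 0 < m → t ^ m ≠ 1) (m : ℕ) :
    ∑ j ∈ Finset.range (m + 1), t ^ j ≠ 0 := by
  intro h
  have := mul_neg_geom_sum t (m + 1)
  rw [h, mul_zero] at this
  exact ht (m + 1) m.succ_pos (sub_eq_zero.1 this.symm).symm

theorem tfact_ne_zero (ht : ∀ m, 0 < m → t ^ m ≠ 1) (m : ℕ) : tfact t m ≠ 0 :=
  Finset.prod_ne_zero_iff.2 fun i _ => geom_ne_zero t ht i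

theorem localWeight_self (ht : ∀ m, 0 < m → t ^ m ≠ 1) (m : ℕ) : localWeight t m m = 1 := by
  rw [localWeight, if_neg (by omega), one_mul, div_self (tfact_ne_zero t ht m)]

theorem localWeight_succ_left (ht : ∀ m, 0 < m → t ^ m ≠ 1) (m : ℕ) :
    localWeight t (m + 1) m = 1 - t := by
  rw [localWeight, if_pos rfl, tfact_succ, ← mul_neg_geom_sum]
  have := tfact_ne_zero t ht m
  have := geom_ne_zero t ht m
  field_simp

theorem localWeight_succ_right (ht : ∀ m, 0 < m → t ^ m ≠ 1) (m : ℕ) :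
    (1 - t) * localWeight t m (m + 1) = 1 - t ^ (m + 1) := by
  rw [localWeight, if_neg (by omega), tfact_succ, ← mul_neg_geom_sum]
  have := tfact_ne_zero t ht m
  field_simp

/-- For lists `l`, `ν` with entries in `T`, the ratio `φ_{l/ν}(t) V_ν(t) / V_l(t)`. -/
noncomputable def pairWeight (t : K) (T : Finset ℤ) (l ν : List ℤ) : K :=
  ∏ k ∈ T, localWeight t (l.count k) (ν.count k)

/-- Invariant of the recursion `pieriCoeff` after processing entries `w'` into `w`, when `q` is the
next entry: `α` is the weight of the processed part, and the ratio `β / α` depends on whether an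
entry of `w` has reached `q` from below. -/
def PieriInvariant (t : K) (T : Finset ℤ) (α β : K) (q : ℤ) (w w' : List ℤ) : Prop :=
  α = pairWeight t T w w' ∧ (∀ x ∈ w, x ≤ q) ∧ (∀ x ∈ w', x ≤ q) ∧
    (w.count q = w'.count q ∧ (1 - t) * β = α * (1 - t ^ (w'.count q + 1)) ∨
      w.count q = w'.count q + 1 ∧ (1 - t) * β = α)

variable {t}

theorem PieriInvariant.weight_snoc (ht : ∀ m, 0 < m → t ^ m ≠ 1) {T : Finset ℤ} {α β : K} {q : ℤ}
    {w w' : List ℤ} (h : PieriInvariant t T α β q w w') {a : ℤ} (hq : q ∈ T) (ha : a ∈ T)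
    (hqa : q ≤ a) :
    (if a = q then α else (1 - t) * β) = pairWeight t T (w ++ [a]) (w' ++ [q]) := by
  obtain ⟨rfl, hw, hw', h⟩ := h
  have h1t := one_sub_ne_zero t ht
  split_ifs with haq
  · subst haq
    refine Finset.prod_congr rfl fun k _ => ?_
    by_cases hk : k = a
    · subst hk
      simp only [List.count_append, List.count_singleton_self]
      rcases h with ⟨h, -⟩ | ⟨h, -⟩
      · rw [h, localWeight_self t ht, localWeight_self t ht]
      · rw [h, localWeight_succ_left t ht, localWeight_succ_left t ht]
    · simp [List.count_append, Ne.symm hk]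
  · have hlt : q < a := by omega
    have haT : a ∈ T.erase q := Finset.mem_erase.2 ⟨haq, ha⟩
    have c1 : w.count a = 0 := List.count_eq_zero.2 fun hm => by have := hw _ hm; omega
    have c2 : w'.count a = 0 := List.count_eq_zero.2 fun hm => by have := hw' _ hm; omega
    unfold pairWeight at h ⊢
    rw [← Finset.mul_prod_erase _ _ hq, ← Finset.mul_prod_erase _ _ haT] at h ⊢
    have hr : ∏ k ∈ (T.erase q).erase a, localWeight t ((w ++ [a]).count k) ((w' ++ [q]).count k) =
        ∏ k ∈ (T.erase q).erase a, localWeight t (w.count k) (w'.count k) := by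
      refine Finset.prod_congr rfl fun k hk => ?_
      simp only [Finset.mem_erase] at hk
      simp [List.count_append, Ne.symm hk.1, Ne.symm hk.2.1]
    rw [hr]
    have e1 : (w ++ [a]).count q = w.count q := by simp [List.count_append, haq]
    have e2 : (w' ++ [q]).count q = w'.count q + 1 := by simp [List.count_append]
    have e3 : (w ++ [a]).count a = 1 := by simp [List.count_append, c1]
    have e4 : (w' ++ [q]).count a = 0 := by simp [List.count_append, c2, Ne.symm haq]
    rw [e1, e2, e3, e4]
    have l1 := localWeight_succ_left t ht 0
    rw [c1, c2, localWeight_self t ht, one_mul] at h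
    rw [zero_add] at l1
    rw [l1]
    rcases h with ⟨h, hb⟩ | ⟨h, hb⟩
    · rw [h] at hb ⊢
      rw [localWeight_self t ht, one_mul] at hb
      rw [hb]
      linear_combination (-∏ k ∈ (T.erase q).erase a, localWeight t (w.count k) (w'.count k)) *
        localWeight_succ_right t ht (w'.count q)
    · rw [h] at hb ⊢
      rw [localWeight_succ_left t ht] at hb
      rw [localWeight_self t ht, hb, one_mul]

theorem PieriInvariant.step (ht : ∀ m, 0 < m → t ^ m ≠ 1) {T : Finset ℤ} {α β : K} {q : ℤ}
    {w w' : List ℤ} (h : PieriInvariant t T α β q w w') {a p : ℤ} (hq : q ∈ T) (ha : a ∈ T)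
    (hqa : q ≤ a) (hap : a ≤ p) :
    PieriInvariant t T (if a = q then α else (1 - t) * β)
      ((if a = q then α else (1 - t) * β) + if a = p then t * β else 0) p (w ++ [a])
      (w' ++ [q]) := by
  have hW := h.weight_snoc ht hq ha hqa
  obtain ⟨-, hw, hw', h⟩ := h
  refine ⟨hW, ?_, ?_, ?_⟩
  · simp only [List.mem_append, List.mem_singleton]
    rintro x (hx | rfl)
    · exact (hw x hx).trans (hqa.trans hap)
    · exact hap
  · simp only [List.mem_append, List.mem_singleton]
    rintro x (hx | rfl)
    · exact (hw' x hx).trans (hqa.trans hap)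
    · exact hqa.trans hap
  · by_cases hqp : q = p
    · obtain rfl : a = q := by omega
      subst hqp
      simp only [if_true, List.count_append, List.count_singleton_self]
      rcases h with ⟨h, hb⟩ | ⟨h, hb⟩
      · left
        exact ⟨by rw [h], by linear_combination t * hb⟩
      · right
        exact ⟨by rw [h], by linear_combination t * hb⟩
    · have c1 : w.count p = 0 := List.count_eq_zero.2 fun hm => by have := hw _ hm; omega
      have c2 : w'.count p = 0 := List.count_eq_zero.2 fun hm => by have := hw' _ hm; omega
      have e2 : (w' ++ [q]).count p = 0 := by simp [List.count_append, c2, hqp]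
      by_cases hap' : a = p
      · right
        subst hap'
        rw [e2]
        refine ⟨by simp [List.count_append, c1], ?_⟩
        rw [if_neg (Ne.symm hqp), if_pos rfl]
        ring
      · left
        rw [e2]
        refine ⟨by simp [List.count_append, c1, hap'], ?_⟩
        rw [if_neg hap']
        ring

/-- The recursively defined coefficients have a product formula. -/
theorem PieriInvariant.pieriCoeff_eq (ht : ∀ m, 0 < m → t ^ m ≠ 1) {T : Finset ℤ} {D : ℕ}
    {r : List ℤ} {α β : K} {q : ℤ} {w w' l : List ℤ} (h : PieriInvariant t T α β q w w')
    (hl : l ∈ interlacing D (q :: r)) (hT : ∀ x ∈ q :: r, x ∈ T) (hT' : ∀ x ∈ l, x ∈ T) :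
    pieriCoeff t α β (q :: r) l = pairWeight t T (w ++ l) (w' ++ q :: r) := by
  induction r generalizing α β q w w' l with
  | nil =>
    obtain ⟨a, hqa, -, rfl⟩ := mem_interlacing_singleton.1 hl
    rw [pieriCoeff]
    exact h.weight_snoc ht (hT q (by simp)) (hT' a (by simp)) hqa
  | cons p r ih =>
    obtain ⟨a, l', hqa, hap, hl', rfl⟩ := mem_interlacing_cons.1 hl
    rw [pieriCoeff, ih (h.step ht (hT q (by simp)) (hT' a (by simp)) hqa hap) hl'
      (fun x hx => hT x (List.mem_cons_of_mem _ hx)) fun x hx => hT' x (List.mem_cons_of_mem _ hx)]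
    simp

/-- The Pieri rule for the symmetrizations of monomials, cleared of the denominators `1 - u y`. -/
theorem pieri_list (ht : ∀ m, 0 < m → t ^ m ≠ 1) {D : ℕ} {u : A} (hD : u ^ (D + 1) = 0)
    (Y : Finset K) (h0 : (0 : K) ∉ Y) (r : List ℤ) (hr : r.IsChain (· ≤ ·))
    (hY : r.length = Y.card) (T : Finset ℤ) (hT : ∀ x ∈ r, x ∈ T)
    (hT' : ∀ l ∈ interlacing D r, ∀ x ∈ l, x ∈ T) :
    (∏ y ∈ Y, (1 - u * algebraMap K A y)) * ∑ l ∈ interlacing D r,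
        algebraMap K A (pairWeight t T l r) * u ^ (l.sum - r.sum).toNat * sym t (l.map pw) Y =
      (∏ y ∈ Y, (1 - algebraMap K A t * u * algebraMap K A y)) * sym t (r.map (pw (A := A))) Y := by
  set γ : K → A := fun y => ∑ i ∈ Finset.range (D + 1), (u * algebraMap K A y) ^ i with hγdef
  have hγ : ∀ y, (1 - u * algebraMap K A y) * γ y = 1 := fun y => by
    rw [hγdef, mul_neg_geom_sum, mul_pow, hD, zero_mul, sub_zero]
  have hfull : sym t (r.map (full t u γ)) Y = ∑ l ∈ interlacing D r,
      algebraMap K A (pairWeight t T l r) * u ^ (l.sum - r.sum).toNat * sym t (l.map pw) Y := by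
    cases r with
    | nil =>
      simp [interlacing, pairWeight, localWeight_self t ht]
    | cons q r =>
      have := sym_full_eq_sum t u hγ hD Y h0 r q 1 1 [] hr
      simp only [map_one, one_smul, List.nil_append] at this
      rw [List.map_cons, full, this]
      refine Finset.sum_congr rfl fun l hl => ?_
      have hI : PieriInvariant t T 1 1 q [] [] :=
        ⟨by simp [pairWeight, localWeight_self t ht], by simp, by simp, Or.inl (by simp)⟩
      rw [hI.pieriCoeff_eq ht hl hT (hT' l hl), List.nil_append, List.nil_append]
  rw [← hfull]
  rw [sym_map_mul t (fun y => (1 - algebraMap K A t * u * algebraMap K A y) * γ y) _ pw r Y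
    (fun p y _ => full_apply t u hγ p y) hY, ← mul_assoc, ← Finset.prod_mul_distrib]
  congr 1
  refine Finset.prod_congr rfl fun y _ => ?_
  linear_combination (1 - algebraMap K A t * u * algebraMap K A y) * hγ y

end Pieri
end HallLittlewood
namespace HallLittlewood

/-! ### Multiplication by elementary symmetric polynomials -/

section Elementary

variable {K A : Type*} [Field K] [CommRing A] [Algebra K A] {t : K}

/-- The Gaussian binomial coefficient, by the Pascal recursion. -/
def tbinom (t : K) : ℕ → ℕ → K
  | _, 0 => 1
  | 0, _ + 1 => 0
  | n + 1, k + 1 => t ^ (k + 1) * tbinom t n (k + 1) + tbinom t n k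

theorem tbinom_zero_right (n : ℕ) : tbinom t n 0 = 1 := by cases n <;> rfl

theorem tbinom_eq_zero {n k : ℕ} (h : n < k) : tbinom t n k = 0 := by
  induction n generalizing k with
  | zero => obtain ⟨k, rfl⟩ := Nat.exists_eq_succ_of_ne_zero h.ne'; rfl
  | succ n ih =>
    obtain ⟨k, rfl⟩ := Nat.exists_eq_succ_of_ne_zero (Nat.ne_zero_of_lt h)
    rw [Nat.succ_eq_add_one, tbinom, ih (by omega), ih (by omega)]; simp

theorem tbinom_mul (a b : ℕ) :
    tbinom t (a + b) b * (tfact t a * tfact t b) = tfact t (a + b) := by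
  induction b generalizing a with
  | zero => simp [tbinom_zero_right, tfact]
  | succ b ihb =>
    induction a with
    | zero =>
      have := ihb 0
      rw [zero_add] at this
      rw [zero_add, tbinom, tbinom_eq_zero (Nat.lt_succ_self b), mul_zero, zero_add, tfact_succ]
      linear_combination (∑ j ∈ Finset.range (b + 1), t ^ j) * this
    | succ a iha =>
      have h1 := ihb (a + 1)
      have h2 := iha
      have e : ∑ j ∈ Finset.range (a + 1 + (b + 1)), t ^ j = ∑ j ∈ Finset.range (b + 1), t ^ j +
          t ^ (b + 1) * ∑ j ∈ Finset.range (a + 1), t ^ j := by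
        rw [add_comm (a + 1), Finset.sum_range_add, Finset.mul_sum]
        simp [pow_add]
      rw [show a + 1 + (b + 1) = (a + (b + 1)) + 1 by ring, tbinom, tfact_succ _ (a + (b + 1)),
        show a + (b + 1) + 1 = a + 1 + (b + 1) by ring, e]
      rw [show a + 1 + b = a + (b + 1) by ring] at h1
      rw [tfact_succ _ a] at h1 ⊢
      rw [tfact_succ _ b] at h2 ⊢
      linear_combination (∑ j ∈ Finset.range (b + 1), t ^ j) * h1 +
        t ^ (b + 1) * (∑ j ∈ Finset.range (a + 1), t ^ j) * h2

theorem tbinom_mem (R : Subring K) (ht : t ∈ R) (n k : ℕ) : tbinom t n k ∈ R := by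
  induction n generalizing k with
  | zero => cases k <;> simp [tbinom, R.one_mem, R.zero_mem]
  | succ n ih =>
    cases k with
    | zero => simp [tbinom, R.one_mem]
    | succ k => exact R.add_mem (R.mul_mem (R.pow_mem ht _) (ih _)) (ih _)

variable (t)

/-- Adjacent exponents that differ by `1` can be sorted. -/
theorem sym_swap_pw (w r : List (K → A)) (Y : Finset K) (h0 : (0 : K) ∉ Y) (p : ℤ) :
    sym t (w ++ pw (p + 1) :: pw p :: r) Y =
      algebraMap K A t * sym t (w ++ pw p :: pw (p + 1) :: r) Y := by
  have h : algebraMap K A t * sym t (w ++ pw p :: pw (p + 1) :: r) Y =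
      sym t (w ++ (algebraMap K A t • pw p) :: pw (p + 1) :: r) Y := by
    rw [← slot_apply, ← slot_apply, map_smul, smul_eq_mul]
  rw [h]
  refine sym_adjacent t w r Y _ _ _ _ fun a ha b hb => ?_
  have ha0 : a ≠ 0 := fun h => h0 (h ▸ ha)
  have hb0 : b ≠ 0 := fun h => h0 (h ▸ hb)
  simp only [pw, Pi.smul_apply, smul_eq_mul, zpow_add_one₀ ha0, zpow_add_one₀ hb0, map_mul,
    map_sub]
  ring

theorem sym_replicate_swap (w r : List (K → A)) (Y : Finset K) (h0 : (0 : K) ∉ Y) (p : ℤ) (j : ℕ) :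
    sym t (w ++ (List.replicate j (pw (p + 1)) ++ pw p :: r)) Y =
      algebraMap K A (t ^ j) * sym t (w ++ pw p :: (List.replicate j (pw (p + 1)) ++ r)) Y := by
  induction j generalizing r with
  | zero => simp
  | succ j ih =>
    have h1 : w ++ (List.replicate (j + 1) (pw (A := A) (p + 1)) ++ pw p :: r) =
        (w ++ List.replicate j (pw (p + 1))) ++ pw (p + 1) :: pw p :: r := by
      rw [List.replicate_succ']; simp
    have h2 : (w ++ List.replicate j (pw (A := A) (p + 1))) ++ pw p :: pw (p + 1) :: r =
        w ++ (List.replicate j (pw (p + 1)) ++ pw p :: (pw (p + 1) :: r)) := by simp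
    rw [h1, sym_swap_pw t _ _ Y h0, h2, ih, List.replicate_succ', pow_succ', map_mul]
    simp [mul_assoc]

/-- The function `y ↦ (1 + u y) y ^ p`. -/
def elemEntry (u : A) (p : ℤ) : K → A := fun y => (1 + u * algebraMap K A y) * pw p y

/-- A block of `b` entries `(1 + u y) y ^ p` expands with Gaussian binomial coefficients, according
to the number `j` of raised exponents. -/
theorem sym_replicate_elemEntry (u : A) (w r : List (K → A)) (Y : Finset K) (h0 : (0 : K) ∉ Y)
    (p : ℤ) (b : ℕ) :
    sym t (w ++ (List.replicate b (elemEntry u p) ++ r)) Y =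
      ∑ j ∈ Finset.range (b + 1), algebraMap K A (tbinom t b j) * u ^ j *
        sym t (w ++ (List.replicate (b - j) (pw p) ++ (List.replicate j (pw (p + 1)) ++ r))) Y := by
  induction b generalizing r with
  | zero => simp [tbinom]
  | succ b ih =>
    have h1 : w ++ (List.replicate (b + 1) (elemEntry u p) ++ r) =
        w ++ (List.replicate b (elemEntry u p) ++ (elemEntry u p :: r)) := by
      rw [List.replicate_succ']; simp
    rw [h1, ih]
    have h2 : ∀ j ∈ Finset.range (b + 1), sym t (w ++ (List.replicate (b - j) (pw p) ++
          (List.replicate j (pw (p + 1)) ++ elemEntry u p :: r))) Y =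
        algebraMap K A (t ^ j) * sym t (w ++ (List.replicate (b + 1 - j) (pw p) ++
          (List.replicate j (pw (p + 1)) ++ r))) Y +
        u * sym t (w ++ (List.replicate (b + 1 - (j + 1)) (pw p) ++
          (List.replicate (j + 1) (pw (p + 1)) ++ r))) Y := by
      intro j hj
      have hj' : j ≤ b := Nat.lt_succ_iff.1 (Finset.mem_range.1 hj)
      have e1 : w ++ (List.replicate (b - j) (pw p) ++
          (List.replicate j (pw (p + 1)) ++ elemEntry u p :: r)) =
          (w ++ List.replicate (b - j) (pw p) ++ List.replicate j (pw (p + 1))) ++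
            elemEntry u p :: r := by simp
      rw [e1, sym_congr_slot t _ r Y (elemEntry u p) (pw p + u • pw (p + 1)) (by
        intro a ha
        have ha0 : a ≠ 0 := fun h => h0 (h ▸ ha)
        simp only [elemEntry, pw, Pi.add_apply, Pi.smul_apply, smul_eq_mul, zpow_add_one₀ ha0,
          map_mul]
        ring), ← slot_apply, map_add, map_smul, slot_apply, slot_apply, smul_eq_mul]
      congr 1
      · have e2 := sym_replicate_swap t (w ++ List.replicate (b - j) (pw p)) r Y h0 p j
        rw [← List.append_assoc] at e2
        rw [e2, show b + 1 - j = (b - j) + 1 by omega, List.replicate_succ']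
        simp
      · rw [Nat.add_sub_add_right, List.replicate_succ']
        simp
    rw [Finset.sum_congr rfl fun j hj => by rw [h2 j hj]]
    simp only [mul_add, Finset.sum_add_distrib]
    rw [Finset.sum_range_succ' _ (b + 1)]
    have e3 : ∀ j ∈ Finset.range (b + 1), algebraMap K A (tbinom t (b + 1) (j + 1)) * u ^ (j + 1) *
        sym t (w ++ (List.replicate (b + 1 - (j + 1)) (pw p) ++
          (List.replicate (j + 1) (pw (p + 1)) ++ r))) Y =
        algebraMap K A (tbinom t b (j + 1)) * u ^ (j + 1) * (algebraMap K A (t ^ (j + 1)) *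
        sym t (w ++ (List.replicate (b + 1 - (j + 1)) (pw p) ++
          (List.replicate (j + 1) (pw (p + 1)) ++ r))) Y) +
        algebraMap K A (tbinom t b j) * u ^ j * (u *
        sym t (w ++ (List.replicate (b + 1 - (j + 1)) (pw p) ++
          (List.replicate (j + 1) (pw (p + 1)) ++ r))) Y) := by
      intro j _
      rw [tbinom, map_add, map_mul]
      ring
    rw [Finset.sum_congr rfl e3, Finset.sum_add_distrib]
    rw [Finset.sum_range_succ' (fun j => algebraMap K A (tbinom t b j) * u ^ j *
      (algebraMap K A (t ^ j) * _)) b, Finset.sum_range_succ (fun j => algebraMap K A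
      (tbinom t b (j + 1)) * u ^ (j + 1) * (algebraMap K A (t ^ (j + 1)) * _)) b,
      tbinom_eq_zero (Nat.lt_succ_self b)]
    simp only [tbinom_zero_right, map_zero, zero_mul, add_zero, pow_zero, map_one, one_mul]
    ring

end Elementary
end HallLittlewood
namespace HallLittlewood

/-! ### Hall-Littlewood polynomials indexed by lists -/

section ListPolynomials

variable {K : Type*} [Field K] (t : K)

/-- The normalizing factor `V_l(t)` for a list. -/
def listV (l : List ℤ) : K := ∏ k ∈ l.toFinset, tfact t (l.count k)

/-- The Hall-Littlewood polynomial indexed by a weakly increasing list, evaluated at the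
elements of `Y`. -/
noncomputable def listP (Y : Finset K) (l : List ℤ) : K :=
  (listV t l)⁻¹ * sym t (l.map (pw (A := K))) Y

variable {t}

theorem listV_eq_prod {l : List ℤ} {T : Finset ℤ} (hT : ∀ x ∈ l, x ∈ T) :
    listV t l = ∏ k ∈ T, tfact t (l.count k) := by
  refine Finset.prod_subset (fun x hx => hT x (List.mem_toFinset.1 hx)) fun x _ hx => ?_
  rw [List.count_eq_zero.2 fun h => hx (List.mem_toFinset.2 h)]
  simp [tfact]

theorem listV_nil : listV t [] = 1 := by simp [listV]

theorem listV_ne_zero (ht : ∀ m, 0 < m → t ^ m ≠ 1) (l : List ℤ) : listV t l ≠ 0 :=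
  Finset.prod_ne_zero_iff.2 fun _ _ => tfact_ne_zero t ht _

theorem listV_append_replicate (l : List ℤ) (k : ℕ) (p : ℤ) :
    listV t (l ++ List.replicate k p) * tfact t (l.count p) =
      listV t l * tfact t (l.count p + k) := by
  have hp : p ∈ insert p l.toFinset := Finset.mem_insert_self _ _
  rw [listV_eq_prod (T := insert p l.toFinset) (l := l) (fun x hx => by simp [hx]),
    listV_eq_prod (T := insert p l.toFinset) (by
      intro x hx
      rcases List.mem_append.1 hx with hx | hx
      · simp [hx]
      · simp [List.eq_of_mem_replicate hx]), ← Finset.mul_prod_erase _ _ hp,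
    ← Finset.mul_prod_erase _ _ hp]
  have : ∏ x ∈ (insert p l.toFinset).erase p, tfact t ((l ++ List.replicate k p).count x) =
      ∏ x ∈ (insert p l.toFinset).erase p, tfact t (l.count x) := by
    refine Finset.prod_congr rfl fun x hx => ?_
    have := Finset.ne_of_mem_erase hx
    simp [List.count_append, List.count_replicate, this.symm]
  rw [this]
  simp [List.count_append]
  ring

theorem listV_perm {l l' : List ℤ} (h : l.Perm l') : listV t l = listV t l' := by
  unfold listV
  rw [List.toFinset_eq_of_perm _ _ h]
  exact Finset.prod_congr rfl fun k _ => by rw [h.count_eq]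

theorem listV_replicate_append {p : ℤ} {l : List ℤ} (h : p ∉ l) (k : ℕ) :
    listV t (List.replicate k p ++ l) = tfact t k * listV t l := by
  have := listV_append_replicate (t := t) l k p
  rw [List.count_eq_zero.2 h, zero_add] at this
  rw [listV_perm List.perm_append_comm]
  simpa [tfact, mul_comm] using this

theorem sym_map_pw_algebraMap {A : Type*} [CommRing A] [Algebra K A] (Y : Finset K) (l : List ℤ) :
    sym t (l.map (pw (A := A))) Y = algebraMap K A (sym t (l.map (pw (A := K))) Y) := by
  rw [← sym_algebraMap, List.map_map]
  rfl

theorem sym_eq_listV_mul (ht : ∀ m, 0 < m → t ^ m ≠ 1) (Y : Finset K) (l : List ℤ) :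
    sym t (l.map (pw (A := K))) Y = listV t l * listP t Y l := by
  rw [listP, mul_inv_cancel_left₀ (listV_ne_zero ht l)]

/-- The statistic `∑_i i l_i`, with positions counted from `0`; it increases strictly in the
dominance order. -/
def wsum : List ℤ → ℤ
  | [] => 0
  | _ :: l => wsum l + l.sum

/-- `0 + 1 + ⋯ + (k - 1)`. -/
def tri (k : ℕ) : ℤ := ∑ i ∈ Finset.range k, (i : ℤ)

theorem tri_add (a b : ℕ) : tri (a + b) = tri a + tri b + a * b := by
  rw [tri, Finset.sum_range_add]
  simp [Finset.sum_add_distrib, tri]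
  ring

theorem wsum_append (l l' : List ℤ) : wsum (l ++ l') = wsum l + wsum l' + l.length * l'.sum := by
  induction l with
  | nil => simp [wsum]
  | cons a l ih =>
    simp only [List.cons_append, wsum, ih, List.sum_append, List.length_cons]
    push_cast
    ring

theorem wsum_replicate (k : ℕ) (p : ℤ) : wsum (List.replicate k p) = tri k * p := by
  induction k with
  | zero => simp [wsum, tri]
  | succ k ih =>
    rw [List.replicate_succ, wsum, ih, tri_add]
    simp [tri]
    ring

/-- The list in which each value of a list of pairs is repeated with its multiplicity. -/
def expand (bl : List (ℤ × ℕ)) : List ℤ := bl.flatMap fun b => List.replicate b.2 b.1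

theorem expand_cons (p : ℤ) (b : ℕ) (bl : List (ℤ × ℕ)) :
    expand ((p, b) :: bl) = List.replicate b p ++ expand bl := by simp [expand]

theorem mem_expand {bl : List (ℤ × ℕ)} {x : ℤ} (h : x ∈ expand bl) : ∃ b ∈ bl, x = b.1 := by
  simp only [expand, List.mem_flatMap] at h
  obtain ⟨b, hb, hx⟩ := h
  exact ⟨b, hb, List.eq_of_mem_replicate hx⟩

/-- Every weakly increasing list consists of blocks of equal entries. -/
theorem exists_expand {l : List ℤ} (h : l.Pairwise (· ≤ ·)) :
    ∃ bl : List (ℤ × ℕ), bl.Pairwise (fun a b => a.1 < b.1) ∧ (∀ b ∈ bl, 0 < b.2) ∧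
      expand bl = l := by
  induction l with
  | nil => exact ⟨[], by simp [expand]⟩
  | cons a l ih =>
    obtain ⟨bl, h1, h2, h3⟩ := ih (List.pairwise_cons.1 h).2
    have ha : ∀ b ∈ bl, a ≤ b.1 := fun b hb => (List.pairwise_cons.1 h).1 _ (by
      rw [← h3]
      exact List.mem_flatMap.2 ⟨b, hb, by simp [(h2 b hb).ne']⟩)
    by_cases hc : ∃ k bl', bl = (a, k) :: bl'
    · obtain ⟨k, bl', rfl⟩ := hc
      refine ⟨(a, k + 1) :: bl', ?_, ?_, ?_⟩
      · simpa using h1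
      · simp only [List.mem_cons, forall_eq_or_imp] at h2 ⊢
        exact ⟨k.succ_pos, h2.2⟩
      · rw [← h3, expand_cons, expand_cons, List.replicate_succ]; simp
    · refine ⟨(a, 1) :: bl, ?_, ?_, ?_⟩
      · refine List.pairwise_cons.2 ⟨fun b hb => ?_, h1⟩
        refine lt_of_le_of_ne (ha b hb) fun heq => hc ?_
        -- the first block has the smallest value, so it would have value `a`
        cases bl with
        | nil => simp at hb
        | cons b' bl' =>
          have h4 : b'.1 = a := by
            rcases List.mem_cons.1 hb with rfl | hb
            · exact heq.symm
            · have := (List.pairwise_cons.1 h1).1 b hb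
              have := ha b' (by simp)
              simp only at heq
              omega
          exact ⟨b'.2, bl', by rw [← h4]⟩
      · simp only [List.mem_cons, forall_eq_or_imp]
        exact ⟨one_pos, h2⟩
      · rw [expand_cons, h3]; simp

/-- The elementary symmetric polynomial of degree `r` in the elements of `Y`. -/
noncomputable def elem (Y : Finset K) (r : ℕ) : K :=
  (∏ y ∈ Y, (1 + Polynomial.X * Polynomial.C y)).coeff r

/-- The span over a subring of the Hall-Littlewood polynomials indexed by the lists satisfying a
condition. -/
noncomputable def listSpan (R : Subring K) (t : K) (Y : Finset K) (C : Set (List ℤ)) :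
    Submodule R K := Submodule.span R (listP t Y '' C)

/-- The weakly increasing lists of given length and sum, with entries bounded below and
bounded `wsum`. -/
def boundedLists (n : ℕ) (d c s : ℤ) : Set (List ℤ) :=
  {l | l.Pairwise (· ≤ ·) ∧ l.length = n ∧ l.sum = d ∧ (∀ x ∈ l, c ≤ x) ∧ wsum l ≤ s}

theorem listSpan_mono {R : Subring K} {Y : Finset K} {C C' : Set (List ℤ)} (h : C ⊆ C') :
    listSpan R t Y C ≤ listSpan R t Y C' := Submodule.span_mono (Set.image_mono h)

theorem listP_mem_listSpan (R : Subring K) {Y : Finset K} {C : Set (List ℤ)} {l : List ℤ}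
    (h : l ∈ C) : listP t Y l ∈ listSpan R t Y C := Submodule.subset_span ⟨l, h, rfl⟩

variable (t) in
/-- The symmetrization of a partially processed product: the entries of `w` are monomials, and
those of `l` carry the factors `1 + u y`. -/
noncomputable def mixed (Y : Finset K) (w l : List ℤ) : Polynomial K :=
  sym t (w.map pw ++ l.map (elemEntry Polynomial.X)) Y

theorem coeff_mixed_nil (ht : ∀ m, 0 < m → t ^ m ≠ 1) (Y : Finset K) (w : List ℤ) (r : ℕ) :
    (mixed t Y w []).coeff r = if r = 0 then listV t w * listP t Y w else 0 := by
  rw [mixed, List.map_nil, List.append_nil, sym_map_pw_algebraMap, sym_eq_listV_mul ht,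
    Polynomial.algebraMap_apply, Polynomial.coeff_C]
  rfl

theorem coeff_mixed (Y : Finset K) (h0 : (0 : K) ∉ Y) (w l : List ℤ) (p : ℤ) (b r : ℕ) :
    (mixed t Y w (List.replicate b p ++ l)).coeff r = ∑ j ∈ Finset.range (b + 1),
      if j ≤ r then tbinom t b j * (mixed t Y (w ++ List.replicate (b - j) p ++
        List.replicate j (p + 1)) l).coeff (r - j) else 0 := by
  have := sym_replicate_elemEntry t (Polynomial.X : Polynomial K) (w.map pw)
    (l.map (elemEntry Polynomial.X)) Y h0 p b
  rw [mixed, List.map_append, List.map_replicate, this, Polynomial.finsetSum_coeff]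
  refine Finset.sum_congr rfl fun j _ => ?_
  rw [mul_assoc, Polynomial.algebraMap_apply, Polynomial.coeff_C_mul, Polynomial.coeff_X_pow_mul',
    mul_ite, mul_zero, mixed]
  simp

theorem coeff_mixed_eq_zero (ht : ∀ m, 0 < m → t ^ m ≠ 1) (Y : Finset K) (h0 : (0 : K) ∉ Y)
    (bl : List (ℤ × ℕ)) (w : List ℤ) (r : ℕ) (hr : (expand bl).length < r) :
    (mixed t Y w (expand bl)).coeff r = 0 := by
  induction bl generalizing w r with
  | nil =>
    rw [expand, List.flatMap_nil, coeff_mixed_nil ht, if_neg (Nat.ne_zero_of_lt hr)]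
  | cons pb bl ih =>
    obtain ⟨p, b⟩ := pb
    rw [expand_cons] at hr ⊢
    rw [coeff_mixed Y h0]
    refine Finset.sum_eq_zero fun j hj => ?_
    have := Finset.mem_range.1 hj
    rw [List.length_append, List.length_replicate] at hr
    rw [ih _ _ (by omega)]
    simp

/-- The normalizing factors of a partially processed product combine to a Gaussian binomial
coefficient. -/
theorem tbinom_mul_listV (ht : ∀ m, 0 < m → t ^ m ≠ 1) {w l : List ℤ} {p : ℤ} {b j : ℕ}
    (hw : ∀ x ∈ w, x ≤ p) (hl : p ∉ l) (hj : j ≤ b) :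
    tbinom t b j * (listV t (w ++ List.replicate (b - j) p ++ List.replicate j (p + 1)) *
      listV t l) = listV t w * listV t (List.replicate b p ++ l) *
        tbinom t (w.count p + (b - j)) (b - j) := by
  have hc : (w ++ List.replicate (b - j) p).count (p + 1) = 0 := by
    rw [List.count_eq_zero]
    intro h
    rcases List.mem_append.1 h with h | h
    · have := hw _ h; omega
    · have := List.eq_of_mem_replicate h; omega
  have e1 := listV_append_replicate (t := t) (w ++ List.replicate (b - j) p) j (p + 1)
  rw [hc, zero_add] at e1
  have e2 := listV_append_replicate (t := t) w (b - j) p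
  have e3 := tbinom_mul (t := t) (w.count p) (b - j)
  have e4 := tbinom_mul (t := t) (b - j) j
  rw [Nat.sub_add_cancel hj] at e4
  have f0 : tfact t 0 = 1 := by simp [tfact]
  rw [f0, mul_one] at e1
  rw [e1, listV_replicate_append hl]
  have n1 := tfact_ne_zero t ht (w.count p)
  have n2 := tfact_ne_zero t ht (b - j)
  apply mul_right_cancel₀ (mul_ne_zero n1 n2)
  linear_combination (tbinom t b j * tfact t j * listV t l * tfact t (b - j)) * e2
    - (listV t w * listV t l * tfact t b) * e3 + listV t w * listV t l *
      tfact t (w.count p + (b - j)) * e4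

theorem wsum_split (w l : List ℤ) (p : ℤ) {b j : ℕ} (hj : j ≤ b) :
    wsum (w ++ List.replicate (b - j) p ++ List.replicate j (p + 1) ++ l) =
      wsum (w ++ (List.replicate b p ++ l)) + tri j + (b - j) * j + w.length * j := by
  obtain ⟨k, rfl⟩ := Nat.exists_eq_add_of_le hj
  rw [Nat.add_sub_cancel_left]
  simp only [wsum_append, wsum_replicate, List.length_append, List.length_replicate, tri_add,
    List.sum_append, List.sum_replicate]
  push_cast
  simp only [nsmul_eq_mul]
  push_cast
  ring

/-- The largest possible change of `wsum` when `r` of `n` entries increase by `1`. -/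
def maxRaise (n r : ℕ) : ℤ := tri r + (n - r) * r

theorem maxRaise_sub (n W b E r j : ℕ) (hn : n = W + (b + E)) (hr : j ≤ r) :
    tri j + (b - j) * j + W * j + maxRaise n (r - j) = maxRaise n r - j * (E - (r - j)) := by
  obtain ⟨s, rfl⟩ := Nat.exists_eq_add_of_le hr
  rw [Nat.add_sub_cancel_left, maxRaise, maxRaise, tri_add, hn]
  push_cast
  ring

theorem pairwise_split {w : List ℤ} {p : ℤ} {b j : ℕ} (hw : w.Pairwise (· ≤ ·))
    (hwp : ∀ x ∈ w, x ≤ p) : (w ++ List.replicate (b - j) p ++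
      List.replicate j (p + 1)).Pairwise (· ≤ ·) := by
  simp only [List.pairwise_append, List.mem_append, List.mem_replicate]
  refine ⟨⟨hw, ?_, ?_⟩, ?_, ?_⟩
  · simp [List.pairwise_replicate]
  · rintro x hx y ⟨-, rfl⟩; exact hwp x hx
  · simp [List.pairwise_replicate]
  · rintro x (hx | ⟨-, rfl⟩) y ⟨-, rfl⟩
    · have := hwp x hx; omega
    · omega

/-- The term of `coeff_mixed` in which `j` entries of the first block are raised. -/
theorem split_mem (ht : ∀ m, 0 < m → t ^ m ≠ 1) (R : Subring K) (htR : t ∈ R) (Y : Finset K)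
    {w l : List ℤ} {p c : ℤ} {b j r : ℕ} (hjb : j ≤ b) (hjr : j ≤ r) (hwp : ∀ x ∈ w, x ≤ p)
    (hpl : p ∉ l) (h : ∃ z ∈ listSpan R t Y (boundedLists
        (w ++ List.replicate (b - j) p ++ List.replicate j (p + 1) ++ l).length
        ((w ++ List.replicate (b - j) p ++ List.replicate j (p + 1) ++ l).sum + (r - j : ℕ)) c
        (wsum (w ++ List.replicate (b - j) p ++ List.replicate j (p + 1) ++ l) +
          maxRaise (w ++ List.replicate (b - j) p ++ List.replicate j (p + 1) ++ l).length
            (r - j))),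
      (mixed t Y (w ++ List.replicate (b - j) p ++ List.replicate j (p + 1)) l).coeff (r - j) =
        listV t (w ++ List.replicate (b - j) p ++ List.replicate j (p + 1)) * listV t l * z) :
    ∃ z ∈ listSpan R t Y (boundedLists (w ++ (List.replicate b p ++ l)).length
        ((w ++ (List.replicate b p ++ l)).sum + r) c
        (wsum (w ++ (List.replicate b p ++ l)) +
          maxRaise (w ++ (List.replicate b p ++ l)).length r - j * (l.length - (r - j)))),
      tbinom t b j * (mixed t Y (w ++ List.replicate (b - j) p ++ List.replicate j (p + 1))
        l).coeff (r - j) = listV t w * listV t (List.replicate b p ++ l) * z := by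
  obtain ⟨z, hz, he⟩ := h
  refine ⟨tbinom t (w.count p + (b - j)) (b - j) * z, ?_, ?_⟩
  · refine Submodule.smul_mem _ (⟨_, tbinom_mem R htR _ _⟩ : R) (listSpan_mono ?_ hz)
    rintro κ ⟨h1, h2, h3, h4, h5⟩
    refine ⟨h1, ?_, ?_, h4, ?_⟩
    · rw [h2]; simp only [List.length_append, List.length_replicate]; omega
    · rw [h3]
      simp only [List.sum_append, List.sum_replicate, nsmul_eq_mul]
      push_cast [hjr, hjb]
      ring
    · refine h5.trans ?_
      have hlen : (w ++ List.replicate (b - j) p ++ List.replicate j (p + 1) ++ l).length =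
          (w ++ (List.replicate b p ++ l)).length := by
        simp only [List.length_append, List.length_replicate]; omega
      have := maxRaise_sub (w ++ (List.replicate b p ++ l)).length w.length b l.length r j
        (by simp) hjr
      rw [wsum_split w _ p hjb, hlen]
      linarith
  · rw [he, ← mul_assoc, ← mul_assoc, mul_assoc (tbinom t b j), tbinom_mul_listV ht hwp hpl hjb,
      mul_assoc]

theorem notMem_expand {p : ℤ} {b : ℕ} {bl : List (ℤ × ℕ)}
    (hbl : ((p, b) :: bl).Pairwise fun a b => a.1 < b.1) : p ∉ expand bl := fun h => by
  obtain ⟨b', hb', he⟩ := mem_expand h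
  have := (List.pairwise_cons.1 hbl).1 b' hb'
  simp only at this
  omega

theorem bound_split {w l : List ℤ} {p c : ℤ} {b j : ℕ} (hjb : j ≤ b)
    (hc : ∀ x ∈ w ++ (List.replicate b p ++ l), c ≤ x) :
    ∀ x ∈ w ++ List.replicate (b - j) p ++ List.replicate j (p + 1) ++ l, c ≤ x := by
  intro x hx
  simp only [List.mem_append, List.mem_replicate] at hx hc
  rcases hx with ((hx | hx) | hx) | hx
  · exact hc x (Or.inl hx)
  · exact hc x (Or.inr (Or.inl ⟨by omega, hx.2⟩))
  · have := hc p (Or.inr (Or.inl ⟨by omega, rfl⟩)); omega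
  · exact hc x (Or.inr (Or.inr hx))

theorem le_split {w : List ℤ} {p : ℤ} {b j : ℕ} {bl : List (ℤ × ℕ)} (hwp : ∀ x ∈ w, x ≤ p)
    (hbl : ((p, b) :: bl).Pairwise fun a b => a.1 < b.1) :
    ∀ x ∈ w ++ List.replicate (b - j) p ++ List.replicate j (p + 1), ∀ b' ∈ bl, x ≤ b'.1 := by
  intro x hx b' hb'
  have hlt := (List.pairwise_cons.1 hbl).1 b' hb'
  simp only at hlt
  simp only [List.mem_append, List.mem_replicate] at hx
  rcases hx with (hx | hx) | hx
  · have := hwp x hx; omega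
  · omega
  · omega

/-- The coefficients of a partially processed product are integral combinations of normalized
Hall-Littlewood polynomials: the block lemma `sym_replicate_elemEntry` resolves the first block, and
its Gaussian binomial coefficients turn the normalizing factors of the old list into those of the
new one. -/
theorem coeff_mixed_mem (ht : ∀ m, 0 < m → t ^ m ≠ 1) (R : Subring K) (htR : t ∈ R) (Y : Finset K)
    (h0 : (0 : K) ∉ Y) (bl : List (ℤ × ℕ)) (hbl : bl.Pairwise fun a b => a.1 < b.1) (w : List ℤ)
    (hw : w.Pairwise (· ≤ ·)) (hwb : ∀ x ∈ w, ∀ b ∈ bl, x ≤ b.1) (c : ℤ)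
    (hc : ∀ x ∈ w ++ expand bl, c ≤ x) (r : ℕ) :
    ∃ z ∈ listSpan R t Y (boundedLists (w ++ expand bl).length ((w ++ expand bl).sum + r) c
      (wsum (w ++ expand bl) + maxRaise (w ++ expand bl).length r)),
      (mixed t Y w (expand bl)).coeff r = listV t w * listV t (expand bl) * z := by
  induction bl generalizing w r with
  | nil =>
    have he : expand [] = [] := rfl
    rw [he, coeff_mixed_nil ht]
    rw [he] at hc
    by_cases hr : r = 0
    · subst hr
      refine ⟨listP t Y w, listP_mem_listSpan R ⟨hw, ?_⟩, by simp [listV]⟩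
      rw [List.append_nil] at hc ⊢
      exact ⟨rfl, by simp, hc, by simp [maxRaise, tri]⟩
    · exact ⟨0, Submodule.zero_mem _, by rw [if_neg hr, mul_zero]⟩
  | cons pb bl ih =>
    obtain ⟨p, b⟩ := pb
    rw [expand_cons] at hc ⊢
    rw [coeff_mixed Y h0]
    have hwp : ∀ x ∈ w, x ≤ p := fun x hx => hwb x hx (p, b) (by simp)
    have key : ∀ j ∈ Finset.range (b + 1), ∃ z ∈ listSpan R t Y
        (boundedLists (w ++ (List.replicate b p ++ expand bl)).length
          ((w ++ (List.replicate b p ++ expand bl)).sum + r) c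
          (wsum (w ++ (List.replicate b p ++ expand bl)) +
            maxRaise (w ++ (List.replicate b p ++ expand bl)).length r)),
        (if j ≤ r then tbinom t b j * (mixed t Y (w ++ List.replicate (b - j) p ++
          List.replicate j (p + 1)) (expand bl)).coeff (r - j) else 0) =
          listV t w * listV t (List.replicate b p ++ expand bl) * z := by
      intro j hj
      have hjb : j ≤ b := Nat.lt_succ_iff.1 (Finset.mem_range.1 hj)
      by_cases hjr : j ≤ r
      swap
      · exact ⟨0, Submodule.zero_mem _, by rw [if_neg hjr, mul_zero]⟩
      rw [if_pos hjr]
      by_cases hE : (expand bl).length < r - j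
      · exact ⟨0, Submodule.zero_mem _, by rw [coeff_mixed_eq_zero ht Y h0 _ _ _ hE, mul_zero,
          mul_zero]⟩
      obtain ⟨z, hz, he⟩ := split_mem ht R htR Y hjb hjr hwp (notMem_expand hbl)
        (ih (List.pairwise_cons.1 hbl).2 _ (pairwise_split hw hwp) (le_split hwp hbl)
          (bound_split hjb hc) (r - j))
      refine ⟨z, listSpan_mono ?_ hz, he⟩
      rintro κ ⟨h1, h2, h3, h4, h5⟩
      refine ⟨h1, h2, h3, h4, h5.trans ?_⟩
      have h6 : (0 : ℤ) ≤ j * ((expand bl).length - (r - j)) :=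
        mul_nonneg (by positivity) (by omega)
      linarith
    choose! z hz he using key
    refine ⟨∑ j ∈ Finset.range (b + 1), z j, Submodule.sum_mem _ hz, ?_⟩
    rw [Finset.sum_congr rfl he, Finset.mul_sum]

theorem tbinom_self (n : ℕ) : tbinom t n n = 1 := by
  induction n with
  | zero => rfl
  | succ n ih => rw [tbinom, tbinom_eq_zero (Nat.lt_succ_self n), ih]; simp

/-- If at most as many entries are raised as there are maximal ones, the dominant term raises
maximal entries only, and it has coefficient `1`. -/
theorem coeff_mixed_lead (ht : ∀ m, 0 < m → t ^ m ≠ 1) (R : Subring K) (htR : t ∈ R) (Y : Finset K)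
    (h0 : (0 : K) ∉ Y) (bl : List (ℤ × ℕ)) {p : ℤ} {b r : ℕ} (hr : r ≤ b)
    (hbl : (bl ++ [(p, b)]).Pairwise fun a b => a.1 < b.1) (w : List ℤ)
    (hw : w.Pairwise (· ≤ ·)) (hwb : ∀ x ∈ w, ∀ b' ∈ bl ++ [(p, b)], x < b'.1) (c : ℤ)
    (hc : ∀ x ∈ w ++ expand (bl ++ [(p, b)]), c ≤ x) :
    ∃ z ∈ listSpan R t Y (boundedLists (w ++ expand (bl ++ [(p, b)])).length
        ((w ++ expand (bl ++ [(p, b)])).sum + r) c (wsum (w ++ expand (bl ++ [(p, b)])) +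
          maxRaise (w ++ expand (bl ++ [(p, b)])).length r - 1)),
      (mixed t Y w (expand (bl ++ [(p, b)]))).coeff r =
        listV t w * listV t (expand (bl ++ [(p, b)])) *
          (listP t Y (w ++ expand bl ++ List.replicate (b - r) p ++ List.replicate r (p + 1)) +
            z) := by
  induction bl generalizing w with
  | nil =>
    refine ⟨0, Submodule.zero_mem _, ?_⟩
    have hwp : ∀ x ∈ w, x ≤ p := fun x hx => (hwb x hx (p, b) (by simp)).le
    have hcount : w.count p = 0 :=
      List.count_eq_zero.2 fun h => lt_irrefl _ (hwb p h (p, b) (by simp))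
    have h1 := tbinom_mul_listV (t := t) (l := []) ht hwp (by simp) hr
    rw [hcount, zero_add, tbinom_self, mul_one] at h1
    have he : expand [] = [] := rfl
    rw [List.nil_append, expand_cons, he, coeff_mixed Y h0,
      Finset.sum_eq_single_of_mem r (by simp; omega), if_pos le_rfl, coeff_mixed_nil ht,
      if_pos (Nat.sub_self r), ← h1, List.append_nil, add_zero]
    · simp only [listV, List.toFinset_nil, Finset.prod_empty]
      ring
    · intro j _ hjr
      split_ifs with h
      · rw [coeff_mixed_nil ht, if_neg (by omega), mul_zero]
      · rfl
  | cons qk bl ih =>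
    obtain ⟨q, k⟩ := qk
    simp only [List.cons_append] at hbl hwb hc ⊢
    rw [expand_cons] at hc ⊢
    rw [coeff_mixed Y h0, Finset.sum_range_succ', if_pos (Nat.zero_le _)]
    have hwq : ∀ x ∈ w, x ≤ q := fun x hx => (hwb x hx (q, k) (by simp)).le
    have hcount : w.count q = 0 :=
      List.count_eq_zero.2 fun h => lt_irrefl _ (hwb q h (q, k) (by simp))
    have hE : r ≤ (expand (bl ++ [(p, b)])).length := by
      simp only [expand, List.flatMap_append, List.length_append, List.flatMap_cons,
        List.flatMap_nil, List.append_nil, List.length_replicate]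
      omega
    have h1 := tbinom_mul_listV (t := t) ht hwq (notMem_expand hbl) (Nat.zero_le k)
    rw [hcount, zero_add, Nat.sub_zero, tbinom_self, mul_one, tbinom_zero_right, one_mul,
      List.replicate_zero, List.append_nil] at h1
    have key : ∀ j ∈ Finset.range k, ∃ z ∈ listSpan R t Y
        (boundedLists (w ++ (List.replicate k q ++ expand (bl ++ [(p, b)]))).length
          ((w ++ (List.replicate k q ++ expand (bl ++ [(p, b)]))).sum + r) c
          (wsum (w ++ (List.replicate k q ++ expand (bl ++ [(p, b)]))) +
            maxRaise (w ++ (List.replicate k q ++ expand (bl ++ [(p, b)]))).length r - 1)),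
        (if j + 1 ≤ r then tbinom t k (j + 1) * (mixed t Y (w ++ List.replicate (k - (j + 1)) q ++
          List.replicate (j + 1) (q + 1)) (expand (bl ++ [(p, b)]))).coeff (r - (j + 1)) else 0) =
          listV t w * listV t (List.replicate k q ++ expand (bl ++ [(p, b)])) * z := by
      intro j hj
      have hjb : j + 1 ≤ k := Finset.mem_range.1 hj
      by_cases hjr : j + 1 ≤ r
      swap
      · exact ⟨0, Submodule.zero_mem _, by rw [if_neg hjr, mul_zero]⟩
      rw [if_pos hjr]
      obtain ⟨z, hz, he⟩ := split_mem ht R htR Y hjb hjr hwq (notMem_expand hbl)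
        (coeff_mixed_mem ht R htR Y h0 _ (List.pairwise_cons.1 hbl).2 _ (pairwise_split hw hwq)
          (le_split hwq hbl) c (bound_split hjb hc) (r - (j + 1)))
      refine ⟨z, listSpan_mono ?_ hz, he⟩
      rintro κ ⟨h1, h2, h3, h4, h5⟩
      refine ⟨h1, h2, h3, h4, h5.trans ?_⟩
      have h6 : (1 : ℤ) ≤ (j + 1 : ℕ) *
          ((expand (bl ++ [(p, b)])).length - (r - (j + 1 : ℕ))) :=
        one_le_mul_of_one_le_of_one_le (by omega) (by omega)
      linarith
    choose! z hz he using key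
    obtain ⟨z0, hz0, he0⟩ := ih (List.pairwise_cons.1 hbl).2 (w ++ List.replicate k q) (by
        have := pairwise_split (b := k) (j := 0) hw hwq
        simpa using this) (by
        intro x hx b' hb'
        have hlt := (List.pairwise_cons.1 hbl).1 b' hb'
        simp only at hlt
        rcases List.mem_append.1 hx with hx | hx
        · exact (hwq x hx).trans_lt hlt
        · rw [List.eq_of_mem_replicate hx]; exact hlt) (by simpa using hc)
    refine ⟨z0 + ∑ j ∈ Finset.range k, z j, Submodule.add_mem _ ?_ (Submodule.sum_mem _ hz), ?_⟩
    · simpa only [List.append_assoc] using hz0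
    · rw [Finset.sum_congr rfl he, ← Finset.mul_sum, tbinom_zero_right, one_mul, Nat.sub_zero,
        List.replicate_zero, List.append_nil, Nat.sub_zero, he0, ← h1, expand_cons]
      simp only [List.append_assoc]
      ring

theorem mixed_nil_left (Y : Finset K) (l : List ℤ) (hl : l.length = Y.card) :
    mixed t Y [] l = (∏ y ∈ Y, (1 + Polynomial.X * Polynomial.C y)) *
      Polynomial.C (sym t (l.map (pw (A := K))) Y) := by
  rw [mixed, List.map_nil, List.nil_append, sym_map_mul t
    (fun y => 1 + (Polynomial.X : Polynomial K) * Polynomial.C y)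
    (elemEntry Polynomial.X) pw l Y (fun _ _ _ => rfl) hl,
    sym_map_pw_algebraMap]
  rfl

/-- The product of an elementary symmetric and a Hall-Littlewood polynomial is an integral
combination of Hall-Littlewood polynomials. -/
theorem elem_mul_listP_mem (ht : ∀ m, 0 < m → t ^ m ≠ 1) (R : Subring K) (htR : t ∈ R)
    (Y : Finset K) (h0 : (0 : K) ∉ Y) {l : List ℤ} (hl : l.Pairwise (· ≤ ·))
    (hY : l.length = Y.card) (c : ℤ) (hc : ∀ x ∈ l, c ≤ x) (r : ℕ) :
    elem Y r * listP t Y l ∈ listSpan R t Y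
      (boundedLists l.length (l.sum + r) c (wsum l + maxRaise l.length r)) := by
  obtain ⟨bl, hbl, -, rfl⟩ := exists_expand hl
  obtain ⟨z, hz, he⟩ := coeff_mixed_mem ht R htR Y h0 bl hbl [] List.Pairwise.nil (by simp) c
    (by simpa using hc) r
  rw [mixed_nil_left Y _ hY, Polynomial.coeff_mul_C, sym_eq_listV_mul ht,
    listV_nil, one_mul] at he
  have : elem Y r * listP t Y (expand bl) = z := by
    apply mul_left_cancel₀ (listV_ne_zero ht (expand bl))
    rw [← he, elem]
    ring
  rw [this]
  simpa using hz

/-- The leading term of the product of an elementary symmetric and a Hall-Littlewood polynomial. -/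
theorem elem_mul_listP_sub_mem (ht : ∀ m, 0 < m → t ^ m ≠ 1) (R : Subring K) (htR : t ∈ R)
    (Y : Finset K) (h0 : (0 : K) ∉ Y) {l : List ℤ} {r : ℕ} {p : ℤ} (hr : 0 < r)
    (hl : (l ++ List.replicate r p).Pairwise (· ≤ ·))
    (hY : (l ++ List.replicate r p).length = Y.card) (c : ℤ)
    (hc : ∀ x ∈ l ++ List.replicate r p, c ≤ x) :
    elem Y r * listP t Y (l ++ List.replicate r p) - listP t Y (l ++ List.replicate r (p + 1)) ∈
      listSpan R t Y (boundedLists (l.length + r) ((l ++ List.replicate r (p + 1)).sum) c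
        (wsum (l ++ List.replicate r (p + 1)) - 1)) := by
  obtain ⟨bl, hbl, hpos, hexp⟩ := exists_expand hl
  have hmax : ∀ x ∈ l ++ List.replicate r p, x ≤ p := by
    intro x hx
    rcases List.mem_append.1 hx with hx | hx
    · exact (List.pairwise_append.1 hl).2.2 x hx p (by simp [hr.ne'])
    · exact (List.eq_of_mem_replicate hx).le
  obtain rfl | ⟨bl', ⟨q, b⟩, rfl⟩ := List.eq_nil_or_concat' bl
  · have := congrArg List.length hexp
    simp [expand] at this
    omega
  have hexp' : expand bl' ++ List.replicate b q = l ++ List.replicate r p := by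
    rw [← hexp]; simp [expand]
  have hb : 0 < b := hpos (q, b) (by simp)
  have hlt : ∀ x ∈ expand bl', x < q := by
    intro x hx
    obtain ⟨b', hb', rfl⟩ := mem_expand hx
    exact (List.pairwise_append.1 hbl).2.2 b' hb' (q, b) (by simp)
  have hqp : q = p := by
    refine le_antisymm (hmax q ?_) ?_
    · rw [← hexp']; simp [hb.ne']
    · have hp : p ∈ expand bl' ++ List.replicate b q := by rw [hexp']; simp [hr.ne']
      rcases List.mem_append.1 hp with hp | hp
      · exact (hlt p hp).le
      · exact (List.eq_of_mem_replicate hp).le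
  subst hqp
  have hrb : r ≤ b := by
    have h1 := congrArg (List.count q) hexp'
    rw [List.count_append, List.count_append, List.count_eq_zero.2 fun h => lt_irrefl _ (hlt q h)]
      at h1
    simp at h1
    omega
  have hl' : l = expand bl' ++ List.replicate (b - r) q := by
    have : expand bl' ++ List.replicate (b - r) q ++ List.replicate r q =
        l ++ List.replicate r q := by
      rw [← hexp', List.append_assoc, List.replicate_append_replicate, Nat.sub_add_cancel hrb]
    exact (List.append_cancel_right this).symm
  obtain ⟨z, hz, he⟩ := coeff_mixed_lead ht R htR Y h0 bl' hrb hbl [] List.Pairwise.nil (by simp) c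
    (by rw [List.nil_append, hexp]; exact hc)
  rw [hexp, mixed_nil_left Y _ hY, Polynomial.coeff_mul_C, sym_eq_listV_mul ht,
    listV_nil, one_mul, List.nil_append, ← hl'] at he
  have : elem Y r * listP t Y (l ++ List.replicate r q) -
      listP t Y (l ++ List.replicate r (q + 1)) = z := by
    apply mul_left_cancel₀ (listV_ne_zero ht (l ++ List.replicate r q))
    rw [elem]
    linear_combination he
  rw [this]
  refine listSpan_mono ?_ hz
  rw [List.nil_append, hexp]
  rintro κ ⟨h1, h2, h3, h4, h5⟩
  refine ⟨h1, by simpa using h2, ?_, h4, h5.trans ?_⟩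
  · rw [h3]
    simp only [List.sum_append, List.sum_replicate, nsmul_eq_mul]
    ring
  · simp only [wsum_append, wsum_replicate, List.sum_replicate, nsmul_eq_mul, maxRaise,
      List.length_append, List.length_replicate]
    push_cast
    apply le_of_eq
    ring

/-- Adding a constant to all entries multiplies the polynomial by a power of the product of the
variables. -/
theorem listP_map_add (Y : Finset K) (h0 : (0 : K) ∉ Y) (l : List ℤ) (hl : l.length = Y.card)
    (k : ℤ) : listP t Y (l.map (· + k)) = (∏ y ∈ Y, y) ^ k * listP t Y l := by
  have hV : listV t (l.map (· + k)) = listV t l := by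
    have hinj : Function.Injective fun x : ℤ => x + k := add_left_injective k
    have hs : (l.map (· + k)).toFinset = l.toFinset.image (· + k) := by
      ext x; simp only [List.mem_toFinset, List.mem_map, Finset.mem_image]
    rw [listV, hs, Finset.prod_image fun a _ b _ h => hinj h, listV]
    exact Finset.prod_congr rfl fun x _ => by rw [List.count_map_of_injective l _ hinj x]
  rw [listP, hV, List.map_map, sym_map_mul t (fun y => y ^ k) _ (pw (A := K)) l Y ?_ hl, listP,
    Finset.prod_zpow]
  · ring
  · intro a y hy
    have hy0 : y ≠ 0 := fun h => h0 (h ▸ hy)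
    simp [pw, zpow_add₀ hy0, mul_comm]

end ListPolynomials
end HallLittlewood
namespace HallLittlewood

/-! ### Triangularity with respect to the elementary symmetric polynomials -/

section Triangularity

variable {K : Type*} [Field K] {t : K}

theorem wsum_nonneg {l : List ℤ} (h : ∀ x ∈ l, 0 ≤ x) : 0 ≤ wsum l := by
  induction l with
  | nil => simp [wsum]
  | cons a l ih =>
    have h' : ∀ x ∈ l, 0 ≤ x := fun x hx => h x (List.mem_cons_of_mem _ hx)
    exact add_nonneg (ih h') (List.sum_nonneg h')

/-- Induction on increasing lists of nonnegative integers: a list is obtained from one of smaller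
sum by raising all its maximal entries, and lists of the same sum and smaller `wsum` may be
used. -/
theorem list_induction (n : ℕ) (Q : List ℤ → Prop) (hzero : Q (List.replicate n 0))
    (hstep : ∀ (l : List ℤ) (r : ℕ) (p : ℤ), 0 < r → (l ++ List.replicate r p).Pairwise (· ≤ ·) →
      (∀ x ∈ l ++ List.replicate r p, 0 ≤ x) → l.length + r = n → Q (l ++ List.replicate r p) →
      (∀ κ ∈ boundedLists n (l ++ List.replicate r (p + 1)).sum 0
        (wsum (l ++ List.replicate r (p + 1)) - 1), Q κ) → Q (l ++ List.replicate r (p + 1)))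
    (l : List ℤ) (hl : l.Pairwise (· ≤ ·)) (hn : l.length = n) (hpos : ∀ x ∈ l, 0 ≤ x) : Q l := by
  obtain ⟨d, hd⟩ : ∃ d : ℕ, l.sum.toNat = d := ⟨_, rfl⟩
  induction d using Nat.strong_induction_on generalizing l with
  | _ d ihd =>
  obtain ⟨s, hs⟩ : ∃ s : ℕ, (wsum l).toNat = s := ⟨_, rfl⟩
  induction s using Nat.strong_induction_on generalizing l with
  | _ s ihs =>
  obtain ⟨bl, hbl, hb, hexp⟩ := exists_expand hl
  obtain rfl | ⟨bl', ⟨q, b⟩, rfl⟩ := List.eq_nil_or_concat' bl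
  · obtain rfl : l = [] := by rw [← hexp]; rfl
    obtain rfl : n = 0 := by simpa using hn.symm
    exact hzero
  have hexp' : expand bl' ++ List.replicate b q = l := by rw [← hexp]; simp [expand]
  have hb0 : 0 < b := hb (q, b) (by simp)
  have hlt : ∀ x ∈ expand bl', x < q := by
    intro x hx
    obtain ⟨b', hb', rfl⟩ := mem_expand hx
    exact (List.pairwise_append.1 hbl).2.2 b' hb' (q, b) (by simp)
  have hq0 : 0 ≤ q := hpos q (by rw [← hexp']; simp [hb0.ne'])
  by_cases hq : q = 0
  · have : l = List.replicate n 0 := by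
      refine List.eq_replicate_iff.2 ⟨hn, fun x hx => ?_⟩
      have hx0 := hpos x hx
      rw [← hexp'] at hx
      rcases List.mem_append.1 hx with hx | hx
      · have := hlt x hx; omega
      · rw [List.eq_of_mem_replicate hx, hq]
    rw [this]
    exact hzero
  · have hq1 : q - 1 + 1 = q := by ring
    have := hstep (expand bl') b (q - 1) hb0
    rw [hq1, hexp'] at this
    have hsorted : (expand bl' ++ List.replicate b (q - 1)).Pairwise (· ≤ ·) := by
      rw [← hexp'] at hl
      refine List.pairwise_append.2 ⟨(List.pairwise_append.1 hl).1,
        by simp [List.pairwise_replicate], fun x hx y hy => ?_⟩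
      rw [List.eq_of_mem_replicate hy]
      have := hlt x hx; omega
    have hpos' : ∀ x ∈ expand bl' ++ List.replicate b (q - 1), 0 ≤ x := by
      intro x hx
      rcases List.mem_append.1 hx with hx | hx
      · exact hpos x (by rw [← hexp']; exact List.mem_append_left _ hx)
      · rw [List.eq_of_mem_replicate hx]; omega
    have hlen : (expand bl').length + b = n := by rw [← hn, ← hexp']; simp
    refine this hsorted hpos' hlen ?_ ?_
    · refine ihd _ ?_ _ hsorted (by simpa using hlen) hpos' rfl
      have h1 := List.sum_nonneg hpos'
      have h2 : l.sum = (expand bl' ++ List.replicate b (q - 1)).sum + b := by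
        rw [← hexp']; simp; ring
      omega
    · rintro κ ⟨h1, h2, h3, h4, h5⟩
      refine ihs (wsum κ).toNat ?_ κ h1 h2 h4 (by rw [h3, hd]) rfl
      have := wsum_nonneg h4
      omega

theorem listP_replicate_zero (ht : ∀ m, 0 < m → t ^ m ≠ 1) (Y : Finset K) (h0 : (0 : K) ∉ Y) :
    listP t Y (List.replicate Y.card 0) = 1 := by
  have h1 : (List.replicate Y.card (0 : ℤ)).map (pw (A := K)) =
      List.replicate Y.card (1 : K → K) := by
    rw [List.map_replicate]
    congr 1
    funext y
    simp [pw]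
  have h2 := listV_append_replicate (t := t) [] Y.card 0
  simp only [List.nil_append, List.count_nil, zero_add, listV_nil, one_mul] at h2
  rw [show tfact t 0 = 1 by simp [tfact], mul_one] at h2
  rw [listP, h1, sym_one t (fun h => ht 1 one_pos (by rw [h, one_pow])) _ Y h0 rfl, h2,
    inv_mul_cancel₀ (tfact_ne_zero t ht _)]

theorem exists_lower_bound (l : List ℤ) : ∃ c, ∀ x ∈ l, c ≤ x := by
  induction l with
  | nil => exact ⟨0, by simp⟩
  | cons a l ih =>
    obtain ⟨c, hc⟩ := ih
    refine ⟨min a c, fun x hx => ?_⟩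
    rcases List.mem_cons.1 hx with rfl | hx
    · exact min_le_left _ _
    · exact (min_le_right _ _).trans (hc x hx)

/-- If a graded multiplicative family of submodules contains the elementary symmetric polynomials,
then it contains the Hall-Littlewood polynomials. -/
theorem listP_mem_graded (ht : ∀ m, 0 < m → t ^ m ≠ 1) (R : Subring K) (htR : t ∈ R) (Y : Finset K)
    (h0 : (0 : K) ∉ Y) (S : ℤ → Submodule R K) (hone : 1 ∈ S 0)
    (hmul : ∀ i j a b, a ∈ S i → b ∈ S j → a * b ∈ S (i + j)) (k : ℤ)
    (helem : ∀ r : ℕ, elem Y r ∈ S (k * r)) {l : List ℤ} (hl : l.Pairwise (· ≤ ·))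
    (hn : l.length = Y.card) (hpos : ∀ x ∈ l, 0 ≤ x) : listP t Y l ∈ S (k * l.sum) := by
  refine list_induction Y.card (fun l => listP t Y l ∈ S (k * l.sum)) ?_ ?_ l hl hn hpos
  · rw [listP_replicate_zero ht Y h0]
    simpa using hone
  · intro l r p hr hl hpos hn hQ hκ
    have h1 := elem_mul_listP_sub_mem ht R htR Y h0 hr hl (by simpa using hn) 0 hpos
    rw [hn] at h1
    have h2 : listSpan R t Y (boundedLists Y.card (l ++ List.replicate r (p + 1)).sum 0
        (wsum (l ++ List.replicate r (p + 1)) - 1)) ≤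
        S (k * (l ++ List.replicate r (p + 1)).sum) := by
      refine Submodule.span_le.2 ?_
      rintro _ ⟨κ, hκ', rfl⟩
      have := hκ κ hκ'
      rwa [hκ'.2.2.1] at this
    have h3 := hmul _ _ _ _ (helem r) hQ
    rw [show k * (r : ℤ) + k * (l ++ List.replicate r p).sum =
      k * (l ++ List.replicate r (p + 1)).sum by simp; ring] at h3
    simpa using (S _).sub_mem h3 (h2 h1)

/-- With an inverse of the product of the variables, the same holds for lists with negative
entries. -/
theorem listP_mem_graded_of_inv (ht : ∀ m, 0 < m → t ^ m ≠ 1) (R : Subring K) (htR : t ∈ R)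
    (Y : Finset K) (h0 : (0 : K) ∉ Y) (S : ℤ → Submodule R K) (hone : 1 ∈ S 0)
    (hmul : ∀ i j a b, a ∈ S i → b ∈ S j → a * b ∈ S (i + j)) (k : ℤ)
    (helem : ∀ r : ℕ, elem Y r ∈ S (k * r)) (hinv : (∏ y ∈ Y, y)⁻¹ ∈ S (-(k * Y.card)))
    {l : List ℤ} (hl : l.Pairwise (· ≤ ·)) (hn : l.length = Y.card) :
    listP t Y l ∈ S (k * l.sum) := by
  obtain ⟨c, hc⟩ := exists_lower_bound l
  have hpow : ∀ N : ℕ, ((∏ y ∈ Y, y)⁻¹) ^ N ∈ S (-(k * Y.card) * N) := by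
    intro N
    induction N with
    | zero => simpa using hone
    | succ N ih =>
      have := hmul _ _ _ _ ih hinv
      rw [pow_succ]
      convert this using 2
      push_cast
      ring
  have hprod : ∏ y ∈ Y, y ≠ 0 := Finset.prod_ne_zero_iff.2 fun y hy h => h0 (h ▸ hy)
  set N := c.natAbs
  have hsh := listP_map_add (t := t) Y h0 l hn N
  have hmem := listP_mem_graded ht R htR Y h0 S hone hmul k helem
    (l := l.map (· + (N : ℤ))) (by
      rw [List.pairwise_map]
      exact hl.imp fun h => by omega) (by simpa using hn) (by
      intro x hx
      obtain ⟨y, hy, rfl⟩ := List.mem_map.1 hx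
      have := hc y hy
      omega)
  have h := hmul _ _ _ _ (hpow N) hmem
  have hsum : (l.map (· + (N : ℤ))).sum = l.sum + Y.card * N := by
    rw [List.sum_map_add]
    simp [hn]
  rw [hsh, hsum, ← mul_assoc, inv_pow, zpow_natCast, inv_mul_cancel₀ (pow_ne_zero _ hprod),
    one_mul] at h
  convert h using 2
  ring

/-- The span of the Hall-Littlewood polynomials of degree `d`. -/
noncomputable def degSpan (R : Subring K) (t : K) (Y : Finset K) (d : ℤ) : Submodule R K :=
  listSpan R t Y {l | l.Pairwise (· ≤ ·) ∧ l.length = Y.card ∧ l.sum = d}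

/-- The elements of `K` multiplication by which raises the degree by `d` on the spans of
Hall-Littlewood polynomials. -/
noncomputable def stab (R : Subring K) (t : K) (Y : Finset K) (d : ℤ) : Submodule R K where
  carrier := {z | ∀ e, ∀ x ∈ degSpan R t Y e, z * x ∈ degSpan R t Y (d + e)}
  add_mem' ha hb e x hx := by rw [add_mul]; exact Submodule.add_mem _ (ha e x hx) (hb e x hx)
  zero_mem' e x _ := by rw [zero_mul]; exact Submodule.zero_mem _
  smul_mem' c z hz e x hx := by rw [smul_mul_assoc]; exact Submodule.smul_mem _ c (hz e x hx)

theorem one_mem_stab (R : Subring K) (Y : Finset K) : 1 ∈ stab R t Y 0 := fun e x hx => by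
  rwa [one_mul, zero_add]

theorem mul_mem_stab (R : Subring K) (Y : Finset K) (i j : ℤ) (a b : K) (ha : a ∈ stab R t Y i)
    (hb : b ∈ stab R t Y j) : a * b ∈ stab R t Y (i + j) := fun e x hx => by
  rw [mul_assoc, add_assoc]
  exact ha _ _ (hb _ _ hx)

theorem elem_mem_stab (ht : ∀ m, 0 < m → t ^ m ≠ 1) (R : Subring K) (htR : t ∈ R) (Y : Finset K)
    (h0 : (0 : K) ∉ Y) (r : ℕ) : elem Y r ∈ stab R t Y r := by
  intro e x hx
  induction hx using Submodule.span_induction with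
  | mem x hx =>
    obtain ⟨l, ⟨h1, h2, h3⟩, rfl⟩ := hx
    obtain ⟨c, hc⟩ := exists_lower_bound l
    refine listSpan_mono ?_ (elem_mul_listP_mem ht R htR Y h0 h1 h2 c hc r)
    rintro κ ⟨k1, k2, k3, -, -⟩
    exact ⟨k1, by rw [k2, h2], by rw [k3, h3, add_comm]⟩
  | zero => rw [mul_zero]; exact Submodule.zero_mem _
  | add x y _ _ hx hy => rw [mul_add]; exact Submodule.add_mem _ hx hy
  | smul c x _ hx => rw [mul_smul_comm]; exact Submodule.smul_mem _ c hx

theorem prod_zpow_mem_stab (R : Subring K) (Y : Finset K) (h0 : (0 : K) ∉ Y) (k : ℤ) :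
    (∏ y ∈ Y, y) ^ k ∈ stab R t Y (Y.card * k) := by
  intro e x hx
  induction hx using Submodule.span_induction with
  | mem x hx =>
    obtain ⟨l, ⟨h1, h2, h3⟩, rfl⟩ := hx
    rw [← listP_map_add Y h0 l h2]
    refine listP_mem_listSpan R ⟨?_, by simpa using h2, ?_⟩
    · rw [List.pairwise_map]
      exact h1.imp fun h => by omega
    · rw [List.sum_map_add]
      simp [h2, h3, add_comm]
  | zero => rw [mul_zero]; exact Submodule.zero_mem _
  | add x y _ _ hx hy => rw [mul_add]; exact Submodule.add_mem _ hx hy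
  | smul c x _ hx => rw [mul_smul_comm]; exact Submodule.smul_mem _ c hx

/-- The increasing list of partial sums of a vector of multiplicities. -/
def partialSums {n : ℕ} (s : Fin n →₀ ℕ) : List ℤ :=
  List.ofFn fun j : Fin n => ∑ i ∈ Finset.Iic j, (s i : ℤ)

/-- The statistic `wsum` of the list of partial sums. -/
def expWeight {n : ℕ} (s : Fin n →₀ ℕ) : ℤ :=
  ∑ j : Fin n, (j : ℤ) * ∑ i ∈ Finset.Iic j, (s i : ℤ)

theorem expWeight_add {n : ℕ} (s s' : Fin n →₀ ℕ) :
    expWeight (s + s') = expWeight s + expWeight s' := by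
  simp [expWeight, Finset.sum_add_distrib, mul_add]

theorem wsum_ofFn {n : ℕ} (f : Fin n → ℤ) : wsum (List.ofFn f) = ∑ j : Fin n, (j : ℤ) * f j := by
  induction n with
  | zero => simp [wsum]
  | succ n ih =>
    rw [List.ofFn_succ, wsum, ih, List.sum_ofFn, Fin.sum_univ_succ, ← Finset.sum_add_distrib]
    simp [add_mul]

theorem wsum_partialSums {n : ℕ} (s : Fin n →₀ ℕ) : wsum (partialSums s) = expWeight s :=
  wsum_ofFn _

theorem partialSums_add_single {n : ℕ} (s : Fin n →₀ ℕ) (l : List ℤ) (r : ℕ) (p : ℤ)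
    (hn : l.length + r = n) (hs : partialSums s = l ++ List.replicate r p) (i : Fin n)
    (hi : (i : ℕ) = l.length) :
    partialSums (s + Finsupp.single i 1) = l ++ List.replicate r (p + 1) := by
  refine List.ext_getElem (by simp [partialSums, hn]) fun j h1 h2 => ?_
  have h3 : j < (partialSums s).length := by simpa [partialSums] using h1
  have h4 : (partialSums s)[j] = (l ++ List.replicate r p)[j]'(hs ▸ h3) := by
    simp only [hs]
  have e : (partialSums (s + Finsupp.single i 1))[j] =
      (partialSums s)[j] + if l.length ≤ j then 1 else 0 := by
    simp only [partialSums, List.getElem_ofFn, Finsupp.add_apply, Nat.cast_add,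
      Finset.sum_add_distrib, Finsupp.single_apply, Nat.cast_ite, Nat.cast_one,
      Nat.cast_zero, Finset.sum_ite_eq, Finset.mem_Iic, Fin.le_def, hi]
  rw [e, h4, List.getElem_append, List.getElem_append]
  split_ifs with h5 h6 h6
  · omega
  · simp
  · simp
  · omega

/-- A Hall-Littlewood polynomial is a monomial in the elementary symmetric polynomials plus
monomials of smaller weight. -/
theorem exists_aeval_elem {F : Type*} [Field F] [Algebra F K] (ht : ∀ m, 0 < m → t ^ m ≠ 1)
    (htF : t ∈ (algebraMap F K).range) (Y : Finset K) (h0 : (0 : K) ∉ Y) {n : ℕ} (hY : Y.card = n)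
    {l : List ℤ} (hl : l.Pairwise (· ≤ ·)) (hn : l.length = n) (hpos : ∀ x ∈ l, 0 ≤ x) :
    ∃ (s : Fin n →₀ ℕ) (q : MvPolynomial (Fin n) F), partialSums s = l ∧
      (∀ s' ∈ q.support, expWeight s' < expWeight s) ∧
      MvPolynomial.aeval (fun i : Fin n => elem Y (n - i)) (MvPolynomial.monomial s 1 + q) =
        listP t Y l := by
  classical
  refine list_induction n (fun l => ∃ (s : Fin n →₀ ℕ) (q : MvPolynomial (Fin n) F),
      partialSums s = l ∧ (∀ s' ∈ q.support, expWeight s' < expWeight s) ∧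
      MvPolynomial.aeval (fun i : Fin n => elem Y (n - i)) (MvPolynomial.monomial s 1 + q) =
        listP t Y l) ?_ ?_ l hl hn hpos
  · refine ⟨0, 0, ?_, by simp, ?_⟩
    · rw [partialSums]
      simp [List.ofFn_const]
    · subst hY
      rw [listP_replicate_zero ht Y h0]
      simp
  · intro l r p hr hl hpos hn ⟨s, q, hs, hq, hP⟩ hκ
    have h1 := elem_mul_listP_sub_mem ht _ htF Y h0 hr hl (by simpa [hY] using hn) 0 hpos
    rw [hn] at h1
    set i : Fin n := ⟨l.length, by omega⟩ with hi
    have hps := partialSums_add_single s l r p hn hs i rfl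
    have hw : wsum (l ++ List.replicate r (p + 1)) = expWeight (s + Finsupp.single i 1) := by
      rw [← hps, wsum_partialSums]
    -- the correction terms are polynomials of smaller weight
    have h2 : ∃ q' : MvPolynomial (Fin n) F,
        (∀ s' ∈ q'.support, expWeight s' < expWeight (s + Finsupp.single i 1)) ∧
        MvPolynomial.aeval (fun i : Fin n => elem Y (n - i)) q' =
          elem Y r * listP t Y (l ++ List.replicate r p) -
            listP t Y (l ++ List.replicate r (p + 1)) := by
      generalize elem Y r * listP t Y (l ++ List.replicate r p) -
        listP t Y (l ++ List.replicate r (p + 1)) = z at h1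
      induction h1 using Submodule.span_induction with
      | mem x hx =>
        obtain ⟨κ, hκ', rfl⟩ := hx
        obtain ⟨s', q', hs', hq', hP'⟩ := hκ κ hκ'
        have hlt : expWeight s' < expWeight (s + Finsupp.single i 1) := by
          rw [← wsum_partialSums, hs', ← hw]
          have := hκ'.2.2.2.2
          omega
        refine ⟨_, fun s'' hs'' => ?_, hP'⟩
        rcases Finset.mem_union.1 (MvPolynomial.support_add hs'') with h | h
        · rw [Finset.mem_singleton.1 (MvPolynomial.support_monomial_subset h)]
          exact hlt
        · exact (hq' s'' h).trans hlt
      | zero => exact ⟨0, by simp, by simp⟩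
      | add x y _ _ hx hy =>
        obtain ⟨a, ha, ha'⟩ := hx
        obtain ⟨b, hb, hb'⟩ := hy
        refine ⟨a + b, fun s' hs' => ?_, by rw [map_add, ha', hb']⟩
        rcases Finset.mem_union.1 (MvPolynomial.support_add hs') with h | h
        · exact ha s' h
        · exact hb s' h
      | smul c x _ hx =>
        obtain ⟨a, ha, ha'⟩ := hx
        obtain ⟨⟨_, f, rfl⟩, rfl⟩ : ∃ c', c' = c := ⟨c, rfl⟩
        refine ⟨f • a, fun s' hs' => ha s' (MvPolynomial.support_smul hs'), ?_⟩
        rw [map_smul, ha', Algebra.smul_def]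
        rfl
    obtain ⟨q', hq', hP'⟩ := h2
    refine ⟨s + Finsupp.single i 1, MvPolynomial.X i * q - q', hps, fun s' hs' => ?_, ?_⟩
    · rcases Finset.mem_union.1 (MvPolynomial.support_sub _ _ _ hs') with h | h
      · rw [mul_comm, MvPolynomial.support_mul_X] at h
        obtain ⟨s'', hs'', rfl⟩ := Finset.mem_map.1 h
        have := hq s'' hs''
        simp only [addRightEmbedding_apply, expWeight_add]
        omega
      · exact hq' s' h
    · have e1 : MvPolynomial.monomial (s + Finsupp.single i 1) (1 : F) =
          MvPolynomial.X i * MvPolynomial.monomial s 1 := by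
        rw [mul_comm, MvPolynomial.X, MvPolynomial.monomial_mul, one_mul]
      have e2 : n - (i : ℕ) = r := by rw [hi]; simp; omega
      rw [e1, ← add_sub_assoc, ← mul_add, map_sub, map_mul, hP, MvPolynomial.aeval_X, hP', e2]
      ring

/-- Hall-Littlewood polynomials indexed by distinct increasing lists are linearly independent if
the elementary symmetric polynomials are algebraically independent. -/
theorem linearIndependent_listP {F : Type*} [Field F] [Algebra F K] (ht : ∀ m, 0 < m → t ^ m ≠ 1)
    (htF : t ∈ (algebraMap F K).range) (Y : Finset K) (h0 : (0 : K) ∉ Y) {n : ℕ} (hY : Y.card = n)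
    (hinj : Function.Injective (MvPolynomial.aeval (fun i : Fin n => elem Y (n - i)) :
      MvPolynomial (Fin n) F →ₐ[F] K))
    {ι : Type*} (L : ι → List ℤ) (hL : Function.Injective L) (hs : ∀ i, (L i).Pairwise (· ≤ ·))
    (hn : ∀ i, (L i).length = n) : LinearIndependent F fun i => listP t Y (L i) := by
  classical
  rw [linearIndependent_iff']
  intro S g hg
  -- after a shift all parts are nonnegative
  obtain ⟨N, hN⟩ : ∃ N : ℕ, ∀ i ∈ S, ∀ x ∈ L i, 0 ≤ x + N := by
    choose c hc using fun i => exists_lower_bound (L i)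
    refine ⟨∑ i ∈ S, (c i).natAbs, fun i hi x hx => ?_⟩
    have h1 := hc i x hx
    have h2 : (c i).natAbs ≤ ∑ i ∈ S, (c i).natAbs :=
      Finset.single_le_sum (f := fun i => (c i).natAbs) (fun _ _ => Nat.zero_le _) hi
    omega
  have key : ∀ i : S, ∃ (s : Fin n →₀ ℕ) (q : MvPolynomial (Fin n) F),
      partialSums s = (L i).map (· + (N : ℤ)) ∧
      (∀ s' ∈ q.support, expWeight s' < expWeight s) ∧
      MvPolynomial.aeval (fun i : Fin n => elem Y (n - i)) (MvPolynomial.monomial s 1 + q) =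
        listP t Y ((L i).map (· + (N : ℤ))) := fun i =>
    exists_aeval_elem ht htF Y h0 hY (by
      rw [List.pairwise_map]
      exact (hs i).imp fun h => by omega) (by simpa using hn i) (by
      intro x hx
      obtain ⟨y, hy, rfl⟩ := List.mem_map.1 hx
      exact hN i i.2 y hy)
  choose s q hs' hq hP using key
  have hsum : ∑ i : S, g i • (MvPolynomial.monomial (s i) 1 + q i) = 0 := by
    apply hinj
    rw [map_sum, map_zero]
    simp only [map_smul, hP]
    have : ∀ i : S, g i • listP t Y ((L i).map (· + (N : ℤ))) =
        (∏ y ∈ Y, y) ^ (N : ℤ) * (g i • listP t Y (L i)) := fun i => by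
      rw [listP_map_add Y h0 _ (by rw [hn, hY]), mul_smul_comm]
    simp only [this, ← Finset.mul_sum]
    rw [Finset.sum_coe_sort S fun i => g i • listP t Y (L i), hg, mul_zero]
  by_contra hne
  push Not at hne
  obtain ⟨i0, hi0, hgi0⟩ := hne
  obtain ⟨j, hj, hmax⟩ := Finset.exists_max_image (Finset.univ.filter fun i : S => g i ≠ 0)
    (fun i => expWeight (s i)) ⟨⟨i0, hi0⟩, by simpa using hgi0⟩
  have hc := congrArg (MvPolynomial.coeff (s j)) hsum
  rw [MvPolynomial.coeff_sum, Finset.sum_eq_single j] at hc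
  · rw [MvPolynomial.coeff_smul, MvPolynomial.coeff_add, MvPolynomial.coeff_monomial, if_pos rfl,
      MvPolynomial.notMem_support_iff.1 fun h => lt_irrefl _ (hq j _ h), add_zero, smul_eq_mul,
      mul_one, MvPolynomial.coeff_zero] at hc
    exact (Finset.mem_filter.1 hj).2 hc
  · intro i _ hij
    by_cases hgi : g i = 0
    · rw [hgi, zero_smul, MvPolynomial.coeff_zero]
    have hne : s i ≠ s j := fun h => hij <| by
      have h1 := hs' i
      rw [h, hs' j] at h1
      exact Subtype.ext (hL (List.map_injective_iff.2 (add_left_injective (N : ℤ)) h1).symm)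
    rw [MvPolynomial.coeff_smul, MvPolynomial.coeff_add, MvPolynomial.coeff_monomial, if_neg hne,
      MvPolynomial.notMem_support_iff.1 fun h =>
        not_lt.2 (hmax i (by simpa using hgi)) (hq i _ h), add_zero, smul_zero]
  · intro h
    exact absurd (Finset.mem_univ j) h

end Triangularity
end HallLittlewood
namespace HallLittlewood

/-! ### Signatures as increasing lists -/

section Bridge

/-- The parts of a signature in increasing order. -/
def Sig.toList {n : ℕ} (l : Sig n) : List ℤ := List.ofFn fun i => l.1 i.rev

theorem Sig.length_toList {n : ℕ} (l : Sig n) : l.toList.length = n := by simp [Sig.toList]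

theorem Sig.pairwise_toList {n : ℕ} (l : Sig n) : l.toList.Pairwise (· ≤ ·) := by
  rw [Sig.toList, List.pairwise_ofFn]
  exact fun i j hij => l.2 (Fin.rev_le_rev.2 hij.le)

theorem Sig.sum_toList {n : ℕ} (l : Sig n) : l.toList.sum = l.size := by
  rw [Sig.toList, List.sum_ofFn, Sig.size]
  exact Equiv.sum_comp Fin.revPerm l.1

theorem Sig.toList_injective {n : ℕ} : Function.Injective (Sig.toList (n := n)) := by
  intro l l' h
  have := List.ofFn_injective h
  refine Subtype.ext (funext fun i => ?_)
  simpa using congrFun this i.rev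

theorem Sig.mem_toList {n : ℕ} {l : Sig n} {x : ℤ} : x ∈ l.toList ↔ ∃ i, l.1 i = x := by
  rw [Sig.toList, List.mem_ofFn]
  exact ⟨fun ⟨i, h⟩ => ⟨i.rev, h⟩, fun ⟨i, h⟩ => ⟨i.rev, by simpa using h⟩⟩

theorem Sig.exists_toList {n : ℕ} {l : List ℤ} (h : l.Pairwise (· ≤ ·)) (hn : l.length = n) :
    ∃ κ : Sig n, κ.toList = l := by
  subst hn
  refine ⟨⟨fun i => l[(i.rev : ℕ)], fun i j hij => ?_⟩, ?_⟩
  · rcases eq_or_lt_of_le hij with rfl | hlt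
    · exact le_rfl
    · exact List.pairwise_iff_getElem.1 h _ _ _ _ (Fin.rev_lt_rev.2 hlt)
  · simp [Sig.toList]

theorem count_ofFn {n : ℕ} (f : Fin n → ℤ) (k : ℤ) :
    (List.ofFn f).count k = (Finset.univ.filter fun i => f i = k).card := by
  induction n with
  | zero => simp
  | succ n ih =>
    rw [List.ofFn_succ, List.count_cons, ih, Fin.card_filter_univ_succ]
    by_cases h : f 0 = k <;> simp [h]

theorem Sig.count_toList {n : ℕ} (l : Sig n) (k : ℤ) : l.toList.count k = l.mult k := by
  rw [Sig.toList, count_ofFn, Sig.mult]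
  refine Finset.card_bij' (fun i _ => i.rev) (fun i _ => i.rev) ?_ ?_ ?_ ?_ <;> simp

theorem Sig.toFinset_toList {n : ℕ} (l : Sig n) : l.toList.toFinset = l.values := by
  ext x
  rw [List.mem_toFinset, Sig.mem_toList, Sig.values]
  simp

variable {K : Type*} [Field K] {t : K}

theorem V_eq_tfact (ht : ∀ m, 0 < m → t ^ m ≠ 1) (m : ℕ) : V m t = tfact t m := by
  have h := one_sub_ne_zero t ht
  rw [V, tfact, div_eq_iff (pow_ne_zero _ h)]
  conv_rhs => rw [← Finset.card_range m, ← Finset.prod_const, Finset.card_range,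
    ← Finset.prod_mul_distrib]
  exact Finset.prod_congr rfl fun i _ => by rw [mul_comm, mul_neg_geom_sum]

theorem VSig_eq_listV (ht : ∀ m, 0 < m → t ^ m ≠ 1) {n : ℕ} (l : Sig n) :
    VSig l t = listV t l.toList := by
  rw [VSig, listV, Sig.toFinset_toList]
  exact Finset.prod_congr rfl fun k _ => by rw [V_eq_tfact ht, Sig.count_toList]

open Classical in
/-- The recursive symmetrization is the sum over all permutations. -/
theorem sym_ofFn {n : ℕ} (f : Fin n → K → K) (y : Fin n → K) (hy : Function.Injective y) :
    sym t (List.ofFn f) (Finset.univ.image y) = ∑ σ : Equiv.Perm (Fin n),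
      (∏ i, f i (y (σ i))) *
        ∏ p ∈ (Finset.univ : Finset (Fin n × Fin n)).filter (fun p => p.1 < p.2),
          (y (σ p.2) - t * y (σ p.1)) / (y (σ p.2) - y (σ p.1)) := by
  induction n with
  | zero => simp [sym_nil]
  | succ n ih =>
    rw [List.ofFn_succ, sym_cons, Finset.sum_image hy.injOn,
      ← Equiv.sum_comp Equiv.Perm.decomposeFin.symm, Fintype.sum_prod_type]
    refine Finset.sum_congr rfl fun i _ => ?_
    set y' : Fin n → K := fun k => y (Equiv.swap 0 i k.succ) with hy'
    have hy'inj : Function.Injective y' := fun a b h =>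
      Fin.succ_injective _ ((Equiv.swap 0 i).injective (hy h))
    have himg : (Finset.univ.image y).erase (y i) = Finset.univ.image y' := by
      ext z
      simp only [Finset.mem_erase, Finset.mem_image, Finset.mem_univ, true_and, hy']
      constructor
      · rintro ⟨hz, k, rfl⟩
        have hk : Equiv.swap 0 i k ≠ 0 := fun h => hz (by
          rw [Equiv.swap_apply_eq_iff, Equiv.swap_apply_left] at h
          rw [h])
        obtain ⟨j, hj⟩ := Fin.exists_succ_eq.2 hk
        exact ⟨j, by rw [hj, Equiv.swap_apply_self]⟩
      · rintro ⟨k, rfl⟩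
        refine ⟨fun h => ?_, _, rfl⟩
        have h1 := hy h
        rw [Equiv.swap_apply_eq_iff, Equiv.swap_apply_right] at h1
        exact Fin.succ_ne_zero _ h1
    rw [himg, ih _ y' hy'inj, Finset.mul_sum]
    refine Finset.sum_congr rfl fun e _ => ?_
    have h0 : y (Equiv.Perm.decomposeFin.symm (i, e) 0) = y i := by
      rw [Equiv.Perm.decomposeFin_symm_apply_zero]
    have hs : ∀ k : Fin n, y (Equiv.Perm.decomposeFin.symm (i, e) k.succ) = y' (e k) := fun k => by
      rw [Equiv.Perm.decomposeFin_symm_apply_succ]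
    rw [Fin.prod_univ_succ]
    simp only [Finset.prod_filter, Fintype.prod_prod_type]
    rw [Fin.prod_univ_succ (fun a => ∏ b, if a < b then _ else _)]
    simp only [Fin.prod_univ_succ (fun b : Fin (n + 1) => if _ < b then _ else _)]
    simp only [h0, hs, lt_irrefl, if_false, Fin.succ_pos, if_true, Fin.not_lt_zero,
      Fin.succ_lt_succ_iff, one_mul]
    rw [Finset.prod_image hy'inj.injOn, ← Equiv.prod_comp e]
    simp only [Algebra.algebraMap_self, RingHom.id_apply]
    ring

open Classical in
theorem hallP_eq_listP (ht : ∀ m, 0 < m → t ^ m ≠ 1) {n : ℕ} (l : Sig n) (y : Fin n → K)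
    (hy : Function.Injective y) : hallP l y t = listP t (Finset.univ.image y) l.toList := by
  have h1 : l.toList.map (pw (A := K)) = List.ofFn fun i : Fin n => (pw (l.1 i.rev) : K → K) := by
    rw [Sig.toList, List.map_ofFn]; rfl
  rw [hallP, listP, VSig_eq_listV ht, h1, sym_ofFn _ y hy,
    ← Equiv.sum_comp (Equiv.mulRight (Fin.revPerm (n := n)))]
  congr 1
  refine Finset.sum_congr rfl fun σ _ => ?_
  congr 1
  · rw [← Equiv.prod_comp (Fin.revPerm (n := n))]
    refine Finset.prod_congr rfl fun i _ => ?_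
    simp [pw]
  · refine Finset.prod_bij' (fun p _ => (p.2.rev, p.1.rev)) (fun p _ => (p.2.rev, p.1.rev))
      ?_ ?_ ?_ ?_ ?_ <;> simp

theorem pairWeight_mul_listV (ht : ∀ m, 0 < m → t ^ m ≠ 1) {n : ℕ} (l ν : Sig n) {T : Finset ℤ}
    (hl : ∀ x ∈ l.toList, x ∈ T) (hν : ∀ x ∈ ν.toList, x ∈ T) :
    pairWeight t T l.toList ν.toList * listV t l.toList = phi l ν t * listV t ν.toList := by
  rw [listV_eq_prod hl, listV_eq_prod hν, pairWeight, ← Finset.prod_mul_distrib, phi,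
    Finset.prod_filter]
  have h1 : ∏ k ∈ l.values, (if l.mult k = ν.mult k + 1 then 1 - t ^ l.mult k else 1) =
      ∏ k ∈ T, (if l.mult k = ν.mult k + 1 then 1 - t ^ l.mult k else 1) := by
    refine Finset.prod_subset (fun x hx => hl x ?_) fun x _ hx => ?_
    · rwa [← Sig.toFinset_toList, List.mem_toFinset] at hx
    · rw [← Sig.toFinset_toList, List.mem_toFinset] at hx
      rw [← Sig.count_toList, List.count_eq_zero.2 hx, if_neg (by omega)]
  rw [h1, ← Finset.prod_mul_distrib]
  refine Finset.prod_congr rfl fun k _ => ?_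
  rw [localWeight, Sig.count_toList, Sig.count_toList]
  have := tfact_ne_zero t ht (l.mult k)
  field_simp

theorem length_of_mem_interlacing {D : ℕ} {r l : List ℤ} (h : l ∈ interlacing D r) :
    l.length = r.length := by
  induction r generalizing l with
  | nil => simp [interlacing] at h; simp [h]
  | cons q r ih =>
    cases r with
    | nil =>
      obtain ⟨a, -, -, rfl⟩ := mem_interlacing_singleton.1 h
      rfl
    | cons p r =>
      obtain ⟨a, l', -, -, hl', rfl⟩ := mem_interlacing_cons.1 h
      rw [List.length_cons, ih hl', List.length_cons, List.length_cons, List.length_cons]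

theorem ofFn_mem_interlacing {D n : ℕ} (l ν : Fin n → ℤ) :
    List.ofFn l ∈ interlacing D (List.ofFn ν) ↔ (∀ i, ν i ≤ l i) ∧
      (∀ i j : Fin n, (j : ℕ) = i + 1 → l i ≤ ν j) ∧ ∀ i : Fin n, (i : ℕ) + 1 = n →
        l i ≤ ν i + D := by
  induction n with
  | zero => simp [interlacing]
  | succ n ih =>
    cases n with
    | zero =>
      simp only [List.ofFn_succ, List.ofFn_zero, mem_interlacing_singleton]
      constructor
      · rintro ⟨a, h1, h2, h3⟩
        obtain rfl : l 0 = a := by simpa using h3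
        exact ⟨fun i => by rwa [show i = 0 from Fin.ext (by omega)], fun i j h => by omega,
          fun i _ => by rwa [show i = 0 from Fin.ext (by omega)]⟩
      · rintro ⟨h1, -, h3⟩
        exact ⟨l 0, h1 0, h3 0 rfl, rfl⟩
    | succ n =>
      rw [List.ofFn_succ (f := l), List.ofFn_succ (f := ν)]
      have e : List.ofFn (fun i : Fin (n + 1) => ν i.succ) =
          ν 1 :: List.ofFn (fun i : Fin n => ν i.succ.succ) := by
        rw [List.ofFn_succ]; rfl
      rw [e, mem_interlacing_cons, ← e]
      have h := ih (fun i => l i.succ) (fun i => ν i.succ)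
      constructor
      · rintro ⟨a, l', h1, h2, h3, h4⟩
        obtain ⟨rfl, rfl⟩ := List.cons.inj h4
        obtain ⟨k1, k2, k3⟩ := h.1 h3
        refine ⟨Fin.cases h1 k1, ?_, ?_⟩
        · intro i j hij
          obtain ⟨j', rfl⟩ := Fin.exists_succ_eq.2 (show j ≠ 0 by rintro rfl; simp at hij)
          induction i using Fin.cases with
          | zero =>
            have : j' = 0 := Fin.ext (by simpa using hij)
            subst this
            exact h2
          | succ i => exact k2 i j' (by simpa using hij)
        · intro i hi
          induction i using Fin.cases with
          | zero => simp at hi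
          | succ i => exact k3 i (by simpa using hi)
      · rintro ⟨k1, k2, k3⟩
        refine ⟨l 0, _, k1 0, k2 0 1 (by simp), h.2 ⟨fun i => k1 _, ?_, ?_⟩, rfl⟩
        · intro i j hij
          exact k2 _ _ (by simpa using hij)
        · intro i hi
          exact k3 _ (by simpa using hi)

theorem toList_mem_interlacing {D n : ℕ} (l ν : Sig n) :
    l.toList ∈ interlacing D ν.toList ↔ InterlaceQ ν l ∧ ∀ i : Fin n, (i : ℕ) = 0 →
      l.1 i ≤ ν.1 i + D := by
  rw [Sig.toList, Sig.toList, ofFn_mem_interlacing, InterlaceQ, and_assoc]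
  refine and_congr ⟨fun h i => by simpa using h i.rev, fun h i => h _⟩ (and_congr ?_ ?_)
  · refine ⟨fun h i j hij => ?_, fun h i j hij => h _ _ ?_⟩
    · have := h j.rev i.rev (by simp only [Fin.val_rev]; omega)
      simpa using this
    · simp only [Fin.val_rev]; omega
  · refine ⟨fun h i hi => ?_, fun h i hi => h _ ?_⟩
    · have := h i.rev (by simp only [Fin.val_rev]; omega)
      simpa using this
    · simp only [Fin.val_rev]; omega

theorem exists_toList_of_mem_interlacing {D n : ℕ} {ν : Sig n} {l : List ℤ}
    (h : l ∈ interlacing D ν.toList) : ∃ κ : Sig n, κ.toList = l := by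
  have hlen : l.length = n := by rw [length_of_mem_interlacing h, Sig.length_toList]
  subst hlen
  refine Sig.exists_toList ?_ rfl
  have h' : List.ofFn (fun i : Fin l.length => l[(i : ℕ)]) ∈ interlacing D ν.toList := by
    rw [List.ofFn_getElem]; exact h
  rw [Sig.toList, ofFn_mem_interlacing] at h'
  rw [← List.isChain_iff_pairwise, List.isChain_iff_getElem]
  intro i hi
  exact (h'.2.1 ⟨i, by omega⟩ ⟨i + 1, hi⟩ rfl).trans (h'.1 ⟨i + 1, hi⟩)

variable {A : Type*} [CommRing A] [Algebra K A]

open Classical in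
/-- The signatures `l ≻_Q ν` whose first part exceeds that of `ν` by at most `D`. -/
noncomputable def succQ (D : ℕ) {n : ℕ} (ν : Sig n) : Finset (Sig n) :=
  (interlacing D ν.toList).preimage Sig.toList Sig.toList_injective.injOn

theorem mem_succQ {D n : ℕ} {l ν : Sig n} : l ∈ succQ D ν ↔ InterlaceQ ν l ∧
    ∀ i : Fin n, (i : ℕ) = 0 → l.1 i ≤ ν.1 i + D := by
  rw [succQ, Finset.mem_preimage, toList_mem_interlacing]

theorem lt_size_sub_of_notMem_succQ {D n : ℕ} {l ν : Sig n} (h : InterlaceQ ν l)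
    (h' : l ∉ succQ D ν) : D < (l.size - ν.size).toNat := by
  rw [mem_succQ] at h'
  push Not at h'
  obtain ⟨i, -, hi⟩ := h' h
  have : l.1 i - ν.1 i ≤ l.size - ν.size := by
    rw [Sig.size, Sig.size, ← Finset.sum_sub_distrib]
    exact Finset.single_le_sum (f := fun i => l.1 i - ν.1 i)
      (fun i _ => sub_nonneg.2 (h.1 i)) (Finset.mem_univ i)
  omega

/-- The Pieri rule for Hall-Littlewood polynomials. -/
theorem pieri (ht : ∀ m, 0 < m → t ^ m ≠ 1) {D : ℕ} {u : A} (hD : u ^ (D + 1) = 0)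
    (Y : Finset K) (h0 : (0 : K) ∉ Y) {n : ℕ} (hY : Y.card = n) (ν : Sig n) :
    (∏ y ∈ Y, (1 - u * algebraMap K A y)) * ∑ l ∈ succQ D ν,
        u ^ (l.size - ν.size).toNat * phi l ν (algebraMap K A t) *
          algebraMap K A (listP t Y l.toList) =
      (∏ y ∈ Y, (1 - algebraMap K A t * u * algebraMap K A y)) *
        algebraMap K A (listP t Y ν.toList) := by
  classical
  set T : Finset ℤ := ν.toList.toFinset ∪ (interlacing D ν.toList).biUnion List.toFinset with hT
  have hTν : ∀ x ∈ ν.toList, x ∈ T := fun x hx =>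
    Finset.mem_union_left _ (List.mem_toFinset.2 hx)
  have hTl : ∀ l ∈ interlacing D ν.toList, ∀ x ∈ l, x ∈ T := fun l hl x hx =>
    Finset.mem_union_right _ (Finset.mem_biUnion.2 ⟨l, hl, List.mem_toFinset.2 hx⟩)
  have key := pieri_list (A := A) ht hD Y h0 ν.toList
    (List.isChain_iff_pairwise.2 ν.pairwise_toList) (by rw [Sig.length_toList, hY]) T hTν hTl
  rw [sym_map_pw_algebraMap, sym_eq_listV_mul ht, ← Finset.sum_preimage Sig.toList
    (interlacing D ν.toList) Sig.toList_injective.injOn _ (fun l hl hl' => by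
      obtain ⟨κ, hκ⟩ := exists_toList_of_mem_interlacing hl
      exact absurd ⟨κ, hκ⟩ hl'), map_mul] at key
  have hterm : ∀ l ∈ succQ D ν, algebraMap K A (pairWeight t T l.toList ν.toList) *
      u ^ (l.toList.sum - ν.toList.sum).toNat * sym t (l.toList.map pw) Y =
      algebraMap K A (listV t ν.toList) * (u ^ (l.size - ν.size).toNat *
        phi l ν (algebraMap K A t) * algebraMap K A (listP t Y l.toList)) := by
    intro l hl
    have hphi : phi l ν (algebraMap K A t) = algebraMap K A (phi l ν t) := by simp [phi, map_prod]
    have hw := congrArg (algebraMap K A) (pairWeight_mul_listV ht l ν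
      (hTl _ (Finset.mem_preimage.1 hl)) hTν)
    rw [map_mul, map_mul] at hw
    rw [sym_map_pw_algebraMap, sym_eq_listV_mul ht, map_mul, hphi, Sig.sum_toList, Sig.sum_toList]
    linear_combination (u ^ (l.size - ν.size).toNat * algebraMap K A (listP t Y l.toList)) * hw
  rw [← succQ, Finset.sum_congr rfl hterm, ← Finset.mul_sum] at key
  have hunit : IsUnit (algebraMap K A (listV t ν.toList)) :=
    (IsUnit.mk0 _ (listV_ne_zero ht _)).map (algebraMap K A)
  apply hunit.mul_left_cancel
  linear_combination key

end Bridge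
end HallLittlewood
namespace HallLittlewood

/-! ### The skew Cauchy identity -/

section Cauchy

theorem map_skewQ {R S : Type*} [CommRing R] [CommRing S] (f : R →+* S) {n k : ℕ} (l ν : Sig n)
    (x : Fin k → R) (t : R) : f (skewQ l ν x t) = skewQ l ν (fun i => f (x i)) (f t) := by
  simp [skewQ, phi, map_sum, map_prod]

theorem le_of_mem_GTQ {n k : ℕ} {l ν : Sig n} {T : Fin (k + 1) → Sig n} (h : T ∈ GTQ k l ν)
    (i : Fin n) : ν.1 i ≤ l.1 i := by
  have hm : Monotone fun j => (T j).1 := Fin.monotone_iff_le_succ.2 fun j => (h.2.2 j).1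
  have := hm (Fin.zero_le (Fin.last k)) i
  simpa [h.1, h.2.1] using this

theorem skewQ_eq_zero_of_not_le {R : Type*} [CommRing R] {n k : ℕ} {l ν : Sig n} {x : Fin k → R}
    {t : R} {i : Fin n} (h : l.1 i < ν.1 i) : skewQ l ν x t = 0 := by
  refine Finset.sum_eq_zero fun T hT => ?_
  rw [Set.Finite.mem_toFinset] at hT
  exact absurd (le_of_mem_GTQ hT i) (not_le.2 h)

open Classical in
theorem skewQ_zero {R : Type*} [CommRing R] {n : ℕ} (l ν : Sig n) (x : Fin 0 → R) (t : R) :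
    skewQ l ν x t = if l = ν then 1 else 0 := by
  simp only [skewQ, Finset.univ_eq_empty, Finset.prod_empty, Finset.sum_const, nsmul_eq_mul,
    mul_one]
  split_ifs with h
  · have : (GTQ_finite 0 l ν).toFinset = {fun _ => ν} := by
      ext T
      simp only [Set.Finite.mem_toFinset, Finset.mem_singleton, GTQ, Set.mem_ofPred_eq]
      constructor
      · rintro ⟨h1, -, -⟩
        funext i
        rw [show i = 0 from Fin.ext (by omega), h1]
      · rintro rfl
        exact ⟨rfl, h.symm, fun i => i.elim0⟩
    simp [this]
  · have : (GTQ_finite 0 l ν).toFinset = ∅ := by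
      refine Finset.eq_empty_of_forall_notMem fun T hT => h ?_
      rw [Set.Finite.mem_toFinset] at hT
      exact hT.2.1.symm.trans hT.1
    simp [this]

theorem GTQ_snoc {n k : ℕ} {l ν κ : Sig n} (T : Fin (k + 1) → Sig n) :
    (Fin.snoc T l : Fin (k + 2) → Sig n) ∈ GTQ (k + 1) l ν ∧ T (Fin.last k) = κ ↔
      T ∈ GTQ k κ ν ∧ InterlaceQ κ l := by
  have h0 : (Fin.snoc T l : Fin (k + 2) → Sig n) 0 = T 0 := by
    rw [← Fin.castSucc_zero, Fin.snoc_castSucc]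
  simp only [GTQ, Set.mem_ofPred_eq, h0, Fin.snoc_last, true_and, Fin.forall_fin_succ',
    Fin.snoc_castSucc, Fin.succ_last, Fin.succ_castSucc]
  constructor
  · rintro ⟨⟨h1, h2, h3⟩, rfl⟩
    exact ⟨⟨h1, rfl, h2⟩, h3⟩
  · rintro ⟨⟨h1, rfl, h2⟩, h3⟩
    exact ⟨⟨h1, h2, h3⟩, rfl⟩

open Classical in
/-- The recursion of skew Hall-Littlewood polynomials splitting off the last variable. -/
theorem skewQ_succ {R : Type*} [CommRing R] {n k : ℕ} (l ν : Sig n) (x : Fin (k + 1) → R) (t : R)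
    (S : Finset (Sig n)) (hS : ∀ κ, κ ∉ S → skewQ κ ν (fun i => x (Fin.castSucc i)) t = 0) :
    skewQ l ν x t = ∑ κ ∈ S, if InterlaceQ κ l then
      skewQ κ ν (fun i => x (Fin.castSucc i)) t *
        (x (Fin.last k) ^ (l.size - κ.size).toNat * phi l κ t) else 0 := by
  set p : (Fin (k + 2) → Sig n) → Sig n := fun T => T (Fin.last k).castSucc with hp
  set G := (GTQ_finite (k + 1) l ν).toFinset with hG
  have hfib : ∀ κ, (∑ T ∈ G with p T = κ, ∏ i : Fin (k + 1),
      (x i ^ ((T i.succ).size - (T i.castSucc).size).toNat * phi (T i.succ) (T i.castSucc) t)) =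
      if InterlaceQ κ l then skewQ κ ν (fun i => x (Fin.castSucc i)) t *
        (x (Fin.last k) ^ (l.size - κ.size).toNat * phi l κ t) else 0 := by
    intro κ
    split_ifs with hκ
    · rw [skewQ, Finset.sum_mul]
      refine Finset.sum_bij' (fun T _ => Fin.init T) (fun T _ => Fin.snoc T l) ?_ ?_ ?_ ?_ ?_
      · intro T hT
        rw [Finset.mem_filter, hG, Set.Finite.mem_toFinset] at hT
        rw [Set.Finite.mem_toFinset]
        have hTl : Fin.snoc (Fin.init T) l = T := by
          rw [← hT.1.2.1]; exact Fin.snoc_init_self T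
        exact ((GTQ_snoc (κ := κ) (Fin.init T)).1 (by rw [hTl]; exact hT)).1
      · intro T hT
        rw [Set.Finite.mem_toFinset] at hT
        rw [Finset.mem_filter, hG, Set.Finite.mem_toFinset]
        have := (GTQ_snoc T).2 ⟨hT, hκ⟩
        exact ⟨this.1, by rw [hp]; simpa using this.2⟩
      · intro T hT
        rw [Finset.mem_filter, hG, Set.Finite.mem_toFinset] at hT
        rw [← hT.1.2.1]
        exact Fin.snoc_init_self T
      · intro T _
        exact Fin.init_snoc _ _
      · intro T hT
        rw [Finset.mem_filter, hG, Set.Finite.mem_toFinset] at hT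
        rw [Fin.prod_univ_castSucc, Fin.succ_last, hT.1.2.1, ← hT.2]
        rfl
    · refine Finset.sum_eq_zero fun T hT => absurd ?_ hκ
      rw [Finset.mem_filter, hG, Set.Finite.mem_toFinset] at hT
      have := hT.1.2.2 (Fin.last k)
      rw [Fin.succ_last, hT.1.2.1] at this
      rw [← hT.2]
      exact this
  rw [skewQ, ← Finset.sum_fiberwise_of_maps_to (s := G) (t := S ∪ G.image p) (g := p) fun T hT =>
    Finset.mem_union_right _ (Finset.mem_image_of_mem p hT)]
  simp only [hfib]
  refine (Finset.sum_subset Finset.subset_union_left fun κ _ hκ => ?_).symm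
  rw [hS κ hκ, zero_mul, ite_self]

variable {K A : Type*} [Field K] {t : K} [CommRing A] [Algebra K A]

open Classical in
/-- The skew Cauchy identity, for nilpotent `u_i`, so that both sides are finite. -/
theorem skew_cauchy (ht : ∀ m, 0 < m → t ^ m ≠ 1) {D : ℕ} (Y : Finset K) (h0 : (0 : K) ∉ Y)
    {n : ℕ} (hY : Y.card = n) (ν : Sig n) {k : ℕ} (u : Fin k → A) (hu : ∀ i, u i ^ (D + 1) = 0) :
    ∃ S : Finset (Sig n), (∀ l, l ∉ S → skewQ l ν u (algebraMap K A t) = 0) ∧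
      (∏ i, ∏ y ∈ Y, (1 - u i * algebraMap K A y)) *
          ∑ l ∈ S, skewQ l ν u (algebraMap K A t) * algebraMap K A (listP t Y l.toList) =
        (∏ i, ∏ y ∈ Y, (1 - algebraMap K A t * u i * algebraMap K A y)) *
          algebraMap K A (listP t Y ν.toList) := by
  induction k with
  | zero =>
    refine ⟨{ν}, fun l hl => ?_, ?_⟩
    · rw [skewQ_zero, if_neg (by simpa using hl)]
    · simp [skewQ_zero]
  | succ k ih =>
    obtain ⟨S, hS, hsum⟩ := ih (fun i => u i.castSucc) fun i => hu _
    have hrec := fun l => skewQ_succ l ν u (algebraMap K A t) S hS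
    have hzero : ∀ κ l : Sig n, InterlaceQ κ l → l ∉ succQ D κ →
        u (Fin.last k) ^ (l.size - κ.size).toNat = 0 := fun κ l h h' =>
      pow_eq_zero_of_le (lt_size_sub_of_notMem_succQ h h') (hu _)
    refine ⟨S.biUnion (succQ D), fun l hl => ?_, ?_⟩
    · rw [hrec]
      refine Finset.sum_eq_zero fun κ hκ => ?_
      split_ifs with h
      · rw [hzero κ l h fun h' => hl (Finset.mem_biUnion.2 ⟨κ, hκ, h'⟩), zero_mul, mul_zero]
      · rfl
    · have e : ∑ l ∈ S.biUnion (succQ D), skewQ l ν u (algebraMap K A t) *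
          algebraMap K A (listP t Y l.toList) =
          ∑ κ ∈ S, skewQ κ ν (fun i => u i.castSucc) (algebraMap K A t) *
            ∑ l ∈ succQ D κ, u (Fin.last k) ^ (l.size - κ.size).toNat *
              phi l κ (algebraMap K A t) * algebraMap K A (listP t Y l.toList) := by
        simp only [hrec, Finset.sum_mul]
        rw [Finset.sum_comm]
        refine Finset.sum_congr rfl fun κ hκ => ?_
        rw [Finset.mul_sum]
        symm
        refine Finset.sum_subset_zero_on_sdiff (fun l hl => Finset.mem_biUnion.2 ⟨κ, hκ, hl⟩) ?_ ?_
        · intro l hl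
          split_ifs with h
          · rw [hzero κ l h (Finset.mem_sdiff.1 hl).2]; simp
          · rw [zero_mul]
        · intro l hl
          rw [if_pos (mem_succQ.1 hl).1]
          ring
      rw [e, Fin.prod_univ_castSucc, Fin.prod_univ_castSucc, mul_assoc, Finset.mul_sum]
      have h1 : ∀ κ ∈ S, (∏ y ∈ Y, (1 - u (Fin.last k) * algebraMap K A y)) *
          (skewQ κ ν (fun i => u i.castSucc) (algebraMap K A t) *
            ∑ l ∈ succQ D κ, u (Fin.last k) ^ (l.size - κ.size).toNat *
              phi l κ (algebraMap K A t) * algebraMap K A (listP t Y l.toList)) =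
          (∏ y ∈ Y, (1 - algebraMap K A t * u (Fin.last k) * algebraMap K A y)) *
            (skewQ κ ν (fun i => u i.castSucc) (algebraMap K A t) *
              algebraMap K A (listP t Y κ.toList)) := by
        intro κ _
        have := pieri ht (hu (Fin.last k)) Y h0 hY κ
        linear_combination (skewQ κ ν (fun i => u i.castSucc) (algebraMap K A t)) * this
      rw [Finset.sum_congr rfl h1, ← Finset.mul_sum, mul_left_comm, hsum]
      ring

end Cauchy
end HallLittlewood
namespace HallLittlewood

/-! ### Expansions after a change of variables -/

section Plethysm

theorem prod_interleave {R M : Type*} [CommMonoid M] {n : ℕ} (a b : Fin n → R) (F : R → M) :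
    ∏ i, F (interleave a b i) = (∏ i, F (a i)) * ∏ i, F (b i) := by
  rw [← Equiv.prod_comp (finProdFinEquiv.trans (finCongr (mul_comm n 2))),
    Fintype.prod_prod_type, ← Finset.prod_mul_distrib]
  refine Finset.prod_congr rfl fun i _ => ?_
  rw [Fin.prod_univ_two]
  have h1 : ∀ j : Fin 2, ((finProdFinEquiv.trans (finCongr (mul_comm n 2))) (i, j) : ℕ) =
      j + 2 * i := fun j => rfl
  congr 2
  · rw [interleave, if_pos (by rw [h1]; simp)]
    congr 1
    exact Fin.ext (by simp only [h1]; simp)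
  · rw [interleave, if_neg (by rw [h1]; simp)]
    congr 1
    exact Fin.ext (by simp only [h1]; simp; omega)

theorem interleave_injective {R : Type*} {n : ℕ} {a b : Fin n → R} (ha : Function.Injective a)
    (hb : Function.Injective b) (hab : ∀ i j, a i ≠ b j) :
    Function.Injective (interleave a b) := by
  intro i j h
  rw [interleave, interleave] at h
  split_ifs at h with h1 h2 h2
  · have := congrArg Fin.val (ha h)
    exact Fin.ext (by simp only at this; omega)
  · exact absurd h (hab _ _)
  · exact absurd h.symm (hab _ _)
  · have := congrArg Fin.val (hb h)
    exact Fin.ext (by simp only at this; omega)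

variable {K : Type*} [Field K] {t : K}

open Classical in
theorem elem_image {n : ℕ} {y : Fin n → K} (hy : Function.Injective y) (r : ℕ) :
    elem (Finset.univ.image y) r = (∏ i, (1 + Polynomial.X * Polynomial.C (y i))).coeff r := by
  rw [elem, Finset.prod_image hy.injOn]

theorem coeff_prod_one_add_mul {n : ℕ} (y : Fin n → K) (c : K) (r : ℕ) :
    (∏ i, (1 + Polynomial.X * Polynomial.C (y i * c))).coeff r =
      (∏ i, (1 + Polynomial.X * Polynomial.C (y i))).coeff r * c ^ r := by
  rw [← Polynomial.comp_C_mul_X_coeff, Polynomial.prod_comp]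
  congr 1
  refine Finset.prod_congr rfl fun i _ => ?_
  simp only [Polynomial.add_comp, Polynomial.one_comp, Polynomial.mul_comp, Polynomial.X_comp,
    Polynomial.C_comp, map_mul]
  ring

open Classical in
/-- The elementary symmetric polynomials of `y_1, y_1 c, …, y_n, y_n c` are polynomials in those of
`y_1, …, y_n`. -/
theorem elem_interleave_mem_stab (ht : ∀ m, 0 < m → t ^ m ≠ 1) (R : Subring K) (htR : t ∈ R)
    {c : K} (hc : c ∈ R) {n : ℕ} {y : Fin n → K} (hy : Function.Injective y) (hy0 : ∀ i, y i ≠ 0)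
    (hint : Function.Injective (interleave y fun i => y i * c)) (r : ℕ) :
    elem (Finset.univ.image (interleave y fun i => y i * c)) r ∈
      stab R t (Finset.univ.image y) r := by
  rw [elem_image hint, prod_interleave _ _ fun z => 1 + Polynomial.X * Polynomial.C z,
    Polynomial.coeff_mul]
  refine Submodule.sum_mem _ fun p hp => ?_
  have h0 : (0 : K) ∉ Finset.univ.image y := by simpa using hy0
  rw [coeff_prod_one_add_mul, ← elem_image hy, ← elem_image hy, ← mul_assoc, mul_comm]
  have := mul_mem_stab R _ _ _ _ _ (elem_mem_stab ht R htR _ h0 p.1)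
    (elem_mem_stab ht R htR _ h0 p.2)
  rw [← Nat.cast_add, Finset.HasAntidiagonal.mem_antidiagonal.1 hp] at this
  exact Submodule.smul_mem _ (⟨c ^ p.2, R.pow_mem hc _⟩ : R) this

/-- The identity `∏ (1 - X² y_i²) = ∏ (1 + X y_i) ∏ (1 - X y_i)` in terms of coefficients. -/
theorem coeff_prod_one_add_sq {n : ℕ} (y : Fin n → K) (r : ℕ) :
    (∏ i, (1 + Polynomial.X * Polynomial.C (y i ^ 2))).coeff r * (-1) ^ r =
      ((∏ i, (1 + Polynomial.X * Polynomial.C (y i))) *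
        ∏ i, (1 + Polynomial.X * Polynomial.C (y i * (-1)))).coeff (2 * r) := by
  have h : (∏ i, (1 + Polynomial.X * Polynomial.C (y i))) *
      ∏ i, (1 + Polynomial.X * Polynomial.C (y i * (-1))) =
      Polynomial.expand K 2 (∏ i, (1 + Polynomial.X * Polynomial.C (y i ^ 2 * (-1)))) := by
    rw [map_prod, ← Finset.prod_mul_distrib]
    refine Finset.prod_congr rfl fun i _ => ?_
    simp only [map_add, map_one, map_mul, Polynomial.expand_X, Polynomial.expand_C, map_neg,
      map_pow]
    ring
  rw [h, Polynomial.coeff_expand_mul' two_pos, coeff_prod_one_add_mul]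

open Classical in
/-- The elementary symmetric polynomials of `y_1 ^ 2, …, y_n ^ 2` are polynomials in those of
`y_1, …, y_n`. -/
theorem elem_sq_mem_stab (ht : ∀ m, 0 < m → t ^ m ≠ 1) (R : Subring K) (htR : t ∈ R) {n : ℕ}
    {y : Fin n → K} (hy : Function.Injective fun i => y i ^ 2) (hy0 : ∀ i, y i ≠ 0) (r : ℕ) :
    elem (Finset.univ.image fun i => y i ^ 2) r ∈ stab R t (Finset.univ.image y) (2 * r) := by
  have hy1 : Function.Injective y := fun i j h => hy (by simp only [h])
  have h0 : (0 : K) ∉ Finset.univ.image y := by simpa using hy0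
  have h := coeff_prod_one_add_sq y r
  rw [← elem_image hy, Polynomial.coeff_mul] at h
  have hsgn : ((-1 : K) ^ r) * (-1) ^ r = 1 := by rw [← mul_pow]; simp
  have h' : elem (Finset.univ.image fun i => y i ^ 2) r =
      (-1) ^ r * ∑ p ∈ Finset.HasAntidiagonal.antidiagonal (2 * r),
      (∏ i, (1 + Polynomial.X * Polynomial.C (y i))).coeff p.1 *
        (∏ i, (1 + Polynomial.X * Polynomial.C (y i * (-1)))).coeff p.2 := by
    rw [← h]
    linear_combination -(elem (Finset.univ.image fun i => y i ^ 2) r) * hsgn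
  have hneg : ∀ k : ℕ, (-1 : K) ^ k ∈ R := fun k => R.pow_mem (R.neg_mem R.one_mem) _
  rw [h']
  refine Submodule.smul_mem _ (⟨(-1) ^ r, hneg r⟩ : R) (Submodule.sum_mem _ fun p hp => ?_)
  rw [coeff_prod_one_add_mul, ← elem_image hy1, ← elem_image hy1, ← mul_assoc,
    mul_comm (_ * _) ((-1) ^ _)]
  have := mul_mem_stab R _ _ _ _ _ (elem_mem_stab ht R htR _ h0 p.1)
    (elem_mem_stab ht R htR _ h0 p.2)
  rw [← Nat.cast_add, Finset.HasAntidiagonal.mem_antidiagonal.1 hp, Nat.cast_mul] at this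
  exact Submodule.smul_mem _ (⟨(-1) ^ p.2, hneg _⟩ : R) this

theorem sq_pow_ne_one (ht : ∀ m, 0 < m → t ^ m ≠ 1) (m : ℕ) (hm : 0 < m) : (t ^ 2) ^ m ≠ 1 := by
  rw [← pow_mul]
  exact ht _ (by omega)

theorem neg_pow_ne_one (ht : ∀ m, 0 < m → t ^ m ≠ 1) (m : ℕ) (hm : 0 < m) : (-t) ^ m ≠ 1 := by
  intro h
  refine sq_pow_ne_one ht m hm ?_
  rw [← neg_sq, ← pow_mul, mul_comm, pow_mul, h, one_pow]

open Classical in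
theorem hallP_interleave_mem_stab (ht : ∀ m, 0 < m → t ^ m ≠ 1) (R : Subring K) (htR : t ∈ R)
    {n : ℕ} {y : Fin n → K} (hy : Function.Injective y) (hy0 : ∀ i, y i ≠ 0) (ht0 : t ≠ 0)
    (hyt : ∀ i j, y i ≠ y j * t) (μ : Sig (2 * n)) (h : μ ∈ SigPos (2 * n) ∨ t⁻¹ ∈ R) :
    hallP μ (interleave y fun i => y i * t) t ∈
      stab R (t ^ 2) (Finset.univ.image y) (1 * μ.size) := by
  have hint : Function.Injective (interleave y fun i => y i * t) :=
    interleave_injective hy (fun i j hij => hy (mul_right_cancel₀ ht0 hij)) hyt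
  have h0 : (0 : K) ∉ Finset.univ.image y := by simpa using hy0
  have hi0 : (0 : K) ∉ Finset.univ.image (interleave y fun i => y i * t) := by
    simp only [Finset.mem_image, Finset.mem_univ, true_and, not_exists]
    intro i
    rw [interleave]
    split_ifs
    · exact hy0 _
    · exact mul_ne_zero (hy0 _) ht0
  have hcard : (Finset.univ.image (interleave y fun i => y i * t)).card = 2 * n := by
    rw [Finset.card_image_of_injective _ hint, Finset.card_univ, Fintype.card_fin]
  have helem : ∀ r : ℕ, elem (Finset.univ.image (interleave y fun i => y i * t)) r ∈
      stab R (t ^ 2) (Finset.univ.image y) (1 * r) := fun r => by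
    rw [one_mul]
    exact elem_interleave_mem_stab (sq_pow_ne_one ht) R (R.pow_mem htR 2) htR hy hy0 hint r
  rw [hallP_eq_listP ht μ _ hint, ← Sig.sum_toList]
  rcases h with h | h
  · refine listP_mem_graded ht R htR _ hi0 _ (one_mem_stab R _) (mul_mem_stab R _) 1 helem
      μ.pairwise_toList (by rw [Sig.length_toList, hcard]) fun x hx => ?_
    obtain ⟨i, rfl⟩ := Sig.mem_toList.1 hx
    exact h i
  · refine listP_mem_graded_of_inv ht R htR _ hi0 _ (one_mem_stab R _) (mul_mem_stab R _) 1 helem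
      ?_ μ.pairwise_toList (by rw [Sig.length_toList, hcard])
    have hz := prod_zpow_mem_stab (t := t ^ 2) R _ h0 (-2)
    rw [Finset.prod_image hy.injOn, Finset.card_image_of_injective _ hy, Finset.card_univ,
      Fintype.card_fin] at hz
    rw [Finset.prod_image hint.injOn, prod_interleave y _ fun z => z, hcard,
      Finset.prod_mul_distrib, Finset.prod_const, Finset.card_univ, Fintype.card_fin]
    convert Submodule.smul_mem _ (⟨t⁻¹ ^ n, R.pow_mem h _⟩ : R) hz using 1
    · congr 1
      push_cast
      ring
    · change _ = t⁻¹ ^ n * _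
      rw [zpow_neg, zpow_ofNat, inv_pow, ← mul_inv]
      congr 1
      ring

open Classical in
theorem hallP_sq_mem_stab (ht : ∀ m, 0 < m → t ^ m ≠ 1) (R : Subring K) (htR : t ∈ R) {n : ℕ}
    {y : Fin n → K} (hy : Function.Injective fun i => y i ^ 2) (hy0 : ∀ i, y i ≠ 0) (μ : Sig n) :
    hallP μ (fun i => y i ^ 2) (t ^ 2) ∈ stab R (-t) (Finset.univ.image y) (2 * μ.size) := by
  have hy1 : Function.Injective y := fun i j h => hy (by simp only [h])
  have h0 : (0 : K) ∉ Finset.univ.image y := by simpa using hy0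
  have hi0 : (0 : K) ∉ Finset.univ.image fun i => y i ^ 2 := by simpa using hy0
  have hcard : (Finset.univ.image fun i => y i ^ 2).card = n := by
    rw [Finset.card_image_of_injective _ hy, Finset.card_univ, Fintype.card_fin]
  rw [hallP_eq_listP (sq_pow_ne_one ht) μ _ hy, ← Sig.sum_toList]
  refine listP_mem_graded_of_inv (sq_pow_ne_one ht) R (R.pow_mem htR 2) _ hi0 _ (one_mem_stab R _)
    (mul_mem_stab R _) 2 (elem_sq_mem_stab (neg_pow_ne_one ht) R (R.neg_mem htR) hy hy0)
    ?_ μ.pairwise_toList (by rw [Sig.length_toList, hcard])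
  have hz := prod_zpow_mem_stab (t := -t) R _ h0 (-2)
  rw [Finset.prod_image hy1.injOn, Finset.card_image_of_injective _ hy1, Finset.card_univ,
    Fintype.card_fin] at hz
  rw [Finset.prod_image hy.injOn, hcard, Finset.prod_pow]
  convert hz using 1
  · congr 1
    ring
  · rw [zpow_neg, zpow_ofNat]

/-- The coefficients of an element of the span of the Hall-Littlewood polynomials of degree `d`. -/
theorem exists_finsupp_of_mem_degSpan {F : Type*} [Field F] [Algebra F K] (R : Subring F)
    {Y : Finset K} {n : ℕ} (hY : Y.card = n) {d : ℤ} {z : K}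
    (hz : z ∈ degSpan (R.map (algebraMap F K)) t Y d) :
    ∃ c : Sig n →₀ F, (∀ κ, c κ ∈ R) ∧ (∀ κ, c κ ≠ 0 → κ.size = d) ∧
      z = c.sum fun κ a => algebraMap F K a * listP t Y κ.toList := by
  classical
  have hadd : ∀ c c' : Sig n →₀ F, ((c + c').sum fun κ a => algebraMap F K a * listP t Y κ.toList) =
      (c.sum fun κ a => algebraMap F K a * listP t Y κ.toList) +
        c'.sum fun κ a => algebraMap F K a * listP t Y κ.toList := fun c c' =>
    Finsupp.sum_add_index' (by simp) (by simp [add_mul])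
  induction hz using Submodule.span_induction with
  | mem x hx =>
    obtain ⟨l, ⟨h1, h2, h3⟩, rfl⟩ := hx
    obtain ⟨κ, rfl⟩ := Sig.exists_toList h1 (h2.trans hY)
    refine ⟨Finsupp.single κ 1, fun κ' => ?_, fun κ' h => ?_, by simp⟩
    · rw [Finsupp.single_apply]
      split_ifs
      exacts [R.one_mem, R.zero_mem]
    · rw [Finsupp.single_apply] at h
      split_ifs at h with h'
      · rw [← h', ← Sig.sum_toList, h3]
      · exact absurd rfl h
  | zero => exact ⟨0, fun _ => R.zero_mem, fun _ h => absurd rfl h, by simp⟩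
  | add x y _ _ hx hy =>
    obtain ⟨c, hc, hc', rfl⟩ := hx
    obtain ⟨e, he, he', rfl⟩ := hy
    refine ⟨c + e, fun κ => R.add_mem (hc κ) (he κ), fun κ h => ?_, (hadd c e).symm⟩
    by_cases h1 : c κ = 0
    · exact he' κ fun h2 => h (by rw [Finsupp.add_apply, h1, h2, add_zero])
    · exact hc' κ h1
  | smul a x _ hx =>
    obtain ⟨c, hc, hc', rfl⟩ := hx
    obtain ⟨a, b, hb, rfl⟩ := a
    refine ⟨b • c, fun κ => R.mul_mem hb (hc κ), fun κ h => hc' κ fun h' => h ?_, ?_⟩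
    · rw [Finsupp.smul_apply, h', smul_zero]
    · rw [Finsupp.sum_smul_index' (by simp), Subring.smul_def, smul_eq_mul, Finsupp.mul_sum]
      refine Finsupp.sum_congr fun κ _ => ?_
      simp [mul_assoc]

end Plethysm

section Generic

/-- The properties of the indeterminates `t` and `y_1, …, y_n` that make the Hall-Littlewood
polynomials at `y` well behaved: `t` is neither zero nor a root of unity, the denominators in the
symmetrization formulas do not vanish, and the elementary symmetric polynomials in the `y_i` are
algebraically independent over the field containing `t`. -/
structure Generic {F K : Type*} [Field F] [Field K] [Algebra F K] {n : ℕ} (τ : F) (y : Fin n → K) :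
    Prop where
  pow_ne_one : ∀ m, 0 < m → τ ^ m ≠ 1
  ne_zero : τ ≠ 0
  sq_injective : Function.Injective fun i => y i ^ 2
  var_ne_zero : ∀ i, y i ≠ 0
  var_ne_mul : ∀ i j, y i ≠ y j * algebraMap F K τ
  aeval_injective : Function.Injective (MvPolynomial.aeval
    (fun i : Fin n => (∏ j, (1 + Polynomial.X * Polynomial.C (y j))).coeff (n - i)) :
      MvPolynomial (Fin n) F →ₐ[F] K)

variable {F K : Type*} [Field F] [Field K] [Algebra F K] {n : ℕ} {τ : F} {y : Fin n → K}

namespace Generic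

theorem injective (hG : Generic τ y) : Function.Injective y := fun i j h =>
  hG.sq_injective (by simp only [h])

theorem map_pow_ne_one (hG : Generic τ y) (m : ℕ) (hm : 0 < m) : algebraMap F K τ ^ m ≠ 1 := by
  rw [← map_pow, ← map_one (algebraMap F K)]
  exact fun h => hG.pow_ne_one m hm ((algebraMap F K).injective h)

theorem map_ne_zero (hG : Generic τ y) : algebraMap F K τ ≠ 0 :=
  (_root_.map_ne_zero _).2 hG.ne_zero

open Classical in
theorem card_image (hG : Generic τ y) : (Finset.univ.image y).card = n := by
  rw [Finset.card_image_of_injective _ hG.injective, Finset.card_univ, Fintype.card_fin]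

open Classical in
theorem zero_notMem_image (hG : Generic τ y) : (0 : K) ∉ Finset.univ.image y := by
  simpa using hG.var_ne_zero

/-- Hall-Littlewood polynomials are linearly independent. -/
theorem linearIndependent_hallP (hG : Generic τ y) {t : K} (ht : ∀ m, 0 < m → t ^ m ≠ 1)
    (htF : t ∈ (algebraMap F K).range) : LinearIndependent F fun κ : Sig n => hallP κ y t := by
  classical
  simp only [hallP_eq_listP ht _ _ hG.injective]
  refine linearIndependent_listP ht htF _ hG.zero_notMem_image hG.card_image ?_ _
    Sig.toList_injective Sig.pairwise_toList Sig.length_toList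
  simp only [elem_image hG.injective]
  exact hG.aeval_injective

theorem expansion_unique (hG : Generic τ y) {t : K} (ht : ∀ m, 0 < m → t ^ m ≠ 1)
    (htF : t ∈ (algebraMap F K).range) {c c' : Sig n →₀ F}
    (h : (c.sum fun κ a => algebraMap F K a * hallP κ y t) =
      c'.sum fun κ a => algebraMap F K a * hallP κ y t) : c = c' := by
  refine hG.linearIndependent_hallP ht htF ?_
  simpa only [Finsupp.linearCombination_apply, Algebra.smul_def] using h

open Classical in
/-- Existence and integrality of expansions in Hall-Littlewood polynomials. -/
theorem exists_expansion (hG : Generic τ y) {t : K} (ht : ∀ m, 0 < m → t ^ m ≠ 1) (R : Subring F)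
    {d : ℤ} {z : K} (hz : z ∈ stab (R.map (algebraMap F K)) t (Finset.univ.image y) d)
    (ν : Sig n) :
    ∃ c : Sig n →₀ F, (∀ κ, c κ ∈ R) ∧ (∀ κ, c κ ≠ 0 → κ.size = d + ν.size) ∧
      z * hallP ν y t = c.sum fun κ a => algebraMap F K a * hallP κ y t := by
  simp only [hallP_eq_listP ht _ _ hG.injective]
  refine exists_finsupp_of_mem_degSpan R hG.card_image (hz _ _ (listP_mem_listSpan _
    ⟨ν.pairwise_toList, ?_, ν.sum_toList⟩))
  rw [ν.length_toList, hG.card_image]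

theorem exists_alt_expansion (hG : Generic τ y) (R : Subring F) (hτ : τ ∈ R) (μ : Sig (2 * n))
    (ν : Sig n) (h : μ ∈ SigPos (2 * n) ∨ τ⁻¹ ∈ R) :
    ∃ c : Sig n →₀ F, (∀ κ, c κ ∈ R) ∧ (∀ κ, c κ ≠ 0 → κ.size = μ.size + ν.size) ∧
      hallP μ (interleave y fun i => y i * algebraMap F K τ) (algebraMap F K τ) *
        hallP ν y (algebraMap F K τ ^ 2) =
          c.sum fun κ a => algebraMap F K a * hallP κ y (algebraMap F K τ ^ 2) := by
  have h1 := hallP_interleave_mem_stab hG.map_pow_ne_one (R.map (algebraMap F K)) ⟨_, hτ, rfl⟩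
    hG.injective hG.var_ne_zero hG.map_ne_zero hG.var_ne_mul μ
    (h.imp_right fun h => ⟨_, h, map_inv₀ _ _⟩)
  rw [one_mul] at h1
  exact hG.exists_expansion (sq_pow_ne_one hG.map_pow_ne_one) R h1 ν

theorem exists_her_expansion (hG : Generic τ y) (R : Subring F) (hτ : τ ∈ R) (μ ν : Sig n) :
    ∃ c : Sig n →₀ F, (∀ κ, c κ ∈ R) ∧ (∀ κ, c κ ≠ 0 → κ.size = 2 * μ.size + ν.size) ∧
      hallP μ (fun i => y i ^ 2) (algebraMap F K τ ^ 2) * hallP ν y (-algebraMap F K τ) =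
        c.sum fun κ a => algebraMap F K a * hallP κ y (-algebraMap F K τ) :=
  hG.exists_expansion (neg_pow_ne_one hG.map_pow_ne_one) R
    (hallP_sq_mem_stab hG.map_pow_ne_one (R.map (algebraMap F K)) ⟨_, hτ, rfl⟩
      hG.sq_injective hG.var_ne_zero μ) ν

end Generic

end Generic
end HallLittlewood
namespace HallLittlewood

/-! ### Littlewood-Richardson coefficients -/

section Coefficients

theorem X_pow_ne_one (m : ℕ) (hm : 0 < m) : (RatFunc.X : Ft) ^ m ≠ 1 := by
  rw [← RatFunc.algebraMap_X, ← map_pow, ← map_one (algebraMap (Polynomial ℤ) Ft)]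
  intro h
  have := congrArg Polynomial.natDegree (RatFunc.algebraMap_injective ℤ h)
  simp at this
  omega

theorem X_ne_zero : (RatFunc.X : Ft) ≠ 0 := fun h => by
  have h1 : (RatFunc.X : Ft) + 1 = 1 := by rw [h, zero_add]
  rw [← RatFunc.algebraMap_X, ← map_one (algebraMap (Polynomial ℤ) Ft), ← map_add] at h1
  have := congrArg Polynomial.natDegree (RatFunc.algebraMap_injective ℤ h1)
  rw [← Polynomial.C_1, Polynomial.natDegree_X_add_C] at this
  simp at this

section Indeterminates

variable {F : Type*} [Field F] {n : ℕ} (K : Type*) [Field K] [Algebra (MvPolynomial (Fin n) F) K]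

theorem coeff_prod_one_add_X (r : ℕ) :
    (∏ i : Fin n, (1 + Polynomial.X *
      Polynomial.C (algebraMap (MvPolynomial (Fin n) F) K (MvPolynomial.X i)))).coeff r =
    algebraMap (MvPolynomial (Fin n) F) K (MvPolynomial.esymm (Fin n) F r) := by
  classical
  have h : ∏ i : Fin n, (1 + Polynomial.X *
      Polynomial.C (algebraMap (MvPolynomial (Fin n) F) K (MvPolynomial.X i))) =
      ∑ s : Finset (Fin n), Polynomial.C
        (∏ i ∈ s, algebraMap (MvPolynomial (Fin n) F) K (MvPolynomial.X i)) *
          Polynomial.X ^ s.card := by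
    rw [Finset.prod_one_add, Finset.powerset_univ]
    refine Finset.sum_congr rfl fun s _ => ?_
    rw [Finset.prod_mul_distrib, Finset.prod_const, map_prod, mul_comm]
  rw [h, Polynomial.finsetSum_coeff, MvPolynomial.esymm, map_sum,
    Finset.powersetCard_eq_filter, Finset.powerset_univ, Finset.sum_filter]
  refine Finset.sum_congr rfl fun s _ => ?_
  rw [Polynomial.coeff_C_mul_X_pow, map_prod]
  simp only [eq_comm (a := r)]

variable [Algebra F K] [IsScalarTower F (MvPolynomial (Fin n) F) K]
  [IsFractionRing (MvPolynomial (Fin n) F) K]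

/-- Indeterminates over a field are generic. The algebraic independence of the elementary symmetric
polynomials is part of the fundamental theorem of symmetric polynomials. -/
theorem generic_X {τ : F} (h : ∀ m, 0 < m → τ ^ m ≠ 1) (h0 : τ ≠ 0) :
    Generic τ fun i => algebraMap (MvPolynomial (Fin n) F) K (MvPolynomial.X i) where
  pow_ne_one := h
  ne_zero := h0
  sq_injective := by
    intro i j hij
    simp only [← map_pow] at hij
    have := congrArg (MvPolynomial.eval (Pi.single i (1 : F))) (IsFractionRing.injective _ K hij)
    by_contra hne
    simp [Ne.symm hne] at this
  var_ne_zero i hi := by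
    rw [← map_zero (algebraMap (MvPolynomial (Fin n) F) K)] at hi
    exact MvPolynomial.X_ne_zero i (IsFractionRing.injective _ K hi)
  var_ne_mul i j hij := by
    rw [IsScalarTower.algebraMap_apply F (MvPolynomial (Fin n) F) K, ← map_mul] at hij
    have := congrArg (MvPolynomial.eval fun _ => (1 : F)) (IsFractionRing.injective _ K hij)
    simp [MvPolynomial.algebraMap_eq] at this
    exact h 1 one_pos (by rw [pow_one, ← this])
  aeval_injective := by
    have h : (MvPolynomial.aeval (fun i : Fin n => (∏ j, (1 + Polynomial.X * Polynomial.C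
          (algebraMap (MvPolynomial (Fin n) F) K (MvPolynomial.X j)))).coeff (n - i)) :
          MvPolynomial (Fin n) F →ₐ[F] K) =
        (IsScalarTower.toAlgHom F (MvPolynomial (Fin n) F) K).comp
          ((Subalgebra.val _).comp ((MvPolynomial.esymmAlgHom (Fin n) F n).comp
            (MvPolynomial.rename Fin.rev))) := by
      refine MvPolynomial.algHom_ext fun i => ?_
      rw [MvPolynomial.aeval_X, coeff_prod_one_add_X]
      simp only [AlgHom.comp_apply, MvPolynomial.rename_X, IsScalarTower.toAlgHom_apply]
      congr 1
      rw [Subalgebra.val_apply, MvPolynomial.esymmAlgHom_apply, MvPolynomial.aeval_X]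
      congr 1
      rw [Fin.val_rev]
      omega
    rw [h]
    have h1 : Function.Injective (MvPolynomial.esymmAlgHom (Fin n) F n) :=
      MvPolynomial.esymmAlgHom_injective F (by simp)
    have h2 : Function.Injective (MvPolynomial.rename Fin.rev :
        MvPolynomial (Fin n) F →ₐ[F] MvPolynomial (Fin n) F) :=
      MvPolynomial.rename_injective _ Fin.rev_injective
    intro a b hab
    exact h2 (h1 (Subtype.val_injective (IsFractionRing.injective _ K hab)))

end Indeterminates

theorem X_mem_Zt : (RatFunc.X : Ft) ∈ Zt := ⟨Polynomial.X, RatFunc.algebraMap_X⟩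

/-- The ring `ℤ[t, t⁻¹]`, as the ring of rational functions that some power of `t` carries into
`ℤ[t]`. -/
noncomputable def Zlaurent : Subring Ft where
  carrier := {a | ∃ k : ℕ, RatFunc.X ^ k * a ∈ Zt}
  mul_mem' := by
    rintro a b ⟨k, hk⟩ ⟨j, hj⟩
    refine ⟨k + j, ?_⟩
    rw [pow_add, mul_mul_mul_comm]
    exact Zt.mul_mem hk hj
  one_mem' := ⟨0, by simp [Zt.one_mem]⟩
  add_mem' := by
    rintro a b ⟨k, hk⟩ ⟨j, hj⟩
    refine ⟨k + j, ?_⟩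
    rw [show RatFunc.X ^ (k + j) * (a + b) = RatFunc.X ^ j * (RatFunc.X ^ k * a) +
      RatFunc.X ^ k * (RatFunc.X ^ j * b) by ring]
    exact Zt.add_mem (Zt.mul_mem (Zt.pow_mem X_mem_Zt _) hk)
      (Zt.mul_mem (Zt.pow_mem X_mem_Zt _) hj)
  zero_mem' := ⟨0, by simp [Zt.zero_mem]⟩
  neg_mem' := by
    rintro a ⟨k, hk⟩
    exact ⟨k, by rw [mul_neg]; exact Zt.neg_mem hk⟩

theorem X_mem_Zlaurent : (RatFunc.X : Ft) ∈ Zlaurent := ⟨0, by simp [X_mem_Zt]⟩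

theorem inv_X_mem_Zlaurent : (RatFunc.X : Ft)⁻¹ ∈ Zlaurent :=
  ⟨1, by rw [pow_one, mul_inv_cancel₀ X_ne_zero]; exact Zt.one_mem⟩

variable {n : ℕ}

theorem generic_xvar : Generic (RatFunc.X : Ft) (xvar (n := n)) :=
  generic_X (Fx n) X_pow_ne_one X_ne_zero

/-- The conclusion for `R = ℤ[t, t⁻¹]` holds for all `μ`, that for `R = ℤ[t]` for nonnegative
`μ`. -/
theorem exists_isAltExpansion (R : Subring Ft) (hX : RatFunc.X ∈ R) (μ : Sig (2 * n)) (ν : Sig n)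
    (h : μ ∈ SigPos (2 * n) ∨ (RatFunc.X : Ft)⁻¹ ∈ R) :
    ∃ c, IsAltExpansion μ ν c ∧ (∀ κ, c κ ∈ R) ∧ ∀ κ, c κ ≠ 0 → κ.size = μ.size + ν.size := by
  obtain ⟨c, hc, hc', hsum⟩ := generic_xvar.exists_alt_expansion R hX μ ν h
  exact ⟨c, hsum, hc, hc'⟩

theorem exists_isHerExpansion (μ ν : Sig n) :
    ∃ c, IsHerExpansion μ ν c ∧ (∀ κ, c κ ∈ Zt) ∧ ∀ κ, c κ ≠ 0 → κ.size = 2 * μ.size + ν.size := by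
  obtain ⟨c, hc, hc', hsum⟩ := generic_xvar.exists_her_expansion Zt X_mem_Zt μ ν
  exact ⟨c, hsum, hc, hc'⟩

theorem IsAltExpansion.unique {μ : Sig (2 * n)} {ν : Sig n} {c c' : Sig n →₀ Ft}
    (h : IsAltExpansion μ ν c) (h' : IsAltExpansion μ ν c') : c = c' :=
  generic_xvar.expansion_unique (sq_pow_ne_one generic_xvar.map_pow_ne_one)
    ⟨RatFunc.X ^ 2, map_pow _ _ _⟩ (h.symm.trans h')

theorem IsHerExpansion.unique {μ ν : Sig n} {c c' : Sig n →₀ Ft}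
    (h : IsHerExpansion μ ν c) (h' : IsHerExpansion μ ν c') : c = c' :=
  generic_xvar.expansion_unique (neg_pow_ne_one generic_xvar.map_pow_ne_one)
    ⟨-RatFunc.X, map_neg _ _⟩ (h.symm.trans h')

theorem isAltExpansion_altLR (μ : Sig (2 * n)) (ν : Sig n) :
    IsAltExpansion μ ν (altLR μ ν) := by
  have h : ∃ c, IsAltExpansion μ ν c :=
    (exists_isAltExpansion Zlaurent X_mem_Zlaurent μ ν (Or.inr inv_X_mem_Zlaurent)).imp
      fun _ h => h.1
  rw [altLR, dif_pos h]
  exact h.choose_spec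

theorem isHerExpansion_herLR (μ ν : Sig n) : IsHerExpansion μ ν (herLR μ ν) := by
  have h : ∃ c, IsHerExpansion μ ν c := (exists_isHerExpansion μ ν).imp fun _ h => h.1
  rw [herLR, dif_pos h]
  exact h.choose_spec

theorem altLR_mem (R : Subring Ft) (hX : RatFunc.X ∈ R) (μ : Sig (2 * n)) (ν : Sig n)
    (h : μ ∈ SigPos (2 * n) ∨ (RatFunc.X : Ft)⁻¹ ∈ R) (κ : Sig n) : altLR μ ν κ ∈ R := by
  obtain ⟨c, hc, hR, -⟩ := exists_isAltExpansion R hX μ ν h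
  rw [(isAltExpansion_altLR μ ν).unique hc]
  exact hR κ

theorem size_of_altLR_ne_zero {μ : Sig (2 * n)} {ν κ : Sig n} (h : altLR μ ν κ ≠ 0) :
    κ.size = μ.size + ν.size := by
  obtain ⟨c, hc, -, hs⟩ := exists_isAltExpansion Zlaurent X_mem_Zlaurent μ ν
    (Or.inr inv_X_mem_Zlaurent)
  rw [(isAltExpansion_altLR μ ν).unique hc] at h
  exact hs κ h

theorem herLR_mem_Zt (μ ν κ : Sig n) : herLR μ ν κ ∈ Zt := by
  obtain ⟨c, hc, hR, -⟩ := exists_isHerExpansion μ ν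
  rw [(isHerExpansion_herLR μ ν).unique hc]
  exact hR κ

theorem size_of_herLR_ne_zero {μ ν κ : Sig n} (h : herLR μ ν κ ≠ 0) :
    κ.size = 2 * μ.size + ν.size := by
  obtain ⟨c, hc, -, hs⟩ := exists_isHerExpansion μ ν
  rw [(isHerExpansion_herLR μ ν).unique hc] at h
  exact hs κ h

theorem finite_sigPos_size_le (N : ℕ) (d : ℤ) :
    {μ : Sig N | μ ∈ SigPos N ∧ μ.size ≤ d}.Finite := by
  refine Set.Finite.subset (Set.Finite.preimage Subtype.val_injective.injOn
    (Set.finite_Icc (fun _ : Fin N => (0 : ℤ)) (fun _ => d))) ?_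
  rintro μ ⟨h1, h2⟩
  exact ⟨h1, fun i =>
    (Finset.single_le_sum (f := μ.1) (fun i _ => h1 i) (Finset.mem_univ i)).trans h2⟩

theorem finite_altLR_ne_zero (ν l : Sig n) :
    {μ | μ ∈ SigPos (2 * n) ∧ altLR μ ν l ≠ 0}.Finite := by
  refine (finite_sigPos_size_le (2 * n) (l.size - ν.size)).subset ?_
  rintro μ ⟨h1, h2⟩
  have := size_of_altLR_ne_zero h2
  exact ⟨h1, by omega⟩

theorem finite_herLR_ne_zero (ν l : Sig n) : {μ | μ ∈ SigPos n ∧ herLR μ ν l ≠ 0}.Finite := by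
  refine (finite_sigPos_size_le n (l.size - ν.size)).subset ?_
  rintro μ ⟨h1, h2⟩
  have := size_of_herLR_ne_zero h2
  have : 0 ≤ μ.size := Finset.sum_nonneg fun i _ => h1 i
  exact ⟨h1, by omega⟩

end Coefficients
end HallLittlewood
namespace HallLittlewood

/-! ### Skew Cauchy identities after a change of variables -/

section SkewCauchy

theorem Sig.toList_zero (n : ℕ) : (Sig.zero n).toList = List.replicate n 0 := by
  rw [Sig.toList, ← List.ofFn_const]; rfl

theorem apply_interleave {R S : Type*} (f : R → S) {n : ℕ} (a b : Fin n → R) (i : Fin (2 * n)) :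
    f (interleave a b i) = interleave (fun j => f (a j)) (fun j => f (b j)) i := by
  rw [interleave, interleave, apply_ite f]

variable {K A : Type*} [Field K] [CommRing A] [Algebra K A]

theorem isUnit_prod_one_sub {D k : ℕ} {u : Fin k → A} (hu : ∀ i, u i ^ (D + 1) = 0) {n : ℕ}
    (y : Fin n → K) (a : A) : IsUnit (∏ i, ∏ j, (1 - a * u i * algebraMap K A (y j))) := by
  refine IsUnit.prod_iff.2 fun i _ => IsUnit.prod_iff.2 fun j _ => ?_
  refine IsNilpotent.isUnit_one_sub ⟨D + 1, ?_⟩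
  rw [mul_pow, mul_pow, hu, mul_zero, zero_mul]

/-- The skew Cauchy identity in terms of an indexed family of variables. -/
theorem skew_cauchy_hallP {t : K} (ht : ∀ m, 0 < m → t ^ m ≠ 1) {D n k : ℕ} {y : Fin n → K}
    (hy : Function.Injective y) (hy0 : ∀ i, y i ≠ 0) (ν : Sig n) (u : Fin k → A)
    (hu : ∀ i, u i ^ (D + 1) = 0) :
    ∃ S : Finset (Sig n), (∀ l, l ∉ S → skewQ l ν u (algebraMap K A t) = 0) ∧
      (∏ i, ∏ j, (1 - u i * algebraMap K A (y j))) *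
          ∑ l ∈ S, skewQ l ν u (algebraMap K A t) * algebraMap K A (hallP l y t) =
        (∏ i, ∏ j, (1 - algebraMap K A t * u i * algebraMap K A (y j))) *
          algebraMap K A (hallP ν y t) := by
  classical
  have := skew_cauchy ht (Finset.univ.image y) (by simpa using hy0)
    (by rw [Finset.card_image_of_injective _ hy, Finset.card_univ, Fintype.card_fin]) ν u hu
  simpa only [Finset.prod_image hy.injOn, ← hallP_eq_listP ht _ _ hy] using this

theorem hallP_zero {t : K} (ht : ∀ m, 0 < m → t ^ m ≠ 1) {n : ℕ} {y : Fin n → K}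
    (hy : Function.Injective y) (hy0 : ∀ i, y i ≠ 0) : hallP (Sig.zero n) y t = 1 := by
  classical
  have := listP_replicate_zero ht (Finset.univ.image y) (by simpa using hy0)
  rwa [Finset.card_image_of_injective _ hy, Finset.card_univ, Fintype.card_fin,
    ← Sig.toList_zero, ← hallP_eq_listP ht _ _ hy] at this

variable {F : Type*} [Field F] [Algebra F K] {n : ℕ} {τ : F} {y : Fin n → K}

/-- The Cauchy sum over signatures of length `2 n`, at the variables `y_1, y_1 t, …, y_n, y_n t` and
the parameter `t`, times `P_ν` equals the skew Cauchy sum of `P_ν` at the parameter `t ^ 2`: the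
factors `1 - t u y` of the kernel cancel. -/
theorem Generic.alt_cauchy (hG : Generic τ y) {D k : ℕ} (ν : Sig n) (u : Fin k → A)
    (hu : ∀ i, u i ^ (D + 1) = 0) :
    ∃ (S' : Finset (Sig (2 * n))) (S : Finset (Sig n)),
      (∀ μ, μ ∉ S' → skewQ μ (Sig.zero (2 * n)) u (algebraMap K A (algebraMap F K τ)) = 0) ∧
      (∀ κ, κ ∉ S → skewQ κ ν u (algebraMap K A (algebraMap F K τ ^ 2)) = 0) ∧
      (∑ μ ∈ S', skewQ μ (Sig.zero (2 * n)) u (algebraMap K A (algebraMap F K τ)) *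
        algebraMap K A (hallP μ (interleave y fun i => y i * algebraMap F K τ)
          (algebraMap F K τ))) * algebraMap K A (hallP ν y (algebraMap F K τ ^ 2)) =
      ∑ κ ∈ S, skewQ κ ν u (algebraMap K A (algebraMap F K τ ^ 2)) *
        algebraMap K A (hallP κ y (algebraMap F K τ ^ 2)) := by
  have ht : ∀ m, 0 < m → algebraMap F K τ ^ m ≠ 1 := hG.map_pow_ne_one
  set t := algebraMap F K τ
  have ht0 : t ≠ 0 := hG.map_ne_zero
  have hint : Function.Injective (interleave y fun i => y i * t) :=
    interleave_injective hG.injective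
      (fun i j hij => hG.injective (mul_right_cancel₀ ht0 hij)) hG.var_ne_mul
  have hi0 : ∀ i, interleave y (fun i => y i * t) i ≠ 0 := fun i => by
    rw [interleave]
    split_ifs
    exacts [hG.var_ne_zero _, mul_ne_zero (hG.var_ne_zero _) ht0]
  obtain ⟨S', hS', h'⟩ := skew_cauchy_hallP ht hint hi0 (Sig.zero (2 * n)) u hu
  obtain ⟨S, hS, h⟩ := skew_cauchy_hallP (sq_pow_ne_one ht) hG.injective
    hG.var_ne_zero ν u hu
  refine ⟨S', S, hS', hS, ?_⟩
  rw [hallP_zero ht hint hi0, map_one, mul_one] at h'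
  have e : ∀ a i, ∏ j, (1 - a * u i * algebraMap K A (interleave y (fun i => y i * t) j)) =
      (∏ j, (1 - a * u i * algebraMap K A (y j))) *
        ∏ j, (1 - algebraMap K A t * a * u i * algebraMap K A (y j)) := fun a i => by
    rw [prod_interleave _ _ fun z => 1 - a * u i * algebraMap K A z]
    congr 1
    refine Finset.prod_congr rfl fun j _ => ?_
    rw [map_mul]
    ring
  have e1 := fun i => e 1 i
  have e2 := fun i => e (algebraMap K A t) i
  simp only [one_mul, mul_one] at e1
  simp only [e1, e2, Finset.prod_mul_distrib, ← sq] at h'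
  apply (isUnit_prod_one_sub hu y 1).mul_left_cancel
  simp only [one_mul]
  rw [h, ← mul_assoc]
  congr 1
  apply (isUnit_prod_one_sub hu y (algebraMap K A t)).mul_left_cancel
  rw [map_pow, ← h']
  ring

/-- The Cauchy sum at `u_i ^ 2`, at the variables `y_j ^ 2` and the parameter `t ^ 2`, times `P_ν`
equals the skew Cauchy sum of `P_ν` at `u_i` and `-u_i` and the parameter `-t`: in the kernel of
the latter, the factors of `u_i` and of `-u_i` combine to functions of `u_i ^ 2`. -/
theorem Generic.her_cauchy (hG : Generic τ y) {D k : ℕ} (ν : Sig n) (u : Fin k → A)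
    (hu : ∀ i, u i ^ (D + 1) = 0) :
    ∃ S' S : Finset (Sig n),
      (∀ μ, μ ∉ S' → skewQ μ (Sig.zero n) (fun i => u i ^ 2)
        (algebraMap K A (algebraMap F K τ ^ 2)) = 0) ∧
      (∀ κ, κ ∉ S → skewQ κ ν (interleave u fun i => -u i)
        (algebraMap K A (-algebraMap F K τ)) = 0) ∧
      (∑ μ ∈ S', skewQ μ (Sig.zero n) (fun i => u i ^ 2) (algebraMap K A (algebraMap F K τ ^ 2)) *
        algebraMap K A (hallP μ (fun i => y i ^ 2) (algebraMap F K τ ^ 2))) *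
          algebraMap K A (hallP ν y (-algebraMap F K τ)) =
      ∑ κ ∈ S, skewQ κ ν (interleave u fun i => -u i) (algebraMap K A (-algebraMap F K τ)) *
        algebraMap K A (hallP κ y (-algebraMap F K τ)) := by
  have ht : ∀ m, 0 < m → algebraMap F K τ ^ m ≠ 1 := hG.map_pow_ne_one
  set t := algebraMap F K τ
  have hi0 : ∀ i, y i ^ 2 ≠ 0 := fun i => pow_ne_zero _ (hG.var_ne_zero i)
  have hu2 : ∀ i, (u i ^ 2) ^ (D + 1) = 0 := fun i => by
    rw [← pow_mul, mul_comm, pow_mul, hu, zero_pow two_ne_zero]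
  have hui : ∀ i, interleave u (fun i => -u i) i ^ (D + 1) = 0 := fun i => by
    rw [interleave]
    split_ifs
    exacts [hu _, by rw [neg_pow, hu, mul_zero]]
  obtain ⟨S', hS', h'⟩ := skew_cauchy_hallP (sq_pow_ne_one ht) hG.sq_injective hi0
    (Sig.zero n) (fun i => u i ^ 2) hu2
  obtain ⟨S, hS, h⟩ := skew_cauchy_hallP (neg_pow_ne_one ht) hG.injective
    hG.var_ne_zero ν (interleave u fun i => -u i) hui
  refine ⟨S', S, hS', hS, ?_⟩
  rw [hallP_zero (sq_pow_ne_one ht) hG.sq_injective hi0, map_one, mul_one] at h'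
  have e : ∀ a : A, ∏ i, ∏ j, (1 - a * interleave u (fun i => -u i) i * algebraMap K A (y j)) =
      ∏ i, ∏ j, (1 - a ^ 2 * u i ^ 2 * algebraMap K A (y j ^ 2)) := fun a => by
    rw [prod_interleave _ _ fun z => ∏ j, (1 - a * z * algebraMap K A (y j)),
      ← Finset.prod_mul_distrib]
    refine Finset.prod_congr rfl fun i _ => ?_
    rw [← Finset.prod_mul_distrib]
    refine Finset.prod_congr rfl fun j _ => ?_
    rw [map_pow]
    ring
  have e1 := e 1
  simp only [one_mul, one_pow] at e1
  rw [e1, e, ← map_pow, neg_sq] at h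
  have hunit := isUnit_prod_one_sub (u := fun i => u i ^ 2) hu2 (fun j => y j ^ 2) 1
  simp only [one_mul] at hunit
  apply hunit.mul_left_cancel
  rw [h, ← h', mul_assoc]

end SkewCauchy

section Comparison

variable {F K : Type*} [Field F] [Field K] [Algebra F K] {m : ℕ}

theorem coeff_eq_zero_of_sum_eq_zero {ι : Type*} {P : ι → K} (hP : LinearIndependent F P)
    (T : Finset ι) (f : ι → MvPolynomial (Fin m) F) {N : ℕ}
    (h : Ideal.Quotient.mk (MvPolynomial.idealOfVars (Fin m) K ^ N)
      (∑ κ ∈ T, MvPolynomial.map (algebraMap F K) (f κ) * MvPolynomial.C (P κ)) = 0)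
    {s : Fin m →₀ ℕ} (hs : s.degree < N) {κ : ι} (hκ : κ ∈ T) : (f κ).coeff s = 0 := by
  rw [Ideal.Quotient.eq_zero_iff_mem, MvPolynomial.mem_pow_idealOfVars_iff'] at h
  have h1 := h s hs
  simp only [MvPolynomial.coeff_sum, mul_comm _ (MvPolynomial.C (P _)), MvPolynomial.coeff_C_mul,
    MvPolynomial.coeff_map] at h1
  refine linearIndependent_iff'.1 hP T (fun κ => (f κ).coeff s) ?_ κ hκ
  simpa only [Algebra.smul_def, mul_comm] using h1

/-- Comparison of coefficients: if the products `P'_μ p` expand in the linearly independent `P_κ`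
with coefficients `c_{μ κ}`, and `∑_μ q_μ P'_μ p = ∑_κ r_κ P_κ` holds modulo every power of the
ideal of the variables, then `r_l = ∑_μ c_{μ l} q_μ`. -/
theorem finsum_mul_eq {ι ι' : Type*} {P : ι → K} (hP : LinearIndependent F P) (P' : ι' → K) (p : K)
    (c : ι' → ι →₀ F) (hc : ∀ μ, P' μ * p = (c μ).sum fun κ a => algebraMap F K a * P κ)
    (q : ι' → MvPolynomial (Fin m) F) (r : ι → MvPolynomial (Fin m) F) (Pos : Set ι') (l : ι)
    (hfin : {μ | μ ∈ Pos ∧ c μ l ≠ 0}.Finite) (hq : ∀ μ, μ ∉ Pos → q μ = 0)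
    (h : ∀ (D : ℕ) (f : MvPolynomial (Fin m) F →+*
        MvPolynomial (Fin m) K ⧸ MvPolynomial.idealOfVars (Fin m) K ^ (D + 1)),
      f = (Ideal.Quotient.mk _).comp (MvPolynomial.map (algebraMap F K)) →
      ∃ (S' : Finset ι') (S : Finset ι), (∀ μ, μ ∉ S' → f (q μ) = 0) ∧
        (∀ κ, κ ∉ S → f (r κ) = 0) ∧
        (∑ μ ∈ S', f (q μ) * algebraMap K _ (P' μ)) * algebraMap K _ p =
          ∑ κ ∈ S, f (r κ) * algebraMap K _ (P κ)) :
    ∑ᶠ μ ∈ Pos, MvPolynomial.C (c μ l) * q μ = r l := by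
  classical
  ext s
  obtain ⟨S', S, hS', hS, hsum⟩ := h s.degree _ rfl
  set I := MvPolynomial.idealOfVars (Fin m) K ^ (s.degree + 1) with hI
  set T : Finset ι := insert l (S ∪ S'.biUnion fun μ => (c μ).support) with hT
  have hmk : ∀ a : K, algebraMap K (MvPolynomial (Fin m) K ⧸ I) a =
      Ideal.Quotient.mk I (MvPolynomial.C a) := fun _ => rfl
  have hcoeff : ∀ μ, μ ∉ S' → (q μ).coeff s = 0 := by
    intro μ hμ
    have h1 := hS' μ hμ
    rw [RingHom.comp_apply, Ideal.Quotient.eq_zero_iff_mem,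
      MvPolynomial.mem_pow_idealOfVars_iff'] at h1
    have h2 := h1 s (Nat.lt_succ_self _)
    rw [MvPolynomial.coeff_map] at h2
    exact (map_eq_zero _).1 h2
  -- the congruence expands to a linear relation between the `P_κ`
  have key : (r l - ∑ μ ∈ S', MvPolynomial.C (c μ l) * q μ).coeff s = 0 := by
    refine coeff_eq_zero_of_sum_eq_zero hP T
      (fun κ => r κ - ∑ μ ∈ S', MvPolynomial.C (c μ κ) * q μ) (N := s.degree + 1) ?_
      (Nat.lt_succ_self _) (Finset.mem_insert_self _ _)
    have hr : ∑ κ ∈ S, Ideal.Quotient.mk I (MvPolynomial.map (algebraMap F K) (r κ)) *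
          algebraMap K _ (P κ) =
        ∑ κ ∈ T, Ideal.Quotient.mk I (MvPolynomial.map (algebraMap F K) (r κ)) *
          algebraMap K _ (P κ) := by
      refine Finset.sum_subset (fun κ hκ => Finset.mem_insert_of_mem
        (Finset.mem_union_left _ hκ)) fun κ _ hκ => ?_
      have := hS κ hκ
      rw [RingHom.comp_apply] at this
      rw [this, zero_mul]
    have hl : (∑ μ ∈ S', Ideal.Quotient.mk I (MvPolynomial.map (algebraMap F K) (q μ)) *
          algebraMap K _ (P' μ)) * algebraMap K _ p =
        ∑ κ ∈ T, (∑ μ ∈ S', algebraMap K _ (algebraMap F K (c μ κ)) *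
          Ideal.Quotient.mk I (MvPolynomial.map (algebraMap F K) (q μ))) *
            algebraMap K _ (P κ) := by
      simp only [Finset.sum_mul]
      rw [Finset.sum_comm]
      refine Finset.sum_congr rfl fun μ hμ => ?_
      rw [mul_assoc, ← map_mul, hc, Finsupp.sum_of_support_subset _ (s := T)
        (fun κ hκ => Finset.mem_insert_of_mem (Finset.mem_union_right _
          (Finset.mem_biUnion.2 ⟨μ, hμ, hκ⟩))) _ (by simp), map_sum, Finset.mul_sum]
      refine Finset.sum_congr rfl fun κ _ => ?_
      rw [map_mul]
      ring
    simp only [RingHom.comp_apply] at hsum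
    rw [hl, hr] at hsum
    change Ideal.Quotient.mk I _ = 0
    simp only [map_sum, map_mul, map_sub, sub_mul, Finset.sum_sub_distrib, MvPolynomial.map_C,
      ← hmk]
    rw [← hsum, sub_self]
  rw [MvPolynomial.coeff_sub, sub_eq_zero] at key
  have hmem : ∑ᶠ μ ∈ Pos, MvPolynomial.C (c μ l) * q μ =
      ∑ μ ∈ S' ∪ hfin.toFinset, MvPolynomial.C (c μ l) * q μ := by
    refine finsum_mem_eq_sum_of_inter_support_eq _ (Set.ext fun μ => ⟨?_, ?_⟩)
    · rintro ⟨h1, h2⟩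
      refine ⟨Finset.mem_coe.2 (Finset.mem_union_right _
        (hfin.mem_toFinset.2 ⟨h1, fun h => ?_⟩)), h2⟩
      exact h2 (by simp only [h, map_zero, zero_mul])
    · rintro ⟨-, h2⟩
      refine ⟨by_contra fun h => h2 ?_, h2⟩
      simp only [hq μ h, mul_zero]
  rw [hmem, key, MvPolynomial.coeff_sum, MvPolynomial.coeff_sum]
  refine (Finset.sum_subset Finset.subset_union_left fun μ _ hμ => ?_).symm
  rw [MvPolynomial.coeff_C_mul, hcoeff μ hμ, mul_zero]

end Comparison
end HallLittlewood
namespace HallLittlewood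

/-! ### The alternating and Hermitian identities -/

section Identities

theorem skewQ_zero_eq_zero {R : Type*} [CommRing R] {n k : ℕ} {μ : Sig n} (h : μ ∉ SigPos n)
    (x : Fin k → R) (t : R) : skewQ μ (Sig.zero n) x t = 0 := by
  obtain ⟨i, hi⟩ := not_forall.1 h
  exact skewQ_eq_zero_of_not_le (i := i) (not_le.1 hi)

variable {F K : Type*} [Field F] [Field K] [Algebra F K] {n m : ℕ} {τ : F} {y : Fin n → K}

theorem mk_map_X_pow_eq_zero (D : ℕ) (i : Fin m) :
    ((Ideal.Quotient.mk (MvPolynomial.idealOfVars (Fin m) K ^ (D + 1))).comp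
      (MvPolynomial.map (algebraMap F K))) (MvPolynomial.X i) ^ (D + 1) = 0 := by
  rw [RingHom.comp_apply, MvPolynomial.map_X, ← map_pow, Ideal.Quotient.eq_zero_iff_mem]
  have h : MvPolynomial.X i ∈ MvPolynomial.idealOfVars (Fin m) K := Ideal.subset_span ⟨i, rfl⟩
  exact Ideal.pow_mem_pow h _

/-- The reduction of constants is the structure map of the quotient. -/
theorem mk_map_C (D : ℕ) (a : F) :
    ((Ideal.Quotient.mk (MvPolynomial.idealOfVars (Fin m) K ^ (D + 1))).comp
      (MvPolynomial.map (algebraMap F K))) (MvPolynomial.C a) =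
      algebraMap K _ (algebraMap F K a) := by
  rw [RingHom.comp_apply, MvPolynomial.map_C]
  rfl

theorem Generic.alt_identity (hG : Generic τ y) (c : Sig (2 * n) → Sig n →₀ F) (l ν : Sig n)
    (hc : ∀ μ, hallP μ (interleave y fun i => y i * algebraMap F K τ) (algebraMap F K τ) *
      hallP ν y (algebraMap F K τ ^ 2) =
        (c μ).sum fun κ a => algebraMap F K a * hallP κ y (algebraMap F K τ ^ 2))
    (hfin : {μ | μ ∈ SigPos (2 * n) ∧ c μ l ≠ 0}.Finite) :
    ∑ᶠ μ ∈ SigPos (2 * n), MvPolynomial.C (c μ l) * skewQ μ (Sig.zero (2 * n))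
        (MvPolynomial.X : Fin m → MvPolynomial (Fin m) F) (MvPolynomial.C τ) =
      skewQ l ν (MvPolynomial.X : Fin m → MvPolynomial (Fin m) F) (MvPolynomial.C τ ^ 2) := by
  refine finsum_mul_eq (hG.linearIndependent_hallP (sq_pow_ne_one hG.map_pow_ne_one)
    ⟨τ ^ 2, map_pow _ _ _⟩) _ _ c hc _
    (fun κ => skewQ κ ν MvPolynomial.X (MvPolynomial.C τ ^ 2)) _ l hfin
    (fun μ hμ => skewQ_zero_eq_zero hμ _ _) ?_
  rintro D f hf
  have h1 : ∀ i, f (MvPolynomial.X i) ^ (D + 1) = 0 := hf ▸ mk_map_X_pow_eq_zero D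
  have h2 : f (MvPolynomial.C τ) = algebraMap K _ (algebraMap F K τ) := hf ▸ mk_map_C D τ
  simp only [map_skewQ, map_pow, h2]
  simp only [← map_pow (algebraMap K _)]
  exact hG.alt_cauchy ν (fun i => f (MvPolynomial.X i)) h1

theorem Generic.her_identity (hG : Generic τ y) (c : Sig n → Sig n →₀ F) (l ν : Sig n)
    (hc : ∀ μ, hallP μ (fun i => y i ^ 2) (algebraMap F K τ ^ 2) *
      hallP ν y (-algebraMap F K τ) =
        (c μ).sum fun κ a => algebraMap F K a * hallP κ y (-algebraMap F K τ))
    (hfin : {μ | μ ∈ SigPos n ∧ c μ l ≠ 0}.Finite) :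
    ∑ᶠ μ ∈ SigPos n, MvPolynomial.C (c μ l) * skewQ μ (Sig.zero n)
        (fun i : Fin m => (MvPolynomial.X i : MvPolynomial (Fin m) F) ^ 2)
        (MvPolynomial.C τ ^ 2) =
      skewQ l ν (interleave (MvPolynomial.X : Fin m → MvPolynomial (Fin m) F)
        fun i => -MvPolynomial.X i) (-MvPolynomial.C τ) := by
  refine finsum_mul_eq (hG.linearIndependent_hallP (neg_pow_ne_one hG.map_pow_ne_one)
    ⟨-τ, map_neg _ _⟩) _ _ c hc _
    (fun κ => skewQ κ ν (interleave MvPolynomial.X fun i => -MvPolynomial.X i)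
      (-MvPolynomial.C τ)) _ l hfin (fun μ hμ => skewQ_zero_eq_zero hμ _ _) ?_
  rintro D f hf
  have h1 : ∀ i, f (MvPolynomial.X i) ^ (D + 1) = 0 := hf ▸ mk_map_X_pow_eq_zero D
  have h2 : f (MvPolynomial.C τ) = algebraMap K _ (algebraMap F K τ) := hf ▸ mk_map_C D τ
  simp only [map_skewQ, apply_interleave f, map_pow, map_neg, h2]
  simp only [← map_pow (algebraMap K _), ← map_neg (algebraMap K _)]
  exact hG.her_cauchy ν (fun i => f (MvPolynomial.X i)) h1

end Identities
end HallLittlewood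
open HallLittlewood in
theorem mainTheorem2 (m n : ℕ) (l ν : Sig n) :
    -- the alternating coefficients are well defined, and lie in `ℤ[t, t⁻¹]`,
    -- and in `ℤ[t]` for nonnegative `μ`
    (∀ μ : Sig (2 * n), (∃! c, IsAltExpansion μ ν c) ∧
      (∃ k : ℕ, RatFunc.X ^ k * altLR μ ν l ∈ Zt) ∧ (μ ∈ SigPos (2 * n) → altLR μ ν l ∈ Zt)) ∧
    -- the Hermitian coefficients are well defined, and lie in `ℤ[t]`
    (∀ μ : Sig n, (∃! c, IsHerExpansion μ ν c) ∧ herLR μ ν l ∈ Zt) ∧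
    -- both sums have finitely many nonzero terms
    {μ | μ ∈ SigPos (2 * n) ∧ altLR μ ν l ≠ 0}.Finite ∧
    {μ | μ ∈ SigPos n ∧ herLR μ ν l ≠ 0}.Finite ∧
    -- the alternating identity
    (∑ᶠ μ ∈ SigPos (2 * n), MvPolynomial.C (altLR μ ν l) *
        skewQ μ (Sig.zero (2 * n)) (MvPolynomial.X : Fin m → MvPolynomial (Fin m) Ft)
          (MvPolynomial.C RatFunc.X) =
      skewQ l ν (MvPolynomial.X : Fin m → MvPolynomial (Fin m) Ft)
        (MvPolynomial.C RatFunc.X ^ 2)) ∧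
    -- the Hermitian identity
    (∑ᶠ μ ∈ SigPos n, MvPolynomial.C (herLR μ ν l) *
        skewQ μ (Sig.zero n) (fun i : Fin m => (MvPolynomial.X i : MvPolynomial (Fin m) Ft) ^ 2)
          (MvPolynomial.C RatFunc.X ^ 2) =
      skewQ l ν
        (interleave (MvPolynomial.X : Fin m → MvPolynomial (Fin m) Ft) fun i => -MvPolynomial.X i)
        (-MvPolynomial.C RatFunc.X)) := by
  refine ⟨fun μ => ⟨⟨altLR μ ν, isAltExpansion_altLR μ ν, fun c hc => hc.unique
      (isAltExpansion_altLR μ ν)⟩, altLR_mem Zlaurent X_mem_Zlaurent μ ν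
      (Or.inr inv_X_mem_Zlaurent) l, fun hμ => altLR_mem Zt X_mem_Zt μ ν (Or.inl hμ) l⟩,
    fun μ => ⟨⟨herLR μ ν, isHerExpansion_herLR μ ν, fun c hc => hc.unique
      (isHerExpansion_herLR μ ν)⟩, herLR_mem_Zt μ ν l⟩,
    finite_altLR_ne_zero ν l, finite_herLR_ne_zero ν l,
    generic_xvar.alt_identity (fun μ => altLR μ ν) l ν (fun μ => isAltExpansion_altLR μ ν)
      (finite_altLR_ne_zero ν l),
    generic_xvar.her_identity (fun μ => herLR μ ν) l ν (fun μ => isHerExpansion_herLR μ ν)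
      (finite_herLR_ne_zero ν l)⟩
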